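/- A surface is a Hausdorff topological 2-manifold, possibly with boundary and not necessarily orientable; a flow $v$ is a continuous $\mathbb{R}$-action; $O(x)$, $O^{+}(x)$, $O^{-}(x)$ denote the orbit and the positive and negative orbits of $x$; $\operatorname{Sing}(v)$ is the set of fixed points; $\omega(x)$ and $\alpha(x)$ are the usual limit sets. An orbit is closed if it is singular or periodic. A point is recurrent if $x\in\omega(x)\cup\alpha(x)$, and an orbit is recurrent if its points are. $\mathrm{P}(v)$ is the union of the non-closed embedded orbits. A separatrix is a non-singular orbit whose $\alpha$- or $\omega$-limit set is a singular point. A *limit cycle* is a periodic orbit that is the $\omega$- or $\alpha$-limit set of a point outside it. A *limit quasi-circuit* is a closed connected invariant set $\gamma$ that contains a non-recurrent orbit, consists of non-recurrent orbits and singular points, and is a boundary component of an open annulus $A$ such that some $x\in A$ satisfies $O^{+}(x)\subset A$ and $\omega(x)=\gamma$, or $O^{-}(x)\subset A$ and $\alpha(x)=\gamma$. A *limit circuit* is a limit cycle, or a limit quasi-circuit that is a union of separatrices and finitely many singular points and is the image of an oriented circle under a continuous map that follows the separatrices in the direction of the flow. A *Q-set* is the closure of a non-closed recurrent orbit; it is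 *locally dense* if it has nonempty interior, and *transversely Cantor* if near each of its non-singular points it is, in a trivial flow box $[0,1]^2$ (horizontal segments being orbit arcs), of the form $[0,1]\times C$ with $C$ a Cantor set. A *closed transversal* is a simple closed curve that near each of its points is the vertical midline of a trivial flow box; it is *essential* if it is not null-homotopic in the surface obtained by collapsing each boundary component to a point. A *quasi-Q-set* is an $\omega$- or $\alpha$-limit set of a point that meets some essential closed transversal in infinitely many points. **Proposition.** (1) Let $a,b$ be two of the four types: singular point; limit circuit; locally dense Q-set; transversely Cantor Q-set. Unless one of $a,b$ is "locally dense Q-set" and the other is "limit circuit" or "transversely Cantor Q-set", there are a compact surface, a flow on it with finitely many singular points, and a point $x$ with non-closed orbit such that $\alpha(x)$ is of type $a$ and $\omega(x)$ is of type $b$. (2) Let $a,b$ be two of the six types: nowhere dense subset of $\operatorname{Sing}(v)$; limit cycle; limit quasi-circuit; locally dense Q-set; transversely Cantor Q-set; quasi-Q-set contained in $\operatorname{Sing}(v)\sqcup \mathrm{P}(v)$. Unless one of $a,b$ is "locally dense Q-set" and the other is neither "locally dense Q-set" nor "nowhere dense subset of $\operatorname{Sing}(v)$", there are a compact surface, a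 flow $v$ on it, and a point $x$ with non-closed orbit such that $\alpha(x)$ is of type $a$ and $\omega(x)$ is of type $b$. -/

import Mathlib

open Set Filter Topology
open scoped Manifold

namespace SurfaceFlow

section Flows

variable {S : Type*} [TopologicalSpace S]

/-- The ω-limit set of a point. -/
def omegaSet (v : Flow ℝ S) (x : S) : Set S := omegaLimit atTop v {x}

/-- The α-limit set of a point. -/
def alphaSet (v : Flow ℝ S) (x : S) : Set S := omegaLimit atBot v {x}

/-- The positive orbit. -/
def posOrbit (v : Flow ℝ S) (x : S) : Set S := {y | ∃ t : ℝ, 0 < t ∧ v t x = y}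

/-- The negative orbit. -/
def negOrbit (v : Flow ℝ S) (x : S) : Set S := {y | ∃ t : ℝ, t < 0 ∧ v t x = y}

/-- The set of singular points. -/
def singularSet (v : Flow ℝ S) : Set S := {x | ∀ t : ℝ, v t x = x}

/-- Periodic points: there is a positive least period. -/
def IsPeriodicPoint (v : Flow ℝ S) (x : S) : Prop :=
  ∃ T : ℝ, 0 < T ∧ v T x = x ∧ ∀ t ∈ Ioo 0 T, v t x ≠ x

/-- Closed points, that is, points whose orbit is closed: singular or periodic. -/
def IsClosedPoint (v : Flow ℝ S) (x : S) : Prop :=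
  x ∈ singularSet v ∨ IsPeriodicPoint v x

/-- Recurrent points. -/
def IsRecurrentPoint (v : Flow ℝ S) (x : S) : Prop :=
  x ∈ omegaSet v x ∪ alphaSet v x

/-- The union of the non-closed proper (that is, embedded) orbits. -/
def nonclosedProperSet (v : Flow ℝ S) : Set S :=
  {x | ¬ IsClosedPoint v x ∧ IsEmbedding (fun t : ℝ => v t x)}

/-- A point on a separatrix: it is non-singular, and the α-limit set or the ω-limit set of its
orbit is a singular point. -/
def IsSeparatrixPoint (v : Flow ℝ S) (x : S) : Prop :=
  x ∉ singularSet v ∧ ∃ p ∈ singularSet v, omegaSet v x = {p} ∨ alphaSet v x = {p}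

/-- A limit cycle: a periodic orbit that is the ω-limit set or the α-limit set of some point
outside of it. -/
def IsLimitCycle (v : Flow ℝ S) (γ : Set S) : Prop :=
  (∃ p, IsPeriodicPoint v p ∧ γ = v.orbit p) ∧
    ∃ x, x ∉ γ ∧ (omegaSet v x = γ ∨ alphaSet v x = γ)

/-- An open annulus in `S`. -/
def IsOpenAnnulus (A : Set S) : Prop :=
  IsOpen A ∧ Nonempty (A ≃ₜ Ioo (0 : ℝ) 1 × Circle)

/-- `γ` is a boundary component of `A`: a connected component of the frontier of `A`. -/
def IsBoundaryComponent (γ A : Set S) : Prop :=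
  ∃ y ∈ frontier A, γ = connectedComponentIn (frontier A) y

/-- `γ` is closed, connected and invariant, contains a non-recurrent orbit and consists of
non-recurrent orbits and singular points. Together with being a boundary component of an open
annulus, this says that `γ` is a non-trivial quasi-circuit. -/
def IsQuasiCircuitSet (v : Flow ℝ S) (γ : Set S) : Prop :=
  IsClosed γ ∧ IsConnected γ ∧ IsInvariant v γ ∧
    (∃ y ∈ γ, ¬ IsRecurrentPoint v y) ∧
    ∀ y ∈ γ, y ∈ singularSet v ∨ ¬ IsRecurrentPoint v y

/-- A limit quasi-circuit: a non-trivial quasi-circuit which is, for the open annulus `A` that it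
bounds, the ω-limit set of a point of `A` whose positive orbit stays in `A`
(quasi-semi-attracting), or the α-limit set of a point of `A` whose negative orbit stays in `A`
(quasi-semi-repelling). -/
def IsLimitQuasiCircuit (v : Flow ℝ S) (γ : Set S) : Prop :=
  IsQuasiCircuitSet v γ ∧
    ∃ A : Set S, IsOpenAnnulus A ∧ IsBoundaryComponent γ A ∧
      ∃ x ∈ A, (posOrbit v x ⊆ A ∧ omegaSet v x = γ) ∨ (negOrbit v x ⊆ A ∧ alphaSet v x = γ)

/-- `γ` is a union of separatrices and finitely many singular points, and is the image of an
oriented circle (a closed curve, written as a `1`-periodic map on `ℝ`) that runs along the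
separatrices in the direction of the flow. -/
def IsOrientedGraphCircle (v : Flow ℝ S) (γ : Set S) : Prop :=
  (γ ∩ singularSet v).Finite ∧
    (∀ y ∈ γ, y ∈ singularSet v ∨ IsSeparatrixPoint v y) ∧
    ∃ c : ℝ → S, Continuous c ∧ Function.Periodic c 1 ∧ range c = γ ∧
      ∀ s : ℝ, c s ∉ singularSet v → ∃ ε > 0, ∃ τ : ℝ → ℝ,
        ContinuousOn τ (Ioo (s - ε) (s + ε)) ∧ StrictMonoOn τ (Ioo (s - ε) (s + ε)) ∧
          ∀ r ∈ Ioo (s - ε) (s + ε), c r = v (τ r) (c s)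

/-- A limit circuit: a limit cycle, or a limit quasi-circuit that is a closed oriented graph made
of separatrices and finitely many singular points. -/
def IsLimitCircuit (v : Flow ℝ S) (γ : Set S) : Prop :=
  IsLimitCycle v γ ∨ (IsLimitQuasiCircuit v γ ∧ IsOrientedGraphCircle v γ)

/-- A Q-set: the closure of a non-closed recurrent orbit. -/
def IsQSet (v : Flow ℝ S) (Q : Set S) : Prop :=
  ∃ x, ¬ IsClosedPoint v x ∧ IsRecurrentPoint v x ∧ Q = closure (v.orbit x)

/-- A locally dense Q-set: the closure of a non-closed recurrent locally dense orbit. -/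
def IsLocallyDenseQSet (v : Flow ℝ S) (Q : Set S) : Prop :=
  IsQSet v Q ∧ (interior Q).Nonempty

/-- A (parametrized) trivial flow box: an embedded square whose horizontal segments are
orbit arcs. -/
def IsTrivialFlowBox (v : Flow ℝ S) (φ : unitInterval × unitInterval → S) : Prop :=
  IsEmbedding φ ∧ ∀ s s' t, φ (s', t) ∈ v.orbit (φ (s, t))

/-- A Cantor set: non-empty, compact, perfect and totally disconnected (for subsets of an
interval). -/
def IsCantorSubset (C : Set unitInterval) : Prop :=
  C.Nonempty ∧ IsCompact C ∧ Perfect C ∧ IsTotallyDisconnected C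

/-- A transversely Cantor Q-set: near each of its non-singular points it is, in a trivial flow box,
the product of an orbit arc and a Cantor set. -/
def IsTransverselyCantorQSet (v : Flow ℝ S) (Q : Set S) : Prop :=
  IsQSet v Q ∧ ∀ x ∈ Q, x ∉ singularSet v →
    ∃ φ : unitInterval × unitInterval → S, IsTrivialFlowBox v φ ∧ range φ ∈ 𝓝 x ∧
      ∃ C : Set unitInterval, IsCantorSubset C ∧ φ ⁻¹' Q = univ ×ˢ C

/-- The midpoint of the unit interval. -/
noncomputable def midPoint : unitInterval := ⟨1 / 2, by norm_num, by norm_num⟩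

/-- A closed transversal: a simple closed curve which, near each of its points, is the vertical
midline of a trivial flow box. -/
def IsClosedTransversal (v : Flow ℝ S) (c : C(Circle, S)) : Prop :=
  Function.Injective c ∧ ∀ θ : Circle,
    ∃ φ : unitInterval × unitInterval → S, IsTrivialFlowBox v φ ∧ range φ ∈ 𝓝 (c θ) ∧
      φ ⁻¹' (range c) = {midPoint} ×ˢ univ

/-- A nowhere dense subset of the set of singular points. -/
def IsNowhereDenseSingular (v : Flow ℝ S) (A : Set S) : Prop :=
  A ⊆ singularSet v ∧ IsNowhereDense A

end Flows

section Surfaces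

variable (S : Type*) [TopologicalSpace S] [ChartedSpace (EuclideanHalfSpace 2) S]

/-- The boundary of a surface, modelled on the Euclidean half-plane. -/
def surfaceBoundary : Set S := (𝓡∂ 2).boundary S

/-- Two points are identified if they are equal or lie in the same boundary component. -/
def boundarySetoid : Setoid S where
  r x y := x = y ∨ (x ∈ surfaceBoundary S ∧ y ∈ connectedComponentIn (surfaceBoundary S) x)
  iseqv :=
    { refl := fun _ => Or.inl rfl
      symm := by
        rintro x y (rfl | ⟨hx, hy⟩)
        · exact Or.inl rfl
        · refine Or.inr ⟨connectedComponentIn_subset _ _ hy, ?_⟩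
          rw [← connectedComponentIn_eq hy]
          exact mem_connectedComponentIn hx
      trans := by
        rintro x y z (rfl | ⟨hx, hy⟩) (rfl | ⟨hy', hz⟩)
        · exact Or.inl rfl
        · exact Or.inr ⟨hy', hz⟩
        · exact Or.inr ⟨hx, hy⟩
        · refine Or.inr ⟨hx, ?_⟩
          rw [connectedComponentIn_eq hy]
          exact hz }

/-- The closed surface obtained by collapsing every boundary component to a point. -/
abbrev CollapsedSurface : Type _ := Quotient (boundarySetoid S)

/-- The collapsing map. -/
def collapse : C(S, CollapsedSurface S) :=
  ⟨Quotient.mk (boundarySetoid S), continuous_quotient_mk'⟩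

variable {S}

/-- A closed curve is essential if it is not null homotopic in the collapsed surface. -/
def IsEssential (c : C(Circle, S)) : Prop :=
  ¬ ((collapse S).comp c).Nullhomotopic

/-- A quasi-Q-set: an ω-limit or α-limit set of a point that intersects an essential closed
transversal infinitely many times. -/
def IsQuasiQSet (v : Flow ℝ S) (A : Set S) : Prop :=
  (∃ x, A = omegaSet v x ∨ A = alphaSet v x) ∧
    ∃ c : C(Circle, S), IsClosedTransversal v c ∧ IsEssential c ∧ (A ∩ range c).Infinite

end Surfaces

/-- The types of limit sets for flows with finitely many singular points. -/
inductive FiniteSingType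
  | singularPoint
  | limitCircuit
  | locallyDenseQSet
  | transverselyCantorQSet

/-- The types of limit sets for flows with arbitrarily many singular points. -/
inductive GeneralType
  | nowhereDenseSingular
  | limitCycle
  | limitQuasiCircuit
  | locallyDenseQSet
  | transverselyCantorQSet
  | quasiQSet

section Types

variable {S : Type*} [TopologicalSpace S] [ChartedSpace (EuclideanHalfSpace 2) S]

/-- `A` is a limit set of the given type. -/
def FiniteSingType.Holds (v : Flow ℝ S) (A : Set S) : FiniteSingType → Prop
  | .singularPoint => ∃ p ∈ singularSet v, A = {p}
  | .limitCircuit => IsLimitCircuit v A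
  | .locallyDenseQSet => IsLocallyDenseQSet v A
  | .transverselyCantorQSet => IsTransverselyCantorQSet v A

/-- `A` is a limit set of the given type. The last type is that of the quasi-Q-sets that consist
of singular points and non-closed proper orbits. -/
def GeneralType.Holds (v : Flow ℝ S) (A : Set S) : GeneralType → Prop
  | .nowhereDenseSingular => IsNowhereDenseSingular v A
  | .limitCycle => IsLimitCycle v A
  | .limitQuasiCircuit => IsLimitQuasiCircuit v A
  | .locallyDenseQSet => IsLocallyDenseQSet v A
  | .transverselyCantorQSet => IsTransverselyCantorQSet v A
  | .quasiQSet => IsQuasiQSet v A ∧ A ⊆ singularSet v ∪ nonclosedProperSet v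

end Types

/-- The forbidden pairs (α-type, ω-type) for finitely many singular points. -/
def FiniteSingType.Forbidden : FiniteSingType → FiniteSingType → Prop
  | .limitCircuit, .locallyDenseQSet => True
  | .locallyDenseQSet, .limitCircuit => True
  | .locallyDenseQSet, .transverselyCantorQSet => True
  | .transverselyCantorQSet, .locallyDenseQSet => True
  | _, _ => False

/-- The forbidden pairs (α-type, ω-type) for arbitrarily many singular points. -/
def GeneralType.Forbidden : GeneralType → GeneralType → Prop
  | .limitCycle, .locallyDenseQSet => True
  | .limitQuasiCircuit, .locallyDenseQSet => True
  | .locallyDenseQSet, .limitCycle => True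
  | .locallyDenseQSet, .limitQuasiCircuit => True
  | .locallyDenseQSet, .transverselyCantorQSet => True
  | .locallyDenseQSet, .quasiQSet => True
  | .transverselyCantorQSet, .locallyDenseQSet => True
  | .quasiQSet, .locallyDenseQSet => True
  | _, _ => False

end SurfaceFlow

/-! For all pairs without a locally dense Q-set a single construction works: the future and the past
of one orbit are prescribed independently by two circle homeomorphisms, and the flow is then stopped
on a closed set.

The surface is a quotient of the family of saddles p q = kap(y) over the circle, with flow (e^t p,
e^{-t} q). A trajectory leaves with large |p| and re-enters with large |q| of the same sign, while y
is moved by `g true` or `g false` according to that sign (`Step`). Where ‖y‖ ≥ 1/8, kap = 1: p and q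
have equal signs, the trajectory keeps to its sheet, and the sheet looks like the suspension of its
return map (`IsCylinder`). Over y = 0, kap = -1: the orbit through y = 0 with p > 0 comes from the
negative sheet and, if the iterates of 0 stay away from 0, remains in the positive sheet. Its
ω-limit set is the suspension of the limit set of 0 under `g true` (`IsCylinder.omegaSet_eq`). Both
maps are conjugate to their inverses by y ↦ -y, so (y, p, q) ↦ (-y, q, p) reverses the flow, and the
α-limit set is found in the same way from `g false`.

Two return maps suffice. `hyp` has one fixed point 1/2, which attracts 0, and yields a limit cycle.
`denjoy` has 0 in the middle of a gap and yields a transversely Cantor Q-set. The other types come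
from a time change (`exists_isTimeChange`). Stopping at a point of the orbit gives a singular point.
Stopping at one point of the limit cycle gives a limit quasi-circuit, bounding the annulus of
`IsCylinder.exists_annulus`. Stopping on a cross section of the suspended Cantor set gives a
quasi-Q-set of singular points and embedded orbits; its transversal is essential because the
transverse coordinate extends to the whole surface (`exists_transverse_coordinate`).

Locally dense Q-sets come from the irrational flow on the torus, unchanged or stopped at one point.
Finitely many singular points are obtained from the same flows, since only the quasi-Q-set needs an
infinite stopping set. -/

namespace SurfaceFlow

/-! ### Time changes that stop a flow on a closed set -/

section TimeChange

variable {X : Type*} [TopologicalSpace X]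

/-- `u` is a time change of `v` that stops exactly at the points of `Z`. -/
def IsTimeChange (v u : Flow ℝ X) (Z : Set X) : Prop :=
  ∀ x, ∃ τ : ℝ → ℝ, (∀ t, u t x = v (τ t) x) ∧ τ 0 = 0 ∧ (x ∈ Z → ∀ t, τ t = 0) ∧
    (x ∉ Z → StrictMono τ ∧ Continuous τ ∧
      range τ = {s | ∀ r ∈ uIcc 0 s, v r x ∉ Z})

lemma isTimeChange_refl (v : Flow ℝ X) : IsTimeChange v v ∅ := fun x =>
  ⟨id, fun _ => rfl, rfl, fun h => h.elim, fun _ => ⟨strictMono_id, continuous_id, by simp⟩⟩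

lemma IsTimeChange.reverse {v u : Flow ℝ X} {Z : Set X} (h : IsTimeChange v u Z) :
    IsTimeChange v.reverse u.reverse Z := by
  intro x
  obtain ⟨τ, h1, h0, h2, h3⟩ := h x
  refine ⟨fun t => -τ (-t), fun t => by simp [h1], by simp [h0], fun hx t => by simp [h2 hx],
    fun hx => ?_⟩
  obtain ⟨hm, hc, hr⟩ := h3 hx
  refine ⟨fun a b hab => neg_lt_neg (hm (neg_lt_neg hab)), by fun_prop, ?_⟩
  ext s
  have : s ∈ range (fun t => -τ (-t)) ↔ -s ∈ range τ := by
    constructor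
    · rintro ⟨t, rfl⟩
      exact ⟨-t, by simp⟩
    · rintro ⟨t, ht⟩
      exact ⟨-t, by simp [ht]⟩
  rw [this, hr]
  simp only [mem_ofPred_eq, Flow.reverse_apply]
  constructor
  · intro H r hr'
    refine H (-r) ?_
    rw [mem_uIcc] at hr' ⊢
    grind
  · intro H r hr'
    have := H (-r) (by rw [mem_uIcc] at hr' ⊢; grind)
    rwa [neg_neg] at this

/-- A continuous function that vanishes exactly on a closed set and is Lipschitz along a flow. -/
lemma exists_lipschitz_along_flow [CompactSpace X] [TopologicalSpace.MetrizableSpace X]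
    (v : Flow ℝ X) {Z : Set X} (hZ : IsClosed Z) (hne : Z.Nonempty) :
    ∃ f : X → ℝ, Continuous f ∧ (∀ x, 0 ≤ f x) ∧ (∀ x, f x ≤ 1) ∧ (∀ x, f x = 0 ↔ x ∈ Z) ∧
      ∀ x r, f x ≤ f (v r x) + |r| := by
  let _ := TopologicalSpace.metrizableSpaceMetric X
  set d : X → ℝ := fun x => min 1 (Metric.infDist x Z) with hd
  have dc : Continuous d := continuous_const.min (Metric.continuous_infDist_pt Z)
  have d0 : ∀ x, 0 ≤ d x := fun x => le_min zero_le_one Metric.infDist_nonneg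
  have d1 : ∀ x, d x ≤ 1 := fun x => min_le_left _ _
  have dz : ∀ x, d x = 0 ↔ x ∈ Z := by
    intro x
    rw [hZ.mem_iff_infDist_zero hne]
    constructor
    · intro h
      rcases min_choice 1 (Metric.infDist x Z) with h' | h'
      · simp only [hd, h'] at h
        norm_num at h
      · simpa only [hd, h'] using h
    · intro h
      simp [hd, h]
  set F : X → ℝ → ℝ := fun x s => |s| + d (v s x) with hF
  have Fc : Continuous ↿F := by
    change Continuous fun p : X × ℝ => |p.2| + d (v p.2 p.1)
    exact continuous_snd.abs.add (dc.comp (v.continuous continuous_snd continuous_fst))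
  -- Inf-convolution along orbits makes f 1-Lipschitz in time. Since d ≤ 1, parameters outside [-1,
  -- 1] never beat s = 0, so the compact interval suffices and the infimum is attained.
  set f : X → ℝ := fun x => sInf (F x '' Icc (-1) 1) with hf
  have fc : Continuous f := isCompact_Icc.continuous_sInf Fc
  have att : ∀ x, ∃ s ∈ Icc (-1 : ℝ) 1, f x = F x s := by
    intro x
    have hcont : ContinuousOn (F x) (Icc (-1) 1) :=
      (Fc.comp (by fun_prop : Continuous fun s : ℝ => (x, s))).continuousOn
    obtain ⟨s, hs, h1, -⟩ := isCompact_Icc.exists_sInf_image_eq_and_le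
      (nonempty_Icc.2 (by norm_num)) hcont
    exact ⟨s, hs, h1⟩
  have bdd : ∀ x, BddBelow (F x '' Icc (-1) 1) := fun x => ⟨0, by
    rintro _ ⟨s, -, rfl⟩
    exact add_nonneg (abs_nonneg s) (d0 _)⟩
  have fle : ∀ x s, f x ≤ F x s := by
    intro x s
    by_cases hs : s ∈ Icc (-1 : ℝ) 1
    · exact csInf_le (bdd x) ⟨s, hs, rfl⟩
    · have h1 : f x ≤ F x 0 := csInf_le (bdd x) ⟨0, by norm_num, rfl⟩
      have h2 : F x 0 ≤ 1 := by simp [hF, d1]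
      have h3 : 1 ≤ |s| := by
        rw [mem_Icc, ← abs_le, not_le] at hs
        exact hs.le
      have := d0 (v s x)
      simp only [hF] at *
      linarith
  refine ⟨f, fc, fun x => ?_, fun x => ?_, fun x => ⟨fun h => ?_, fun h => ?_⟩, fun x r => ?_⟩
  · obtain ⟨s, -, hs⟩ := att x
    rw [hs]
    exact add_nonneg (abs_nonneg s) (d0 _)
  · refine (fle x 0).trans ?_
    simp [hF, d1]
  · obtain ⟨s, -, hs⟩ := att x
    rw [h] at hs
    have h1 := d0 (v s x)
    have h2 := abs_nonneg s
    have h3 : |s| = 0 := by simp only [hF] at hs; linarith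
    have h4 : s = 0 := abs_eq_zero.1 h3
    subst h4
    simp only [hF, abs_zero, zero_add, Flow.map_zero, id] at hs
    exact (dz x).1 hs.symm
  · refine le_antisymm ((fle x 0).trans ?_) ?_
    · simp [hF, (dz x).2 h]
    · obtain ⟨s, -, hs⟩ := att x
      rw [hs]
      exact add_nonneg (abs_nonneg s) (d0 _)
  · obtain ⟨s, -, hs⟩ := att (v r x)
    rw [hs]
    have h1 := fle x (s + r)
    simp only [hF, Flow.map_add] at h1 ⊢
    have := abs_add_le s r
    linarith

/-- A bounded globally Lipschitz vector field has global integral curves. -/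
lemma exists_global_solution {E : Type*} [NormedAddCommGroup E] [NormedSpace ℝ E] [CompleteSpace E]
    (V : E → E) (hV : LipschitzWith 1 V) (hb : ∀ x, ‖V x‖ ≤ 1) (x₀ : E) :
    ∃ α : ℝ → E, α 0 = x₀ ∧ ∀ t, HasDerivAt α (V (α t)) t := by
  have loc : ∀ n : ℕ, ∃ α : ℝ → E, α 0 = x₀ ∧
      ∀ t ∈ Ioo (-((n : ℝ) + 1)) (n + 1), HasDerivAt α (V (α t)) t := by
    intro n
    have h0 : (0 : ℝ) ∈ Icc (-((n : ℝ) + 1)) (n + 1) := ⟨by linarith [n.cast_nonneg (α := ℝ)],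
      by linarith [n.cast_nonneg (α := ℝ)]⟩
    -- The field is bounded by 1, so during time n + 1 a solution stays in the ball of radius n + 1.
    have hp : IsPicardLindelof (fun _ => V) (⟨0, h0⟩ : Icc (-((n : ℝ) + 1)) (n + 1)) x₀
        (n + 1 : NNReal) 0 1 1 :=
      { lipschitzOnWith := fun t _ => hV.lipschitzOnWith
        continuousOn := fun x _ => continuousOn_const
        norm_le := fun t _ x _ => by simpa using hb x
        mul_max_le := by simp }
    obtain ⟨α, h1, h2⟩ := hp.exists_eq_forall_mem_Icc_hasDerivWithinAt₀
    exact ⟨α, h1, fun t ht => (h2 t (Ioo_subset_Icc_self ht)).hasDerivAt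
      (Icc_mem_nhds ht.1 ht.2)⟩
  choose α h0 hα using loc
  have agree : ∀ n m : ℕ, n ≤ m → EqOn (α n) (α m) (Ioo (-((n : ℝ) + 1)) (n + 1)) := by
    intro n m hnm
    have hnm' : (n : ℝ) ≤ m := by exact_mod_cast hnm
    refine ODE_solution_unique_of_mem_Ioo (v := fun _ => V) (s := fun _ => univ) (K := 1)
      (fun t _ => hV.lipschitzOnWith) (t₀ := 0) ?_ (fun t ht => ⟨hα n t ht, trivial⟩)
      (fun t ht => ⟨hα m t ⟨by linarith [ht.1], by linarith [ht.2]⟩, trivial⟩)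
      (by rw [h0, h0])
    constructor <;> linarith [n.cast_nonneg (α := ℝ)]
  have mem : ∀ t : ℝ, t ∈ Ioo (-((⌈|t|⌉₊ : ℝ) + 1)) (⌈|t|⌉₊ + 1) := by
    intro t
    have := Nat.le_ceil |t|
    have := abs_le.1 this
    constructor <;> linarith [this.1, this.2]
  -- The solution with index ⌈|t|⌉ is defined on an open interval around t, and solutions of
  -- different indices agree where both are defined.
  refine ⟨fun t => α ⌈|t|⌉₊ t, by simp [h0], fun t => ?_⟩
  refine (hα _ t (mem t)).congr_of_eventuallyEq ?_
  filter_upwards [isOpen_Ioo.mem_nhds (mem t)] with s hs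
  rcases le_total ⌈|s|⌉₊ ⌈|t|⌉₊ with h | h
  · exact agree _ _ h (mem s)
  · exact (agree _ _ h hs).symm

lemma ode_unique {F a b : ℝ → ℝ} (hF : LipschitzWith 1 F) (ha : ∀ t, HasDerivAt a (F (a t)) t)
    (hb : ∀ t, HasDerivAt b (F (b t)) t) {t₀ : ℝ} (h : a t₀ = b t₀) : a = b :=
  ODE_solution_unique_univ (v := fun _ => F) (s := fun _ => univ) (K := 1)
    (fun _ => hF.lipschitzOnWith) (fun t => ⟨ha t, trivial⟩) (fun t => ⟨hb t, trivial⟩) h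

/-- A solution of a scalar autonomous equation runs through the whole interval on which the right
hand side is positive. -/
lemma mem_range_of_pos {F a : ℝ → ℝ} (hF : Continuous F) (ha : ∀ t, HasDerivAt a (F (a t)) t)
    (h0 : a 0 = 0) {s : ℝ} (hs : 0 ≤ s) (hpos : ∀ r ∈ Icc 0 s, 0 < F r) (hnn : ∀ r, 0 ≤ F r) :
    s ∈ range a := by
  obtain ⟨r₀, hr₀, hmin⟩ := isCompact_Icc.exists_isMinOn (nonempty_Icc.2 hs) hF.continuousOn
  set c := F r₀
  have hc : 0 < c := hpos _ hr₀
  have hac : Continuous a := continuous_iff_continuousAt.2 fun t => (ha t).continuousAt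
  have hmono : Monotone a := monotone_of_deriv_nonneg (fun t => (ha t).differentiableAt)
    (fun t => by rw [(ha t).deriv]; exact hnn _)
  by_contra hns
  have hlt : ∀ t, a t < s := by
    intro t
    by_contra hcon
    rw [not_lt] at hcon
    have ht : 0 ≤ t := by
      by_contra ht
      have := hmono (not_le.1 ht).le
      rw [h0] at this
      apply hns
      exact ⟨0, by rw [h0]; linarith⟩
    obtain ⟨z, -, hz⟩ := intermediate_value_Icc ht hac.continuousOn ⟨by rw [h0]; exact hs, hcon⟩
    exact hns ⟨z, hz⟩
  -- A solution that never reached s would have speed at least c during [0, s / c], which carries it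
  -- as far as s.
  have key : c * (s / c - 0) ≤ a (s / c) - a 0 := by
    refine (convex_Icc (0 : ℝ) (s / c)).mul_sub_le_image_sub_of_le_deriv hac.continuousOn
      (fun t _ => (ha t).differentiableAt.differentiableWithinAt) (fun t ht => ?_) 0
      (left_mem_Icc.2 (by positivity)) (s / c) (right_mem_Icc.2 (by positivity)) (by positivity)
    rw [interior_Icc] at ht
    rw [(ha t).deriv]
    refine hmin ⟨?_, (hlt t).le⟩
    rw [← h0]
    exact hmono ht.1.le
  rw [h0, sub_zero, sub_zero, mul_div_cancel₀ _ hc.ne'] at key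
  exact absurd (hlt (s / c)) (not_lt.2 key)

/-- The new time solves T' = f(v(T, x)), T(0) = 0, for all x at once, as one ODE in the Banach space
C(X, ℝ); joint continuity in time and space is then automatic. Scalar uniqueness gives the cocycle
identity and keeps orbits from reaching Z in finite time. -/
lemma exists_isTimeChange [CompactSpace X] [TopologicalSpace.MetrizableSpace X]
    (v : Flow ℝ X) {Z : Set X} (hZ : IsClosed Z) : ∃ u : Flow ℝ X, IsTimeChange v u Z := by
  rcases Z.eq_empty_or_nonempty with rfl | hne
  · exact ⟨v, isTimeChange_refl v⟩
  obtain ⟨f, fc, f0, f1, fz, fl⟩ := exists_lipschitz_along_flow v hZ hne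
  have lipx : ∀ x, LipschitzWith 1 fun s => f (v s x) := by
    intro x
    refine LipschitzWith.of_dist_le_mul fun a b => ?_
    rw [Real.dist_eq, Real.dist_eq, NNReal.coe_one, one_mul, abs_le]
    have h1 := fl (v a x) (b - a)
    have h2 := fl (v b x) (a - b)
    rw [← v.map_add, sub_add_cancel] at h1 h2
    rw [abs_sub_comm] at h1
    constructor <;> linarith
  have Vc : ∀ φ : C(X, ℝ), Continuous fun x => f (v (φ x) x) := fun φ =>
    fc.comp (v.continuous φ.continuous continuous_id)
  let V : C(X, ℝ) → C(X, ℝ) := fun φ => ⟨fun x => f (v (φ x) x), Vc φ⟩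
  have hV : LipschitzWith 1 V := by
    refine LipschitzWith.of_dist_le_mul fun φ ψ => ?_
    rw [NNReal.coe_one, one_mul, ContinuousMap.dist_le dist_nonneg]
    intro x
    have := (lipx x).dist_le_mul (φ x) (ψ x)
    rw [NNReal.coe_one, one_mul] at this
    exact this.trans (ContinuousMap.dist_apply_le_dist x)
  have hb : ∀ φ, ‖V φ‖ ≤ 1 := by
    intro φ
    rw [ContinuousMap.norm_le _ zero_le_one]
    intro x
    change ‖f (v (φ x) x)‖ ≤ 1
    rw [Real.norm_of_nonneg (f0 _)]
    exact f1 _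
  obtain ⟨T, T0, hT⟩ := exists_global_solution V hV hb 0
  have Td : ∀ x t, HasDerivAt (fun t => T t x) (f (v (T t x) x)) t := by
    intro x t
    exact (ContinuousMap.evalCLM ℝ x : C(X, ℝ) →L[ℝ] ℝ).hasFDerivAt.comp_hasDerivAt t (hT t)
  have T0' : ∀ x, T 0 x = 0 := fun x => by rw [T0]; rfl
  have Tc : Continuous fun p : ℝ × X => T p.1 p.2 := by
    have h : Continuous T := continuous_iff_continuousAt.2 fun t => (hT t).continuousAt
    exact (ContinuousEval.continuous_eval (F := C(X, ℝ))).comp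
      ((h.comp continuous_fst).prodMk continuous_snd)
  have Tadd : ∀ x s t, T (t + s) x = T t (v (T s x) x) + T s x := by
    intro x s t
    have := ode_unique (F := fun r => f (v r x)) (a := fun t => T (t + s) x)
      (b := fun t => T t (v (T s x) x) + T s x) (lipx x)
      (fun t => by
        have := (Td x (t + s)).comp_add_const t s
        exact this)
      (fun t => by
        have := (Td (v (T s x) x) t).add_const (T s x)
        rwa [← v.map_add] at this) (t₀ := 0) (by simp [T0'])
    exact congrFun this t
  let u : Flow ℝ X :=
    { toFun := fun t x => v (T t x) x
      cont' := v.continuous Tc continuous_snd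
      map_add' := fun t s x => by rw [Tadd, v.map_add]
      map_zero' := fun x => by rw [T0', v.map_zero_apply] }
  refine ⟨u, fun x => ⟨fun t => T t x, fun t => rfl, T0' x, fun hx t => ?_, fun hx => ?_⟩⟩
  · have := ode_unique (F := fun r => f (v r x)) (a := fun t => T t x) (b := fun _ => 0) (lipx x)
      (Td x) (fun t => by
        have h : f (v 0 x) = 0 := by rw [v.map_zero_apply]; exact (fz x).2 hx
        simp only [h]
        exact hasDerivAt_const t 0) (t₀ := 0) (T0' x)
    exact congrFun this t
  -- If f vanished at time t, the constant T t x would be a solution as well; by uniqueness T would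
  -- be constant in time, hence 0, and x would lie in Z.
  · have pos : ∀ t, 0 < f (v (T t x) x) := by
      intro t
      refine lt_of_le_of_ne (f0 _) fun h0 => ?_
      have := ode_unique (F := fun r => f (v r x)) (a := fun t => T t x) (b := fun _ => T t x)
        (lipx x) (Td x) (fun s => by
          change HasDerivAt (fun _ : ℝ => T t x) (f (v (T t x) x)) s
          rw [← h0]
          exact hasDerivAt_const s _) (t₀ := t) rfl
      have h1 := congrFun this 0
      simp only [T0'] at h1
      rw [← h1, v.map_zero_apply] at h0
      exact hx ((fz x).1 h0.symm)
    have hm : StrictMono fun t => T t x :=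
      strictMono_of_deriv_pos fun t => by rw [(Td x t).deriv]; exact pos t
    have hc : Continuous fun t => T t x :=
      continuous_iff_continuousAt.2 fun t => (Td x t).continuousAt
    refine ⟨hm, hc, ?_⟩
    ext s
    constructor
    · rintro ⟨t, rfl⟩ r hr
      have hoc : (range fun t => T t x).OrdConnected := (isPreconnected_range hc).ordConnected
      have hr' : r ∈ range fun t => T t x := hoc.uIcc_subset ⟨0, T0' x⟩ ⟨t, rfl⟩ hr
      obtain ⟨t', rfl⟩ := hr'
      intro hz
      exact (pos t').ne' ((fz _).2 hz)
    · intro H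
      have Fc : Continuous fun r => f (v r x) := (lipx x).continuous
      rcases le_total 0 s with hs | hs
      · refine mem_range_of_pos Fc (Td x) (T0' x) hs (fun r hr => ?_) (fun r => f0 _)
        refine lt_of_le_of_ne (f0 _) fun h => H r ?_ ((fz _).1 h.symm)
        rwa [uIcc_of_le hs]
      · have := mem_range_of_pos (F := fun r => f (v (-r) x)) (a := fun t => -T (-t) x) (s := -s)
          (Fc.comp continuous_neg) (fun t => by
            have h := ((Td x (-t)).scomp t (hasDerivAt_neg t)).neg
            exact h.congr_deriv (by simp)) (by simp [T0']) (by linarith)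
          (fun r hr => ?_) (fun r => f0 _)
        · obtain ⟨t, ht⟩ := this
          exact ⟨-t, neg_injective ht⟩
        · refine lt_of_le_of_ne (f0 _) fun h => H (-r) ?_ ((fz _).1 h.symm)
          rw [uIcc_of_ge hs]
          exact ⟨by linarith [hr.2], by linarith [hr.1]⟩

end TimeChange

end SurfaceFlow

namespace SurfaceFlow

/-! ### Invariance of the notions under time reversal -/

section Reversal

variable {S : Type*} [TopologicalSpace S] (v : Flow ℝ S)

lemma mem_omegaSet {v : Flow ℝ S} {x y : S} :
    y ∈ omegaSet v x ↔ MapClusterPt y atTop fun t => v t x :=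
  mem_omegaLimit_singleton_iff_mapClusterPt ..

lemma mem_alphaSet {v : Flow ℝ S} {x y : S} :
    y ∈ alphaSet v x ↔ MapClusterPt y atBot fun t => v t x :=
  mem_omegaLimit_singleton_iff_mapClusterPt ..

@[simp] lemma omegaSet_reverse (x : S) : omegaSet v.reverse x = alphaSet v x := by
  ext y
  rw [mem_omegaSet, mem_alphaSet, MapClusterPt, MapClusterPt, ← map_neg_atTop, map_map]
  rfl

lemma reverse_reverse : v.reverse.reverse = v := by
  ext t x
  simp

@[simp] lemma alphaSet_reverse (x : S) : alphaSet v.reverse x = omegaSet v x := by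
  conv_rhs => rw [← reverse_reverse v]
  rw [omegaSet_reverse]

@[simp] lemma singularSet_reverse : singularSet v.reverse = singularSet v := by
  ext x
  exact ⟨fun h t => by simpa using h (-t), fun h t => h (-t)⟩

lemma isPeriodicPoint_reverse_of {x : S} (h : IsPeriodicPoint v x) :
    IsPeriodicPoint v.reverse x := by
  obtain ⟨T, hT, h1, h2⟩ := h
  have inv : ∀ t, v (-t) x = x → v t x = x := fun t ht => by
    conv_lhs => rw [← ht]
    rw [← v.map_add, add_neg_cancel, v.map_zero_apply]
  exact ⟨T, hT, inv (-T) (by rwa [neg_neg]), fun t ht h => h2 t ht (inv t h)⟩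

@[simp] lemma isPeriodicPoint_reverse {x : S} :
    IsPeriodicPoint v.reverse x ↔ IsPeriodicPoint v x :=
  ⟨fun h => by simpa [reverse_reverse] using isPeriodicPoint_reverse_of v.reverse h,
    isPeriodicPoint_reverse_of v⟩

@[simp] lemma orbit_reverse (x : S) : v.reverse.orbit x = v.orbit x := by
  ext y
  exact ⟨fun ⟨t, ht⟩ => ⟨-t, ht⟩, fun ⟨t, ht⟩ => ⟨-t, by
    change v (- -t) x = y
    rw [neg_neg]
    exact ht⟩⟩

@[simp] lemma isClosedPoint_reverse {x : S} : IsClosedPoint v.reverse x ↔ IsClosedPoint v x := by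
  simp [IsClosedPoint]

@[simp] lemma isRecurrentPoint_reverse {x : S} :
    IsRecurrentPoint v.reverse x ↔ IsRecurrentPoint v x := by
  simp [IsRecurrentPoint, or_comm]

@[simp] lemma nonclosedProperSet_reverse : nonclosedProperSet v.reverse = nonclosedProperSet v := by
  have key : ∀ w : Flow ℝ S, nonclosedProperSet w ⊆ nonclosedProperSet w.reverse := by
    rintro w x ⟨h1, h2⟩
    exact ⟨by simpa using h1, h2.comp (Homeomorph.neg ℝ).isEmbedding⟩
  refine Subset.antisymm ?_ (key v)
  simpa [reverse_reverse] using key v.reverse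

@[simp] lemma isLimitCycle_reverse {γ : Set S} : IsLimitCycle v.reverse γ ↔ IsLimitCycle v γ := by
  simp [IsLimitCycle, or_comm]

lemma isInvariant_reverse {γ : Set S} : IsInvariant v.reverse γ ↔ IsInvariant v γ :=
  ⟨fun h t x hx => by simpa using h (-t) hx, fun h t x hx => h (-t) hx⟩

@[simp] lemma isQuasiCircuitSet_reverse {γ : Set S} :
    IsQuasiCircuitSet v.reverse γ ↔ IsQuasiCircuitSet v γ := by
  simp [IsQuasiCircuitSet, isInvariant_reverse]

@[simp] lemma posOrbit_reverse (x : S) : posOrbit v.reverse x = negOrbit v x := by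
  ext y
  exact ⟨fun ⟨t, h, ht⟩ => ⟨-t, by linarith, ht⟩, fun ⟨t, h, ht⟩ => ⟨-t, by linarith, by simpa using ht⟩⟩

@[simp] lemma negOrbit_reverse (x : S) : negOrbit v.reverse x = posOrbit v x := by
  rw [← posOrbit_reverse, reverse_reverse]

@[simp] lemma isLimitQuasiCircuit_reverse {γ : Set S} :
    IsLimitQuasiCircuit v.reverse γ ↔ IsLimitQuasiCircuit v γ := by
  simp [IsLimitQuasiCircuit, or_comm]

@[simp] lemma isQSet_reverse {Q : Set S} : IsQSet v.reverse Q ↔ IsQSet v Q := by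
  simp [IsQSet]

@[simp] lemma isTrivialFlowBox_reverse {φ : unitInterval × unitInterval → S} :
    IsTrivialFlowBox v.reverse φ ↔ IsTrivialFlowBox v φ := by
  simp [IsTrivialFlowBox]

lemma nowhereDenseSingular_reverse {A : Set S} :
    IsNowhereDenseSingular v.reverse A ↔ IsNowhereDenseSingular v A := by
  simp [IsNowhereDenseSingular]

lemma isTransverselyCantorQSet_reverse {A : Set S} :
    IsTransverselyCantorQSet v.reverse A ↔ IsTransverselyCantorQSet v A := by
  simp [IsTransverselyCantorQSet]

variable [ChartedSpace (EuclideanHalfSpace 2) S]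

lemma isQuasiQSet_reverse {A : Set S} : IsQuasiQSet v.reverse A ↔ IsQuasiQSet v A := by
  simp [IsQuasiQSet, IsClosedTransversal, or_comm]

lemma generalType_holds_reverse {A : Set S} (a : GeneralType) :
    a.Holds v.reverse A ↔ a.Holds v A := by
  cases a <;> simp [GeneralType.Holds, nowhereDenseSingular_reverse, IsLocallyDenseQSet,
    isTransverselyCantorQSet_reverse, isQuasiQSet_reverse]

end Reversal

/-! ### Limit sets and singular points after a time change -/

section TimeChangeConsequences

variable {S : Type*} [TopologicalSpace S] {v u : Flow ℝ S} {Z : Set S}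

namespace IsTimeChange

variable (h : IsTimeChange v u Z)
include h

lemma mem_singularSet {x : S} (hx : x ∈ Z) : x ∈ singularSet u := by
  obtain ⟨τ, h1, h0, h2, -⟩ := h x
  intro t
  rw [h1, h2 hx, v.map_zero_apply]

lemma mem_orbit {x : S} {s : ℝ} (hs : ∀ r ∈ uIcc 0 s, v r x ∉ Z) : v s x ∈ u.orbit x := by
  obtain ⟨τ, h1, h0, -, h3⟩ := h x
  have hx : x ∉ Z := by simpa using hs 0 left_mem_uIcc
  obtain ⟨-, -, hr⟩ := h3 hx
  have : s ∈ range τ := by rw [hr]; exact hs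
  obtain ⟨t, rfl⟩ := this
  exact ⟨t, h1 t⟩

lemma orbit_subset (x : S) : u.orbit x ⊆ v.orbit x := by
  obtain ⟨τ, h1, -⟩ := h x
  rintro _ ⟨t, rfl⟩
  exact ⟨τ t, (h1 t).symm⟩

lemma orbit_eq {x : S} (hx : ∀ s, v s x ∉ Z) : u.orbit x = v.orbit x := by
  refine (h.orbit_subset x).antisymm ?_
  rintro _ ⟨t, rfl⟩
  exact h.mem_orbit fun r _ => hx r

lemma tendsto_atTop {x : S} (hx : ∀ s, 0 ≤ s → v s x ∉ Z) :
    ∃ τ : ℝ → ℝ, (∀ t, u t x = v (τ t) x) ∧ τ 0 = 0 ∧ StrictMono τ ∧ Continuous τ ∧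
      Ici 0 ⊆ range τ := by
  obtain ⟨τ, h1, h0, -, h3⟩ := h x
  obtain ⟨hm, hc, hr⟩ := h3 (by simpa using hx 0 le_rfl)
  refine ⟨τ, h1, h0, hm, hc, fun s hs => ?_⟩
  rw [hr]
  intro r hr
  rw [uIcc_of_le hs] at hr
  exact hx r hr.1

/-- The new time covers [0, ∞), so it is an increasing reparametrization that tends to infinity in
the future. -/
lemma omegaSet_eq {x : S} (hx : ∀ s, 0 ≤ s → v s x ∉ Z) : omegaSet u x = omegaSet v x := by
  obtain ⟨τ, h1, h0, hm, hc, hr⟩ := h.tendsto_atTop hx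
  have hτ : Tendsto τ atTop atTop := by
    refine hm.monotone.tendsto_atTop_atTop fun b => ?_
    obtain ⟨t, ht⟩ := hr (show max b 0 ∈ Ici (0 : ℝ) from mem_Ici.2 (le_max_right _ _))
    exact ⟨t, ht ▸ le_max_left _ _⟩
  ext y
  rw [mem_omegaSet, mem_omegaSet]
  simp only [h1]
  refine ⟨fun H => MapClusterPt.of_comp hτ H, fun H => ?_⟩
  rw [mapClusterPt_iff_frequently] at H ⊢
  intro U hU
  rw [frequently_atTop]
  intro a
  obtain ⟨b, hb, hbU⟩ := frequently_atTop.1 (H U hU) (max (τ a) 0)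
  obtain ⟨t, rfl⟩ := hr (show b ∈ Ici (0 : ℝ) from (le_max_right _ _).trans hb)
  exact ⟨t, hm.le_iff_le.1 ((le_max_left _ _).trans hb), hbU⟩

/-- The old time increases to the first hitting time b of Z without reaching it, so the new orbit
converges to the hitting point. -/
lemma omegaSet_eq_singleton [T2Space S] {x : S} {b : ℝ} (hb : 0 < b) (hz : v b x ∈ Z)
    (hx : ∀ s ∈ Ico 0 b, v s x ∉ Z) : omegaSet u x = {v b x} := by
  obtain ⟨τ, h1, h0, -, h3⟩ := h x
  obtain ⟨hm, hc, hr⟩ := h3 (by simpa using hx 0 ⟨le_rfl, hb⟩)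
  have hlt : ∀ t, τ t < b := by
    intro t
    by_contra hcon
    have : τ t ∈ range τ := ⟨t, rfl⟩
    rw [hr] at this
    refine this b ?_ hz
    rw [uIcc_of_le (hb.le.trans (not_lt.1 hcon))]
    exact ⟨hb.le, not_lt.1 hcon⟩
  have hτ : Tendsto τ atTop (𝓝 b) := by
    rw [tendsto_order]
    refine ⟨fun a ha => ?_, fun a ha => Eventually.of_forall fun t => (hlt t).trans ha⟩
    have hm' : max a 0 ∈ Ico a b ∩ Ici 0 := ⟨⟨le_max_left _ _, max_lt ha hb⟩, mem_Ici.2 (le_max_right _ _)⟩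
    have : max a 0 ∈ range τ := by
      rw [hr]
      intro r hr'
      rw [uIcc_of_le hm'.2] at hr'
      exact hx r ⟨hr'.1, hr'.2.trans_lt hm'.1.2⟩
    obtain ⟨t, ht⟩ := this
    filter_upwards [eventually_gt_atTop t] with t' ht'
    exact (le_max_left a 0).trans_lt (ht ▸ hm ht')
  have hlim : Tendsto (fun t => u t x) atTop (𝓝 (v b x)) := by
    simp only [h1]
    exact ((v.continuous continuous_id continuous_const).tendsto b).comp hτ
  ext y
  rw [mem_omegaSet, mem_singleton_iff]
  constructor
  · intro H
    exact eq_of_nhds_neBot (NeBot.mono H (inf_le_inf_left _ hlim))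
  · rintro rfl
    exact hlim.mapClusterPt

lemma not_isClosedPoint {x : S} (hx : x ∉ Z) (hv : ∀ t, t ≠ 0 → v t x ≠ x) :
    ¬ IsClosedPoint u x := by
  obtain ⟨τ, h1, h0, -, h3⟩ := h x
  obtain ⟨hm, -, -⟩ := h3 hx
  have key : ∀ t, t ≠ 0 → u t x ≠ x := by
    intro t ht
    rw [h1]
    exact hv _ (h0 ▸ hm.injective.ne ht)
  rintro (H | ⟨T, hT, H, -⟩)
  · exact key 1 one_ne_zero (H 1)
  · exact key T hT.ne' H

/-- A fixed point of u outside Z is fixed by v during the nontrivial time interval [0, τ 1], hence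
by iteration and inversion at all times. -/
lemma singularSet_subset : singularSet u ⊆ Z ∪ singularSet v := by
  intro x hx
  by_cases hxZ : x ∈ Z
  · exact Or.inl hxZ
  right
  obtain ⟨τ, h1, h0, -, h3⟩ := h x
  obtain ⟨hm, hc, -⟩ := h3 hxZ
  have hnear : ∀ s ∈ Icc 0 (τ 1), v s x = x := by
    intro s hs
    rw [← h0] at hs
    obtain ⟨t, -, rfl⟩ := intermediate_value_Icc zero_le_one hc.continuousOn hs
    rw [← h1]
    exact hx t
  have hpos : 0 < τ 1 := h0 ▸ hm zero_lt_one
  have hnat : ∀ n : ℕ, ∀ s ∈ Icc 0 (n * τ 1), v s x = x := by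
    intro n
    induction n with
    | zero => intro s hs; simp at hs; simp [hs]
    | succ n ih =>
      intro s hs
      rcases le_total s (n * τ 1) with h' | h'
      · exact ih s ⟨hs.1, h'⟩
      · have e : s = (s - n * τ 1) + n * τ 1 := by ring
        have hs2 := hs.2
        push_cast at hs2
        rw [e, v.map_add, ih _ ⟨by positivity, le_rfl⟩]
        exact hnear _ ⟨by linarith, by linarith⟩
  have hnn : ∀ s, 0 ≤ s → v s x = x := by
    intro s hs
    obtain ⟨n, hn⟩ := exists_nat_ge (s / τ 1)
    exact hnat n s ⟨hs, (div_le_iff₀ hpos).1 hn⟩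
  intro s
  rcases le_total 0 s with hs | hs
  · exact hnn s hs
  · have := hnn (-s) (by linarith)
    conv_lhs => rw [← this]
    rw [← v.map_add, add_neg_cancel, v.map_zero_apply]

lemma isPeriodicPoint {x : S} (hx : ∀ s, v s x ∉ Z) (hv : IsPeriodicPoint v x) :
    IsPeriodicPoint u x := by
  obtain ⟨T, hT, hTx, hmin⟩ := hv
  obtain ⟨τ, h1, h0, hm, hc, hr⟩ := h.tendsto_atTop fun s _ => hx s
  obtain ⟨t, rfl⟩ := hr (show T ∈ Ici (0 : ℝ) from hT.le)
  refine ⟨t, hm.lt_iff_lt.1 (h0.symm ▸ hT), by rw [h1, hTx], fun s hs => ?_⟩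
  rw [h1]
  exact hmin _ ⟨h0 ▸ hm hs.1, hm hs.2⟩

end IsTimeChange

end TimeChangeConsequences

end SurfaceFlow

namespace SurfaceFlow

/-! ### The glued surface and its flow -/

section Model

/-- A function on the circle that changes sign at the two points of norm `1 / 16` and is equal to
`1` outside of a neighbourhood of `0`. -/
noncomputable def kap (y : UnitAddCircle) : ℝ := min (16 * ‖y‖ - 1) 1

lemma continuous_kap : Continuous kap := by
  unfold kap
  fun_prop

lemma abs_kap_le (y : UnitAddCircle) : |kap y| ≤ 1 := by
  rw [abs_le]
  exact ⟨le_min (by linarith [norm_nonneg y]) (by norm_num), min_le_right _ _⟩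

lemma kap_neg (y : UnitAddCircle) : kap (-y) = kap y := by simp [kap]

lemma kap_zero : kap 0 = -1 := by simp [kap]

lemma kap_eq_one {y : UnitAddCircle} (hy : 1 / 8 ≤ ‖y‖) : kap y = 1 :=
  min_eq_right (by linarith)

/-- A family of saddles and nodes over the circle: the level sets of `p * q`. -/
abbrev Model : Type := {z : UnitAddCircle × ℝ × ℝ // z.2.1 * z.2.2 = kap z.1}

namespace Model

/-- The base point. -/
abbrev y (x : Model) : UnitAddCircle := x.1.1

/-- The expanding coordinate. -/
abbrev p (x : Model) : ℝ := x.1.2.1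

/-- The contracting coordinate. -/
abbrev q (x : Model) : ℝ := x.1.2.2

lemma mul_eq (x : Model) : x.p * x.q = kap x.y := x.2

lemma ext' {x z : Model} (hy : x.y = z.y) (hp : x.p = z.p) (hq : x.q = z.q) : x = z :=
  Subtype.ext (Prod.ext hy (Prod.ext hp hq))

lemma ext_p {x z : Model} (hy : x.y = z.y) (hp : x.p = z.p) (h0 : x.p ≠ 0) : x = z := by
  refine ext' hy hp (mul_left_cancel₀ h0 ?_)
  conv_rhs => rw [hp]
  rw [x.mul_eq, z.mul_eq, hy]

lemma ext_q {x z : Model} (hy : x.y = z.y) (hq : x.q = z.q) (h0 : x.q ≠ 0) : x = z := by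
  refine ext' hy (mul_right_cancel₀ h0 ?_) hq
  conv_rhs => rw [hq]
  rw [x.mul_eq, z.mul_eq, hy]

/-- Exchange of the expanding and the contracting coordinate. -/
def swap (x : Model) : Model := ⟨(x.y, x.q, x.p), by rw [mul_comm]; exact x.2⟩

lemma continuous_swap : Continuous swap := by
  unfold swap
  fun_prop

/-- The linear saddle flow on every fibre. -/
noncomputable def flow (t : ℝ) (x : Model) : Model :=
  ⟨(x.y, Real.exp t * x.p, Real.exp (-t) * x.q), by
    change Real.exp t * x.p * (Real.exp (-t) * x.q) = kap x.y
    rw [← x.mul_eq, Real.exp_neg]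
    field_simp⟩

lemma continuous_flow : Continuous fun a : ℝ × Model => flow a.1 a.2 := by
  unfold flow
  fun_prop

end Model

/-- The gluing relation: leaving through `p` on the sheet given by the sign of `p`, one enters
through `q` on the same sheet, after the application of the circle homeomorphism of that sheet. -/
def Step (g : Bool → UnitAddCircle ≃ₜ UnitAddCircle) (x x' : Model) : Prop :=
  x.p * x'.q = Real.exp 1 ∧ x'.y = g (decide (0 < x.p)) x.y

/-- Chains of gluing steps. -/
def StepN (g : Bool → UnitAddCircle ≃ₜ UnitAddCircle) : ℕ → Model → Model → Prop
  | 0, x, z => x = z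
  | n + 1, x, z => ∃ w, StepN g n x w ∧ Step g w z

/-- The inverse gluing maps. -/
def symmFam (g : Bool → UnitAddCircle ≃ₜ UnitAddCircle) : Bool → UnitAddCircle ≃ₜ UnitAddCircle :=
  fun b => (g b).symm

variable {g : Bool → UnitAddCircle ≃ₜ UnitAddCircle}

namespace Step

lemma p_ne {x x' : Model} (h : Step g x x') : x.p ≠ 0 := by
  intro h0
  have := h.1
  rw [h0, zero_mul] at this
  exact (Real.exp_pos 1).ne this

lemma q_ne {x x' : Model} (h : Step g x x') : x'.q ≠ 0 := by
  intro h0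
  have := h.1
  rw [h0, mul_zero] at this
  exact (Real.exp_pos 1).ne this

lemma pos_iff {x x' : Model} (h : Step g x x') : 0 < x'.q ↔ 0 < x.p := by
  have h1 : 0 < x.p * x'.q := h.1 ▸ Real.exp_pos 1
  constructor
  · intro h2
    exact pos_of_mul_pos_left h1 h2.le
  · intro h2
    exact pos_of_mul_pos_right h1 h2.le

lemma p_eq {x x' : Model} (h : Step g x x') : x'.p = kap x'.y * x.p / Real.exp 1 := by
  rw [← h.1, ← x'.mul_eq]
  have := h.p_ne
  have := h.q_ne
  field_simp

lemma abs_p_le {x x' : Model} (h : Step g x x') : |x'.p| ≤ |x.p| / Real.exp 1 := by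
  rw [h.p_eq, abs_div, abs_mul, abs_of_pos (Real.exp_pos 1)]
  gcongr
  exact mul_le_of_le_one_left (abs_nonneg _) (abs_kap_le _)

lemma right_unique {x a b : Model} (ha : Step g x a) (hb : Step g x b) : a = b :=
  Model.ext_q (ha.2.trans hb.2.symm) (mul_left_cancel₀ ha.p_ne (ha.1.trans hb.1.symm)) ha.q_ne

lemma left_unique {x a b : Model} (ha : Step g a x) (hb : Step g b x) : a = b := by
  have hp : a.p = b.p := mul_right_cancel₀ ha.q_ne (ha.1.trans hb.1.symm)
  refine Model.ext_p ?_ hp ha.p_ne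
  have := ha.2.symm.trans hb.2
  rw [hp] at this
  exact (g _).injective this

lemma swap {x x' : Model} (h : Step g x x') : Step (symmFam g) x'.swap x.swap := by
  refine ⟨(mul_comm _ _).trans h.1, ?_⟩
  have h1 := h.2
  have h2 : decide (0 < x'.swap.p) = decide (0 < x.p) := by
    simp only [decide_eq_decide]
    exact h.pos_iff
  rw [h2]
  exact ((g _).symm_apply_eq.2 h1).symm

lemma flow {x x' : Model} (h : Step g x x') (t : ℝ) : Step g (x.flow t) (x'.flow t) := by
  refine ⟨?_, ?_⟩
  · change Real.exp t * x.p * (Real.exp (-t) * x'.q) = _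
    rw [← h.1, Real.exp_neg]
    field_simp
  · have : decide (0 < (x.flow t).p) = decide (0 < x.p) := by
      simp only [decide_eq_decide]
      exact mul_pos_iff_of_pos_left (Real.exp_pos t)
    rw [this]
    exact h.2

end Step

lemma StepN.abs_p_le : ∀ {n : ℕ} {x z : Model}, StepN g n x z →
    Real.exp n * |z.p| ≤ |x.p|
  | 0, x, z, h => by
    cases h
    simp
  | n + 1, x, z, ⟨w, h, hs⟩ => by
    refine le_trans ?_ h.abs_p_le
    have := hs.abs_p_le
    rw [le_div_iff₀ (Real.exp_pos 1)] at this
    push_cast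
    rw [Real.exp_add]
    nlinarith [Real.exp_pos n]

/-- Every step divides |p| by at least e, and p q = e across the last one. So the product on the
right bounds the length of a chain, which is what makes the quotient Hausdorff. -/
lemma StepN.exp_le {n : ℕ} {x z : Model} (h : StepN g (n + 1) x z) :
    Real.exp (n + 1) ≤ |x.p| * |z.q| := by
  obtain ⟨w, h, hs⟩ := h
  have h1 := h.abs_p_le
  have h2 : |w.p| * |z.q| = Real.exp 1 := by
    rw [← abs_mul, hs.1, abs_of_pos (Real.exp_pos 1)]
  rw [Real.exp_add, ← h2, ← mul_assoc]
  gcongr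

/-- The closed surface obtained by gluing the model along circle homeomorphisms. -/
def GluedSurface (g : Bool → UnitAddCircle ≃ₜ UnitAddCircle) : Type := Quot (Step g)

instance : TopologicalSpace (GluedSurface g) := inferInstanceAs (TopologicalSpace (Quot (Step g)))

/-- The gluing map. -/
def glue (g : Bool → UnitAddCircle ≃ₜ UnitAddCircle) (x : Model) : GluedSurface g :=
  Quot.mk (Step g) x

lemma Step.glue_eq {x x' : Model} (h : Step g x x') : glue g x = glue g x' := Quot.sound h

lemma glue_surjective : Function.Surjective (glue g) := Quot.mk_surjective

lemma continuous_glue : Continuous (glue g) := continuous_quot_mk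

lemma StepN.glue_eq : ∀ {n : ℕ} {x z : Model}, StepN g n x z → glue g x = glue g z
  | 0, _, _, h => congrArg _ h
  | _ + 1, _, _, ⟨_, h, hs⟩ => h.glue_eq.trans hs.glue_eq

lemma StepN.trans_step : ∀ {n : ℕ} {x a z : Model}, StepN g n x a → Step g z a →
    (∃ m, StepN g m x z) ∨ Step g z x
  | 0, _, _, _, h, hz => by
    cases h
    exact Or.inr hz
  | n + 1, _, _, z, ⟨w, h, hs⟩, hz => by
    cases hs.left_unique hz
    exact Or.inl ⟨n, h⟩

lemma StepN.cons : ∀ {n : ℕ} {w x z : Model}, Step g w x → StepN g n x z → StepN g (n + 1) w z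
  | 0, w, _, _, hs, h => by
    cases h
    exact ⟨w, rfl, hs⟩
  | _ + 1, _, _, _, hs, ⟨a, h, ha⟩ => ⟨a, StepN.cons hs h, ha⟩

lemma StepN.uncons : ∀ {n : ℕ} {x z : Model}, StepN g (n + 1) x z →
    ∃ a, Step g x a ∧ StepN g n a z
  | 0, x, z, ⟨w, h, hs⟩ => by
    cases h
    exact ⟨z, hs, rfl⟩
  | n + 1, x, z, ⟨w, h, hs⟩ => by
    obtain ⟨a, ha, h'⟩ := StepN.uncons h
    exact ⟨a, ha, w, h', hs⟩

/-- A step is a partial injection, so every zigzag of steps cancels to a chain in one direction. -/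
lemma glue_eq_iff {x z : Model} :
    glue g x = glue g z ↔ ∃ n, StepN g n x z ∨ StepN g n z x := by
  constructor
  · intro h
    have key : ∀ a b, Relation.EqvGen (Step g) a b → ∀ x,
        ((∃ n, StepN g n x a ∨ StepN g n a x) ↔ ∃ n, StepN g n x b ∨ StepN g n b x) := by
      intro a b hab
      induction hab with
      | rel a b hs =>
        intro x
        constructor
        · rintro ⟨n, h | h⟩
          · exact ⟨n + 1, Or.inl ⟨a, h, hs⟩⟩
          · cases n with
            | zero => cases h; exact ⟨1, Or.inl ⟨a, rfl, hs⟩⟩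
            | succ n =>
              obtain ⟨c, hc, h'⟩ := h.uncons
              cases hc.right_unique hs
              exact ⟨n, Or.inr h'⟩
        · rintro ⟨n, h | h⟩
          · rcases h.trans_step hs with ⟨m, hm⟩ | h'
            · exact ⟨m, Or.inl hm⟩
            · exact ⟨1, Or.inr ⟨a, rfl, h'⟩⟩
          · exact ⟨n + 1, Or.inr (StepN.cons hs h)⟩
      | refl a => exact fun _ => Iff.rfl
      | symm a b _ ih => exact fun x => (ih x).symm
      | trans a b c _ _ ih1 ih2 => exact fun x => (ih1 x).trans (ih2 x)
    exact (key x z (Quot.eqvGen_exact h) x).1 ⟨0, Or.inl rfl⟩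
  · rintro ⟨n, h | h⟩
    · exact h.glue_eq
    · exact h.glue_eq.symm

/-- The map that realizes the gluing step. -/
noncomputable def fwd (g : Bool → UnitAddCircle ≃ₜ UnitAddCircle) (x : Model) : Model :=
  if h : x.p ≠ 0 then ⟨(g (decide (0 < x.p)) x.y,
    kap (g (decide (0 < x.p)) x.y) * x.p / Real.exp 1, Real.exp 1 / x.p), by
      have := (Real.exp_pos 1).ne'
      field_simp⟩
  else x

lemma step_fwd {x : Model} (h : x.p ≠ 0) : Step g x (fwd g x) := by
  unfold fwd
  rw [dif_pos h]
  refine ⟨?_, rfl⟩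
  change x.p * (Real.exp 1 / x.p) = _
  field_simp

lemma Step.eq_fwd {x x' : Model} (h : Step g x x') : x' = fwd g x :=
  h.right_unique (step_fwd h.p_ne)

lemma continuousOn_fwd : ContinuousOn (fwd g) {x | x.p ≠ 0} := by
  have hsub : IsInducing (Subtype.val : Model → _) := IsInducing.subtypeVal
  rw [hsub.continuousOn_iff]
  have hy : ContinuousOn (fun x : Model => g (decide (0 < x.p)) x.y) {x | x.p ≠ 0} := by
    intro x hx
    rcases lt_or_gt_of_ne hx with h | h
    · refine ContinuousAt.continuousWithinAt ?_
      have : (fun x : Model => g (decide (0 < x.p)) x.y) =ᶠ[𝓝 x] fun x => g false x.y := by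
        have ho : IsOpen {x : Model | x.p < 0} := isOpen_lt (by fun_prop) continuous_const
        filter_upwards [ho.mem_nhds h] with z hz
        have hz' : ¬ 0 < z.p := not_lt.2 (le_of_lt hz)
        simp [hz']
      refine ContinuousAt.congr ?_ this.symm
      exact ((g false).continuous.comp (by fun_prop)).continuousAt
    · refine ContinuousAt.continuousWithinAt ?_
      have : (fun x : Model => g (decide (0 < x.p)) x.y) =ᶠ[𝓝 x] fun x => g true x.y := by
        have ho : IsOpen {x : Model | 0 < x.p} := isOpen_lt continuous_const (by fun_prop)
        filter_upwards [ho.mem_nhds h] with z hz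
        have hz' : 0 < z.p := hz
        simp [hz']
      refine ContinuousAt.congr ?_ this.symm
      exact ((g true).continuous.comp (by fun_prop)).continuousAt
  have hp : ContinuousOn (fun x : Model => x.p) {x | x.p ≠ 0} := by fun_prop
  have : ContinuousOn (fun x : Model => (g (decide (0 < x.p)) x.y,
      kap (g (decide (0 < x.p)) x.y) * x.p / Real.exp 1, Real.exp 1 / x.p)) {x | x.p ≠ 0} :=
    hy.prodMk ((((continuous_kap.comp_continuousOn hy).mul hp).div_const _).prodMk
      (continuousOn_const.div hp fun x hx => hx))
  refine this.congr fun x hx => ?_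
  have hx' : x.p ≠ 0 := hx
  simp only [Function.comp, fwd, dif_pos hx']

/-- The map that realizes the inverse of the gluing step. -/
noncomputable def bwd (g : Bool → UnitAddCircle ≃ₜ UnitAddCircle) (x : Model) : Model :=
  (fwd (symmFam g) x.swap).swap

lemma step_bwd {x : Model} (h : x.q ≠ 0) : Step g (bwd g x) x := by
  have : Step (symmFam g) x.swap (fwd (symmFam g) x.swap) := step_fwd h
  exact this.swap

lemma continuousOn_bwd : ContinuousOn (bwd g) {x | x.q ≠ 0} :=
  Model.continuous_swap.comp_continuousOn
    (continuousOn_fwd.comp Model.continuous_swap.continuousOn fun _ hx => hx)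

lemma isOpen_p_ne : IsOpen {x : Model | x.p ≠ 0} := isOpen_ne_fun (by fun_prop) continuous_const

lemma isOpen_q_ne : IsOpen {x : Model | x.q ≠ 0} := isOpen_ne_fun (by fun_prop) continuous_const

/-- Steps and their inverses are given by the continuous maps `fwd` and `bwd` on open sets, so the
interior of the saturation of U is again saturated. As it contains U, it is the whole saturation. -/
lemma isOpenMap_glue : IsOpenMap (glue g) := by
  intro U hU
  set V : Set Model := glue g ⁻¹' (glue g '' U) with hV
  have sat : ∀ x z, Step g x z → (x ∈ interior V ↔ z ∈ interior V) := by
    intro x z h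
    constructor
    · intro hx
      have hc : ContinuousAt (bwd g) z := continuousOn_bwd.continuousAt (isOpen_q_ne.mem_nhds h.q_ne)
      rw [mem_interior_iff_mem_nhds] at hx ⊢
      rw [h.left_unique (step_bwd h.q_ne)] at hx
      filter_upwards [hc hx, isOpen_q_ne.mem_nhds h.q_ne] with w hw hw'
      change glue g w ∈ glue g '' U
      rw [← (step_bwd hw').glue_eq]
      exact hw
    · intro hz
      have hc : ContinuousAt (fwd g) x := continuousOn_fwd.continuousAt (isOpen_p_ne.mem_nhds h.p_ne)
      rw [mem_interior_iff_mem_nhds] at hz ⊢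
      rw [h.eq_fwd] at hz
      filter_upwards [hc hz, isOpen_p_ne.mem_nhds h.p_ne] with w hw hw'
      change glue g w ∈ glue g '' U
      rw [(step_fwd hw').glue_eq]
      exact hw
  let P : GluedSurface g → Prop := Quot.lift (fun x => x ∈ interior V)
    fun x z h => propext (sat x z h)
  have hUV : U ⊆ interior V := interior_maximal (subset_preimage_image _ _) hU
  have hP : ∀ s ∈ glue g '' U, P s := by
    rintro _ ⟨x, hx, rfl⟩
    exact hUV hx
  have : V = interior V := by
    refine Subset.antisymm (fun x hx => ?_) interior_subset
    exact hP _ hx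
  have hVo : IsOpen V := by
    rw [this]
    exact isOpen_interior
  exact (isQuotientMap_quot_mk (r := Step g)).isOpen_preimage.1 hVo

lemma isOpenQuotientMap_glue : IsOpenQuotientMap (glue g) :=
  ⟨glue_surjective, continuous_glue, isOpenMap_glue⟩

lemma isClosed_stepN : ∀ n : ℕ, IsClosed {a : Model × Model | StepN g (n + 1) a.1 a.2}
  | 0 => by
    -- The open sign conditions can be replaced by closed ones, because p q = e already excludes p =
    -- 0.
    have : {a : Model × Model | StepN g 1 a.1 a.2} =
        {a | a.1.p * a.2.q = Real.exp 1} ∩ (({a | 0 ≤ a.1.p} ∩ {a | a.2.y = g true a.1.y}) ∪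
          ({a | a.1.p ≤ 0} ∩ {a | a.2.y = g false a.1.y})) := by
      ext ⟨x, z⟩
      constructor
      · rintro ⟨w, h, hs⟩
        cases h
        refine ⟨hs.1, ?_⟩
        have h2 := hs.2
        by_cases h0 : 0 < x.p
        · exact Or.inl ⟨h0.le, by simpa [h0] using h2⟩
        · exact Or.inr ⟨not_lt.1 h0, by simpa [h0] using h2⟩
      · rintro ⟨h1, h2⟩
        refine ⟨x, rfl, h1, ?_⟩
        have hx : x.p ≠ 0 := by
          intro h0
          change x.p * z.q = Real.exp 1 at h1
          rw [h0, zero_mul] at h1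
          exact (Real.exp_pos 1).ne h1
        rcases h2 with ⟨h2, h3⟩ | ⟨h2, h3⟩
        · have : 0 < x.p := lt_of_le_of_ne h2 hx.symm
          simpa [this] using h3
        · have : ¬ 0 < x.p := not_lt.2 h2
          simpa [this] using h3
    have hg : ∀ b, Continuous (g b) := fun b => (g b).continuous
    rw [this]
    refine (isClosed_eq (by fun_prop) continuous_const).inter (IsClosed.union ?_ ?_)
    · exact (isClosed_le continuous_const (by fun_prop)).inter (isClosed_eq (by fun_prop) (by fun_prop))
    · exact (isClosed_le (by fun_prop) continuous_const).inter (isClosed_eq (by fun_prop) (by fun_prop))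
  | n + 1 => by
    -- All chains of positive length lie in this closed set, on which q ≠ 0 and `bwd` is continuous;
    -- peeling off the last step there gives the induction.
    have hc : IsClosed {a : Model × Model | 1 ≤ |a.1.p| * |a.2.q|} :=
      isClosed_le continuous_const (by fun_prop)
    have hq : ∀ a ∈ {a : Model × Model | 1 ≤ |a.1.p| * |a.2.q|}, a.2.q ≠ 0 := by
      intro a ha h0
      simp only [mem_ofPred_eq, h0, abs_zero, mul_zero] at ha
      linarith
    have : {a : Model × Model | StepN g (n + 1 + 1) a.1 a.2} =
        {a : Model × Model | 1 ≤ |a.1.p| * |a.2.q|} ∩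
          (fun a => (a.1, bwd g a.2)) ⁻¹' {a | StepN g (n + 1) a.1 a.2} := by
      ext ⟨x, z⟩
      constructor
      · intro h
        refine ⟨?_, ?_⟩
        · refine le_trans ?_ h.exp_le
          rw [Real.one_le_exp_iff]
          positivity
        · obtain ⟨w, h, hs⟩ := h
          cases hs.left_unique (step_bwd hs.q_ne)
          exact h
      · rintro ⟨h1, h2⟩
        exact ⟨_, h2, step_bwd (hq _ h1)⟩
    rw [this]
    refine ContinuousOn.preimage_isClosed_of_isClosed ?_ hc (isClosed_stepN n)
    exact continuousOn_fst.prodMk (continuousOn_bwd.comp continuousOn_snd hq)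

instance : T2Space (GluedSurface g) := by
  rw [t2Space_iff_of_isOpenQuotientMap isOpenQuotientMap_glue]
  -- By the exponential bound only finitely many chain lengths occur near a given pair, so the union
  -- of these closed relations is locally finite.
  have key : IsClosed (⋃ n : ℕ, {a : Model × Model | StepN g (n + 1) a.1 a.2}) := by
    refine LocallyFinite.isClosed_iUnion ?_ isClosed_stepN
    intro a
    set M := |a.1.p| * |a.2.q| + 1
    have ho : IsOpen {b : Model × Model | |b.1.p| * |b.2.q| < M} :=
      isOpen_lt (by fun_prop) continuous_const
    refine ⟨_, ho.mem_nhds (show |a.1.p| * |a.2.q| < M from lt_add_one _), ?_⟩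
    obtain ⟨N, hN⟩ := exists_nat_gt M
    refine (finite_lt_nat N).subset ?_
    rintro n ⟨b, hb, hb'⟩
    have h1 := StepN.exp_le hb
    have h2 : (n : ℝ) < N := by
      have h3 : |b.1.p| * |b.2.q| < M := hb'
      have := Real.add_one_le_exp ((n : ℝ) + 1)
      linarith
    exact_mod_cast h2
  have : {q : Model × Model | glue g q.1 = glue g q.2} = diagonal Model ∪
      ((⋃ n : ℕ, {a : Model × Model | StepN g (n + 1) a.1 a.2}) ∪
        Prod.swap ⁻¹' ⋃ n : ℕ, {a : Model × Model | StepN g (n + 1) a.1 a.2}) := by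
    ext ⟨x, z⟩
    simp only [mem_ofPred_eq, glue_eq_iff, mem_union, mem_diagonal_iff, mem_iUnion, mem_preimage,
      Prod.swap]
    constructor
    · rintro ⟨n | n, h | h⟩
      · exact Or.inl h
      · exact Or.inl (Eq.symm h)
      · exact Or.inr (Or.inl ⟨n, h⟩)
      · exact Or.inr (Or.inr ⟨n, h⟩)
    · rintro (h | ⟨n, h⟩ | ⟨n, h⟩)
      · exact ⟨0, Or.inl h⟩
      · exact ⟨n + 1, Or.inl h⟩
      · exact ⟨n + 1, Or.inr h⟩
  rw [this]
  exact isClosed_diagonal.union (key.union (key.preimage continuous_swap))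

instance : SecondCountableTopology (GluedSurface g) := by
  have : SecondCountableTopology UnitAddCircle :=
    (QuotientAddGroup.isOpenQuotientMap_mk (N := AddSubgroup.zmultiples (1 : ℝ))).isQuotientMap
      |>.secondCountableTopology QuotientAddGroup.isOpenMap_coe
  exact isOpenQuotientMap_glue.isQuotientMap.secondCountableTopology isOpenMap_glue

/-- A compact set of representatives. -/
def core : Set Model := {x | |x.p| ≤ Real.exp (1 / 2) ∧ |x.q| ≤ Real.exp (1 / 2)}

lemma isCompact_core : IsCompact core := by
  have h1 : IsCompact ((univ : Set UnitAddCircle) ×ˢ (Icc (-Real.exp (1 / 2)) (Real.exp (1 / 2)) ×ˢ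
      Icc (-Real.exp (1 / 2)) (Real.exp (1 / 2)))) :=
    isCompact_univ.prod (isCompact_Icc.prod isCompact_Icc)
  have h2 : IsClosed {z : UnitAddCircle × ℝ × ℝ | z.2.1 * z.2.2 = kap z.1} :=
    isClosed_eq (by fun_prop) (continuous_kap.comp continuous_fst)
  have h3 : IsClosedEmbedding (Subtype.val : Model → _) := h2.isClosedEmbedding_subtypeVal
  convert h3.isCompact_preimage h1 using 1
  ext x
  simp only [core, abs_le, mem_ofPred_eq, mem_preimage, mem_prod, mem_univ, true_and, mem_Icc]

lemma exp_half_mul : Real.exp (1 / 2) * Real.exp (1 / 2) = Real.exp 1 := by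
  rw [← Real.exp_add]
  norm_num

/-- If |p| > e^{1/2}, one step makes |q| = e / |p| smaller than e^{1/2} and divides |p| by at least
e. Induction on the number of factors e in the bound for |p|. -/
lemma exists_core_of_q_le (n : ℕ) : ∀ x : Model, |x.p| ≤ Real.exp (1 / 2) * Real.exp n →
    |x.q| ≤ Real.exp (1 / 2) → ∃ z ∈ core, ∃ m, StepN g m x z := by
  induction n with
  | zero => exact fun x h1 h2 => ⟨x, ⟨by simpa using h1, h2⟩, 0, rfl⟩
  | succ n ih =>
    intro x h1 h2
    by_cases h : |x.p| ≤ Real.exp (1 / 2)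
    · exact ⟨x, ⟨h, h2⟩, 0, rfl⟩
    · rw [not_le] at h
      have hx : x.p ≠ 0 := abs_pos.1 ((Real.exp_pos _).trans h)
      have hs : Step g x (fwd g x) := step_fwd hx
      obtain ⟨z, hz, m, hm⟩ := ih (fwd g x) (by
        refine hs.abs_p_le.trans ?_
        rw [div_le_iff₀ (Real.exp_pos 1), mul_assoc, ← Real.exp_add]
        exact_mod_cast h1) (by
        have h3 : |x.p| * |(fwd g x).q| = Real.exp 1 := by
          rw [← abs_mul, hs.1, abs_of_pos (Real.exp_pos 1)]
        rw [← exp_half_mul] at h3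
        by_contra hcon
        rw [not_le] at hcon
        have := mul_lt_mul h hcon.le (Real.exp_pos _) (abs_nonneg _)
        linarith)
      exact ⟨z, hz, m + 1, StepN.cons hs hm⟩

lemma StepN.glue_swap : ∀ {n : ℕ} {x z : Model}, StepN (symmFam g) n x z →
    glue g x.swap = glue g z.swap
  | 0, _, _, h => by cases h; rfl
  | _ + 1, _, _, ⟨_, h, hs⟩ => h.glue_swap.trans (Step.glue_eq (g := g) hs.swap).symm

lemma exists_core (s : GluedSurface g) : ∃ z ∈ core, glue g z = s := by
  obtain ⟨x, rfl⟩ := glue_surjective s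
  have hex : ∀ r : ℝ, ∃ n : ℕ, r ≤ Real.exp (1 / 2) * Real.exp n := by
    intro r
    obtain ⟨n, hn⟩ := exists_nat_ge r
    refine ⟨n, hn.trans ?_⟩
    have h1 := Real.add_one_le_exp (n : ℝ)
    have h2 : 1 ≤ Real.exp (1 / 2) := Real.one_le_exp (by norm_num)
    nlinarith [Real.exp_pos n]
  have hk : |x.p| * |x.q| ≤ 1 := by
    rw [← abs_mul, x.mul_eq]
    exact abs_kap_le _
  have hone : 1 ≤ Real.exp (1 / 2) := Real.one_le_exp (by norm_num)
  by_cases hq : |x.q| ≤ Real.exp (1 / 2)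
  · obtain ⟨n, hn⟩ := hex |x.p|
    obtain ⟨z, hz, m, hm⟩ := exists_core_of_q_le (g := g) n x hn hq
    exact ⟨z, hz, hm.glue_eq.symm⟩
  · have hp : |x.p| ≤ Real.exp (1 / 2) := by
      by_contra hcon
      rw [not_le] at hq hcon
      have := mul_lt_mul hcon hq.le (Real.exp_pos _) (abs_nonneg _)
      nlinarith
    obtain ⟨n, hn⟩ := hex |x.q|
    obtain ⟨z, hz, m, hm⟩ := exists_core_of_q_le (g := symmFam g) n x.swap hn hp
    exact ⟨z.swap, ⟨hz.2, hz.1⟩, hm.glue_swap.symm⟩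

instance : CompactSpace (GluedSurface g) := by
  refine ⟨?_⟩
  have : glue g '' core = univ := by
    refine eq_univ_of_forall fun s => ?_
    obtain ⟨z, hz, rfl⟩ := exists_core s
    exact ⟨z, hz, rfl⟩
  rw [← this]
  exact isCompact_core.image continuous_glue

/-- The flow on the glued surface. -/
noncomputable def gluedFlow (g : Bool → UnitAddCircle ≃ₜ UnitAddCircle) :
    Flow ℝ (GluedSurface g) where
  toFun t := Quot.map (Model.flow t) fun _ _ h => h.flow t
  cont' := by
    rw [← (IsOpenQuotientMap.id.prodMap (isOpenQuotientMap_glue (g := g))).continuous_comp_iff]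
    exact continuous_glue.comp Model.continuous_flow
  map_add' t₁ t₂ s := by
    obtain ⟨x, rfl⟩ := glue_surjective s
    refine congrArg (glue g) (Model.ext' rfl ?_ ?_)
    · change Real.exp (t₁ + t₂) * x.p = Real.exp t₁ * (Real.exp t₂ * x.p)
      rw [Real.exp_add, mul_assoc]
    · change Real.exp (-(t₁ + t₂)) * x.q = Real.exp (-t₁) * (Real.exp (-t₂) * x.q)
      rw [neg_add, Real.exp_add, mul_assoc]
  map_zero' s := by
    obtain ⟨x, rfl⟩ := glue_surjective s
    refine congrArg (glue g) (Model.ext' rfl ?_ ?_)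
    · change Real.exp 0 * x.p = x.p
      simp
    · change Real.exp (-0) * x.q = x.q
      simp

lemma gluedFlow_glue (t : ℝ) (x : Model) :
    gluedFlow g t (glue g x) = glue g (x.flow t) := rfl

end Model

end SurfaceFlow

namespace SurfaceFlow

/-! ### Plane charts give a surface without boundary -/

section Charts

/-- Every point has an open neighbourhood that is parametrized by an open subset of the plane. -/
def HasPlaneCharts (S : Type*) [TopologicalSpace S] : Prop :=
  ∀ s : S, ∃ (U : Set (ℝ × ℝ)) (f : ℝ × ℝ → S), IsOpen U ∧ ContinuousOn f U ∧ InjOn f U ∧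
    (∀ V ⊆ U, IsOpen V → IsOpen (f '' V)) ∧ s ∈ f '' U

/-- The plane as the interior of the half-plane. -/
noncomputable def planeToHalf (a : ℝ × ℝ) : EuclideanHalfSpace 2 :=
  ⟨!₂[Real.exp a.1, a.2], (Real.exp_pos a.1).le⟩

lemma isOpenEmbedding_planeToHalf : IsOpenEmbedding planeToHalf := by
  have hc : Continuous planeToHalf := by
    unfold planeToHalf
    fun_prop
  have c0 : Continuous fun z : EuclideanHalfSpace 2 => z.1 0 := by fun_prop
  have c1 : Continuous fun z : EuclideanHalfSpace 2 => z.1 1 := by fun_prop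
  have ho : IsOpen {z : EuclideanHalfSpace 2 | 0 < z.1 0} := isOpen_lt continuous_const c0
  have left : ∀ a, (Real.log ((planeToHalf a).1 0), (planeToHalf a).1 1) = a := fun a => by
    simp [planeToHalf]
  refine IsOpenEmbedding.of_continuous_injective_isOpenMap hc ?_ fun U hU => ?_
  · intro a b hab
    rw [← left a, ← left b, hab]
  · have : planeToHalf '' U = {z : EuclideanHalfSpace 2 | 0 < z.1 0} ∩
        (fun z : EuclideanHalfSpace 2 => (Real.log (z.1 0), z.1 1)) ⁻¹' U := by
      ext z
      constructor
      · rintro ⟨a, ha, rfl⟩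
        refine ⟨Real.exp_pos a.1, ?_⟩
        rw [mem_preimage, left]
        exact ha
      · rintro ⟨hz, hz'⟩
        refine ⟨_, hz', Subtype.ext ?_⟩
        ext i
        have hz'' : 0 < z.1 0 := hz
        fin_cases i
        · simp [planeToHalf, Real.exp_log hz'']
        · simp [planeToHalf]
    rw [this]
    refine ContinuousOn.isOpen_inter_preimage ?_ ho hU
    exact (c0.continuousOn.log fun z hz => (ne_of_gt hz)).prodMk c1.continuousOn

variable {S : Type*} [TopologicalSpace S]

lemma HasPlaneCharts.exists_chart (h : HasPlaneCharts S) (s : S) :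
    ∃ e : OpenPartialHomeomorph S (EuclideanHalfSpace 2), s ∈ e.source ∧
      0 < (e s).1 0 := by
  obtain ⟨U, f, hU, hc, hi, ho, hs⟩ := h s
  let E : OpenPartialHomeomorph (ℝ × ℝ) S :=
    OpenPartialHomeomorph.ofContinuousOpenRestrict (hi.bijOn_image.toPartialEquiv f U (f '' U)) hc
      (by
        intro V hV
        have : U.domRestrict f '' V = f '' (Subtype.val '' V) := by
          rw [image_image]
          rfl
        change IsOpen (U.domRestrict f '' V)
        rw [this]
        exact ho _ (Subtype.coe_image_subset U V) (hU.isOpenMap_subtype_val V hV)) hU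
  refine ⟨E.symm.trans (isOpenEmbedding_planeToHalf.toOpenPartialHomeomorph planeToHalf), ?_, ?_⟩
  · rw [OpenPartialHomeomorph.trans_source]
    exact ⟨hs, trivial⟩
  · exact Real.exp_pos _

/-- The charted space structure given by plane charts. -/
@[reducible] noncomputable def HasPlaneCharts.chartedSpace (h : HasPlaneCharts S) :
    ChartedSpace (EuclideanHalfSpace 2) S where
  atlas := range fun s => (h.exists_chart s).choose
  chartAt s := (h.exists_chart s).choose
  mem_chart_source s := (h.exists_chart s).choose_spec.1
  chart_mem_atlas s := ⟨s, rfl⟩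

lemma HasPlaneCharts.surfaceBoundary_eq (h : HasPlaneCharts S) :
    letI := h.chartedSpace
    surfaceBoundary S = ∅ := by
  let _ := h.chartedSpace
  rw [eq_empty_iff_forall_notMem]
  intro s hs
  have h1 : extChartAt (𝓡∂ 2) s s ∈ interior (range (𝓡∂ 2)) := by
    rw [interior_range_modelWithCornersEuclideanHalfSpace]
    exact (h.exists_chart s).choose_spec.2
  exact (disjoint_left.1 disjoint_interior_frontier h1) hs

lemma HasPlaneCharts.eq_of_collapse_eq (h : HasPlaneCharts S) {x y : S}
    (hxy : letI := h.chartedSpace; (boundarySetoid S).r x y) : x = y := by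
  let _ := h.chartedSpace
  rcases hxy with h' | ⟨h', -⟩
  · exact h'
  · rw [h.surfaceBoundary_eq] at h'
    exact h'.elim

end Charts

end SurfaceFlow

namespace SurfaceFlow

/-! ### Cylinders of orbits and charts of the glued surface -/

section Cylinders

lemma coe_circle_injOn {a b : ℝ} (hab : |a - b| < 1) (h : (a : UnitAddCircle) = b) : a = b := by
  have h0 : ((a - b : ℝ) : UnitAddCircle) = 0 := by
    rw [AddCircle.coe_sub, h, sub_self]
  obtain ⟨n, hn⟩ := AddCircle.coe_eq_zero_iff (p := (1 : ℝ)).1 h0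
  rw [zsmul_eq_mul, mul_one] at hn
  rw [← hn] at hab
  have : |n| < 1 := by exact_mod_cast hab
  rw [Int.abs_lt_one_iff.1 this, Int.cast_zero] at hn
  linarith

lemma isOpenMap_coe_circle : IsOpenMap ((↑) : ℝ → UnitAddCircle) := QuotientAddGroup.isOpenMap_coe

lemma continuous_coe_circle : Continuous ((↑) : ℝ → UnitAddCircle) := continuous_quotient_mk'

lemma norm_coe_circle {r : ℝ} (hr : |r| ≤ 1 / 2) : ‖(r : UnitAddCircle)‖ = |r| :=
  (AddCircle.norm_coe_eq_abs_iff (1 : ℝ) one_ne_zero).2 (by simpa using hr)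

/-- A cylinder of orbits, with the first return map `h` away from the gluing slit. -/
structure IsCylinder {S : Type*} [TopologicalSpace S] (v : Flow ℝ S)
    (h : UnitAddCircle ≃ₜ UnitAddCircle) (Λ : ℝ × UnitAddCircle → S) : Prop where
  continuous : Continuous Λ
  isOpenMap : IsOpenMap Λ
  flow : ∀ t σ y, v t (Λ (σ, y)) = Λ (σ + t, y)
  strip : ∀ σ σ' y y', |σ - σ'| < 1 → Λ (σ, y) = Λ (σ', y') → σ = σ' ∧ y = y'
  shift : ∀ σ y, 1 / 8 ≤ ‖h y‖ → Λ (σ, y) = Λ (σ - 1, h y)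

lemma IsCylinder.exists_plane_chart {S : Type*} [TopologicalSpace S] {v : Flow ℝ S}
    {h : UnitAddCircle ≃ₜ UnitAddCircle} {Λ : ℝ × UnitAddCircle → S} (hΛ : IsCylinder v h Λ)
    (a : ℝ × UnitAddCircle) : ∃ (U : Set (ℝ × ℝ)) (f : ℝ × ℝ → S), IsOpen U ∧ ContinuousOn f U ∧
      InjOn f U ∧ (∀ V ⊆ U, IsOpen V → IsOpen (f '' V)) ∧ Λ a ∈ f '' U := by
  obtain ⟨σ, y⟩ := a
  obtain ⟨r, rfl⟩ := QuotientAddGroup.mk_surjective y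
  have hpc : Continuous (Prod.map id (↑) : ℝ × ℝ → ℝ × UnitAddCircle) :=
    continuous_id.prodMap continuous_coe_circle
  have hpo : IsOpenMap (Prod.map id (↑) : ℝ × ℝ → ℝ × UnitAddCircle) :=
    IsOpenMap.id.prodMap isOpenMap_coe_circle
  refine ⟨Ioo (σ - 1 / 4) (σ + 1 / 4) ×ˢ Ioo (r - 1 / 4) (r + 1 / 4),
    Λ ∘ Prod.map id (↑), isOpen_Ioo.prod isOpen_Ioo, (hΛ.continuous.comp hpc).continuousOn, ?_,
    fun V _ hV => ?_, (σ, r), ⟨⟨by linarith, by linarith⟩, ⟨by linarith, by linarith⟩⟩, rfl⟩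
  · rintro ⟨a1, a2⟩ ⟨⟨h1, h2⟩, h3, h4⟩ ⟨b1, b2⟩ ⟨⟨h5, h6⟩, h7, h8⟩ hab
    simp only at h1 h2 h3 h4 h5 h6 h7 h8
    have e := hΛ.strip a1 b1 (a2 : UnitAddCircle) b2 (by rw [abs_lt]; constructor <;> linarith) hab
    exact Prod.ext e.1 (coe_circle_injOn (by rw [abs_lt]; constructor <;> linarith) e.2)
  · rw [image_comp]
    exact hΛ.isOpenMap _ (hpo _ hV)

/-- The sign of a sheet. -/
def sgn (b : Bool) : ℝ := cond b 1 (-1)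

lemma sgn_mul_self (b : Bool) : sgn b * sgn b = 1 := by cases b <;> simp [sgn]

lemma decide_sgn_mul (b : Bool) {r : ℝ} (hr : 0 < r) : decide (0 < sgn b * r) = b := by
  cases b
  · simp [sgn, hr.le]
  · simp [sgn, hr]

variable {g : Bool → UnitAddCircle ≃ₜ UnitAddCircle}

/-- The part of the model where `p` has a given sign. -/
noncomputable def lam (b : Bool) (a : ℝ × UnitAddCircle) : Model :=
  ⟨(a.2, sgn b * Real.exp a.1, sgn b * kap a.2 * Real.exp (-a.1)), by
    change sgn b * Real.exp a.1 * (sgn b * kap a.2 * Real.exp (-a.1)) = kap a.2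
    rw [Real.exp_neg]
    have h := sgn_mul_self b
    have := Real.exp_pos a.1
    field_simp
    linear_combination (kap a.2) * h⟩

lemma continuous_lam (b : Bool) : Continuous (lam b) := by
  have := continuous_kap
  unfold lam
  fun_prop

lemma exists_lam {x : Model} (hx : x.p ≠ 0) : ∃ b a, lam b a = x := by
  have key : ∀ b, 0 < sgn b * x.p → lam b (Real.log (sgn b * x.p), x.y) = x := by
    intro b hb
    have hp : sgn b * Real.exp (Real.log (sgn b * x.p)) = x.p := by
      rw [Real.exp_log hb, ← mul_assoc, sgn_mul_self, one_mul]
    exact Model.ext_p (x := lam b (Real.log (sgn b * x.p), x.y)) rfl hp (hp.trans_ne hx)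
  rcases lt_or_gt_of_ne hx with h | h
  · exact ⟨false, _, key false (by simpa [sgn] using h)⟩
  · exact ⟨true, _, key true (by simpa [sgn] using h)⟩

lemma isOpenMap_lam (b : Bool) : IsOpenMap (lam b) := by
  intro U hU
  have : lam b '' U = {x : Model | 0 < sgn b * x.p} ∩
      (fun x : Model => (Real.log (sgn b * x.p), x.y)) ⁻¹' U := by
    ext x
    constructor
    · rintro ⟨a, ha, rfl⟩
      have hp : sgn b * (lam b a).p = Real.exp a.1 := by
        change sgn b * (sgn b * Real.exp a.1) = _
        rw [← mul_assoc, sgn_mul_self, one_mul]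
      refine ⟨?_, ?_⟩
      · rw [mem_ofPred_eq, hp]
        exact Real.exp_pos _
      · rw [mem_preimage, hp, Real.log_exp]
        exact ha
    · rintro ⟨hb, hx⟩
      refine ⟨_, hx, ?_⟩
      have hb' : 0 < sgn b * x.p := hb
      have hp : sgn b * Real.exp (Real.log (sgn b * x.p)) = x.p := by
        rw [Real.exp_log hb', ← mul_assoc, sgn_mul_self, one_mul]
      refine Model.ext_p (x := lam b (Real.log (sgn b * x.p), x.y)) rfl hp (hp.trans_ne ?_)
      rintro h0
      rw [h0, mul_zero] at hb'
      exact hb'.false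
  rw [this]
  refine ContinuousOn.isOpen_inter_preimage ?_ (isOpen_lt continuous_const (by fun_prop)) hU
  refine ContinuousOn.prodMk (ContinuousOn.log (by fun_prop) fun x hx => ne_of_gt hx) (by fun_prop)

/-- The cylinders of the glued surface. -/
noncomputable def cyl (g : Bool → UnitAddCircle ≃ₜ UnitAddCircle) (b : Bool)
    (a : ℝ × UnitAddCircle) : GluedSurface g := glue g (lam b a)

/-- Identified points are joined by a chain, and each step divides |p| = e^σ by at least e: hence
injectivity as long as σ varies by less than 1. Where kap = 1 a step stays on the sheet and is
exactly σ ↦ σ - 1. -/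
lemma isCylinder_cyl (b : Bool) : IsCylinder (gluedFlow g) (g b) (cyl g b) where
  continuous := continuous_glue.comp (continuous_lam b)
  isOpenMap := isOpenMap_glue.comp (isOpenMap_lam b)
  flow t σ y := by
    refine congrArg (glue g) (Model.ext' rfl ?_ ?_)
    · change Real.exp t * (sgn b * Real.exp σ) = sgn b * Real.exp (σ + t)
      rw [Real.exp_add]
      ring
    · change Real.exp (-t) * (sgn b * kap y * Real.exp (-σ)) = sgn b * kap y * Real.exp (-(σ + t))
      rw [neg_add, Real.exp_add]
      ring
  strip := by
    have habs : ∀ a, |(lam b a).p| = Real.exp a.1 := by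
      intro a
      change |sgn b * Real.exp a.1| = _
      rw [abs_mul, abs_of_pos (Real.exp_pos _)]
      cases b <;> simp [sgn]
    have key : ∀ n σ σ' y y', |σ - σ'| < 1 → StepN g n (lam b (σ, y)) (lam b (σ', y')) →
        σ = σ' ∧ y = y' := by
      intro n σ σ' y y' hσ h
      have h1 := h.abs_p_le
      rw [habs, habs, ← Real.exp_add, Real.exp_le_exp] at h1
      simp only at h1
      cases n with
      | zero =>
        have h0 : lam b (σ, y) = lam b (σ', y') := h
        have hp := congrArg (fun x : Model => |x.p|) h0
        simp only [habs] at hp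
        exact ⟨Real.exp_injective hp, congrArg (fun x : Model => x.y) h0⟩
      | succ n =>
        push_cast at h1
        rw [abs_lt] at hσ
        have := n.cast_nonneg (α := ℝ)
        linarith [hσ.1, hσ.2]
    intro σ σ' y y' hσ h
    obtain ⟨n, h | h⟩ := glue_eq_iff.1 h
    · exact key n _ _ _ _ hσ h
    · rw [abs_sub_comm] at hσ
      have := key n _ _ _ _ hσ h
      exact ⟨this.1.symm, this.2.symm⟩
  shift σ y hy := by
    refine Step.glue_eq ⟨?_, ?_⟩
    · change sgn b * Real.exp σ * (sgn b * kap (g b y) * Real.exp (-(σ - 1))) = _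
      rw [kap_eq_one hy]
      have : Real.exp 1 = Real.exp σ * Real.exp (-(σ - 1)) := by
        rw [← Real.exp_add]
        ring_nf
      rw [this]
      linear_combination (Real.exp σ * Real.exp (-(σ - 1))) * sgn_mul_self b
    · rw [show (lam b (σ, y)).p = sgn b * Real.exp σ from rfl, decide_sgn_mul b (Real.exp_pos _)]
      rfl

/-- The parametrizations near the two saddles. -/
lemma exists_plane_chart_saddle (x : Model) (hp : x.p = 0) (hq : x.q = 0) :
    ∃ (U : Set (ℝ × ℝ)) (f : ℝ × ℝ → GluedSurface g), IsOpen U ∧ ContinuousOn f U ∧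
      InjOn f U ∧ (∀ V ⊆ U, IsOpen V → IsOpen (f '' V)) ∧ glue g x ∈ f '' U := by
  set U : Set (ℝ × ℝ) := Ioo (-1) 1 ×ˢ Ioo (-1) 1 with hU
  have hbd : ∀ a ∈ U, |a.1 * a.2| < 1 := by
    rintro ⟨a1, a2⟩ ⟨h1, h2⟩
    have h1' : |a1| < 1 := abs_lt.2 h1
    have h2' : |a2| < 1 := abs_lt.2 h2
    rw [abs_mul]
    nlinarith [abs_nonneg a1, abs_nonneg a2]
  have hnorm : ∀ b, ∀ a ∈ U, ‖((sgn b * ((1 + a.1 * a.2) / 16) : ℝ) : UnitAddCircle)‖ =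
      (1 + a.1 * a.2) / 16 := by
    intro b a ha
    have h1 := abs_lt.1 (hbd a ha)
    have h2 : |sgn b * ((1 + a.1 * a.2) / 16)| = (1 + a.1 * a.2) / 16 := by
      rw [abs_mul, abs_of_pos (by linarith [h1.1] : 0 < (1 + a.1 * a.2) / 16)]
      cases b <;> simp [sgn]
    rw [norm_coe_circle (by rw [h2]; linarith [h1.2]), h2]
  have hkap : ∀ b, ∀ a ∈ U, a.1 * a.2 =
      kap ((sgn b * ((1 + a.1 * a.2) / 16) : ℝ) : UnitAddCircle) := by
    intro b a ha
    have h1 := abs_lt.1 (hbd a ha)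
    rw [kap, hnorm b a ha, min_eq_left] <;> linarith [h1.2]
  classical
  -- Near a saddle the equation p q = 16‖y‖ - 1 is solved by y = ±(1 + p q) / 16, so (p, q) are
  -- coordinates; the sign selects one of the two saddles.
  let F : Bool → ℝ × ℝ → Model := fun b a => if ha : a ∈ U then
    ⟨(((sgn b * ((1 + a.1 * a.2) / 16) : ℝ) : UnitAddCircle), a.1, a.2), hkap b a ha⟩ else x
  have hF : ∀ b, ∀ a ∈ U, (F b a).1 =
      (((sgn b * ((1 + a.1 * a.2) / 16) : ℝ) : UnitAddCircle), a.1, a.2) := by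
    intro b a ha
    simp only [F, dif_pos ha]
  have hFc : ∀ b, ContinuousOn (F b) U := by
    intro b
    rw [(IsInducing.subtypeVal : IsInducing (Subtype.val : Model → _)).continuousOn_iff]
    refine ContinuousOn.congr (Continuous.continuousOn ?_) (hF b)
    exact (continuous_coe_circle.comp (by fun_prop)).prodMk (by fun_prop)
  have hinj : ∀ b, InjOn (glue g ∘ F b) U := by
    intro b
    have hmem : ∀ a ∈ U, ∀ a' ∈ U, ∀ n, StepN g n (F b a) (F b a') → a = a' := by
      rintro a ha a' ha' (- | n) h
      · have h0 : F b a = F b a' := h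
        have := congrArg (fun x : Model => x.1.2) h0
        simpa only [hF b a ha, hF b a' ha'] using this
      -- A chain of positive length would need |p| |q| ≥ e, which is impossible in the unit square.
      · have h1 := h.exp_le
        have e1 : (F b a).p = a.1 := by rw [Model.p, hF b a ha]
        have e2 : (F b a').q = a'.2 := by rw [Model.q, hF b a' ha']
        rw [e1, e2] at h1
        have h2 : |a.1| < 1 := abs_lt.2 ha.1
        have h3 : |a'.2| < 1 := abs_lt.2 ha'.2
        have h4 := Real.add_one_le_exp ((n : ℝ) + 1)
        nlinarith [abs_nonneg a.1, abs_nonneg a'.2, n.cast_nonneg (α := ℝ)]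
    intro a ha a' ha' h
    obtain ⟨n, h | h⟩ := glue_eq_iff.1 h
    · exact hmem a ha a' ha' n h
    · exact (hmem a' ha' a ha n h).symm
  have hopen : ∀ b, ∀ V ⊆ U, IsOpen V → IsOpen (F b '' V) := by
    intro b V hVU hV
    have : F b '' V = (fun x : Model => x.1.2) ⁻¹' V ∩ (fun x : Model => x.y) ⁻¹'
        ((↑) '' ((fun r : ℝ => sgn b * r) ⁻¹' Ioo 0 (1 / 2))) := by
      ext z
      constructor
      · rintro ⟨a, ha, rfl⟩
        have h1 := abs_lt.1 (hbd a (hVU ha))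
        refine ⟨?_, sgn b * ((1 + a.1 * a.2) / 16), ?_, ?_⟩
        · rw [mem_preimage, hF b a (hVU ha)]
          exact ha
        · rw [mem_preimage, ← mul_assoc, sgn_mul_self, one_mul]
          constructor <;> linarith [h1.1, h1.2]
        · simp only [Model.y]
          rw [hF b a (hVU ha)]
      · rintro ⟨hz, r, ⟨hr0, hr1⟩, hr⟩
        have hzU := hVU hz
        refine ⟨z.1.2, hz, Subtype.ext ?_⟩
        rw [hF b _ hzU]
        refine Prod.ext ?_ rfl
        rw [← show (r : UnitAddCircle) = z.1.1 from hr]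
        have hk := z.mul_eq
        rw [show z.y = (r : UnitAddCircle) from hr.symm, kap] at hk
        have hrs : r = sgn b * (sgn b * r) := by rw [← mul_assoc, sgn_mul_self, one_mul]
        have habs : |r| = sgn b * r := by
          have hr0' : 0 < sgn b * r := hr0
          rw [← abs_of_pos hr0', abs_mul]
          cases b <;> simp [sgn]
        rw [norm_coe_circle (by rw [habs]; exact hr1.le), habs] at hk
        have h1 := (abs_lt.1 (hbd _ hzU)).2
        have h2 : z.p * z.q = 16 * (sgn b * r) - 1 := by
          rcases min_choice (16 * (sgn b * r) - 1) 1 with h | h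
          · rw [hk, h]
          · rw [h] at hk
            exact absurd hk h1.ne
        have h3 : (1 + z.1.2.1 * z.1.2.2) / 16 = sgn b * r := by
          change (1 + z.p * z.q) / 16 = _
          rw [h2]
          ring
        simp only [h3, ← hrs]
    rw [this]
    refine (hV.preimage (by fun_prop)).inter (IsOpen.preimage (by fun_prop) ?_)
    exact isOpenMap_coe_circle _ (isOpen_Ioo.preimage (by fun_prop))
  have h0U : ((0 : ℝ), (0 : ℝ)) ∈ U := by simp [hU]
  have hxF : ∃ b, F b (0, 0) = x := by
    have hk := x.mul_eq
    rw [hp, zero_mul, kap] at hk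
    obtain ⟨r, hr, hxr⟩ : ∃ r : ℝ, |r| ≤ 1 / 2 ∧ x.y = (r : UnitAddCircle) := by
      obtain ⟨r, hr⟩ := QuotientAddGroup.mk_surjective x.y
      refine ⟨r - round r, abs_sub_round r, ?_⟩
      rw [← hr]
      have : ((round r : ℝ) : UnitAddCircle) = 0 :=
        AddCircle.coe_eq_zero_iff (p := (1 : ℝ)).2 ⟨round r, by simp⟩
      rw [AddCircle.coe_sub, this, sub_zero]
    rw [hxr, norm_coe_circle hr] at hk
    have hr16 : |r| = 1 / 16 := by
      rcases min_choice (16 * |r| - 1) 1 with h | h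
      · rw [h] at hk
        linarith
      · rw [h] at hk
        norm_num at hk
    have fin : ∀ b, r = sgn b * (1 / 16) → F b (0, 0) = x := by
      intro b hb
      refine Subtype.ext ?_
      rw [hF b _ h0U]
      refine Prod.ext ?_ (Prod.ext hp.symm hq.symm)
      change _ = x.y
      rw [hxr, hb]
      norm_num
    rcases abs_eq (by norm_num : (0 : ℝ) ≤ 1 / 16) |>.1 hr16 with h | h
    · exact ⟨true, fin true (by rw [h]; simp [sgn])⟩
    · exact ⟨false, fin false (by rw [h]; simp [sgn])⟩
  obtain ⟨b, hb⟩ := hxF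
  refine ⟨U, glue g ∘ F b, isOpen_Ioo.prod isOpen_Ioo, continuous_glue.comp_continuousOn (hFc b),
    hinj b, fun V hVU hV => ?_, (0, 0), h0U, by rw [Function.comp_apply, hb]⟩
  rw [image_comp]
  exact isOpenMap_glue _ (hopen b V hVU hV)

/-- Every point of the glued surface is a saddle or belongs to a cylinder. -/
lemma eq_saddle_or_mem_cyl (s : GluedSurface g) :
    (∃ x : Model, x.p = 0 ∧ x.q = 0 ∧ glue g x = s) ∨ ∃ b a, cyl g b a = s := by
  obtain ⟨x, rfl⟩ := glue_surjective s
  by_cases hp : x.p = 0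
  · by_cases hq : x.q = 0
    · exact Or.inl ⟨x, hp, hq, rfl⟩
    -- A point with p = 0 and q ≠ 0 has a predecessor under the gluing, and there p ≠ 0.
    · obtain ⟨b, a, h⟩ := exists_lam (step_bwd (g := g) hq).p_ne
      exact Or.inr ⟨b, a, by rw [cyl, h, (step_bwd hq).glue_eq]⟩
  · obtain ⟨b, a, h⟩ := exists_lam hp
    exact Or.inr ⟨b, a, by rw [cyl, h]⟩

lemma hasPlaneCharts_gluedSurface : HasPlaneCharts (GluedSurface g) := by
  intro s
  rcases eq_saddle_or_mem_cyl s with ⟨x, hp, hq, rfl⟩ | ⟨b, a, rfl⟩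
  · exact exists_plane_chart_saddle x hp hq
  · exact (isCylinder_cyl b).exists_plane_chart a

lemma finite_singularSet_gluedFlow : (singularSet (gluedFlow g)).Finite := by
  have hfin : (glue g '' {x : Model | x.p = 0 ∧ x.q = 0}).Finite := by
    refine Finite.image _ ?_
    have : {x : Model | x.p = 0 ∧ x.q = 0} ⊆ Subtype.val ⁻¹'
        (({((1 / 16 : ℝ) : UnitAddCircle), ((-(1 / 16) : ℝ) : UnitAddCircle)} : Set UnitAddCircle) ×ˢ
          ({(0, 0)} : Set (ℝ × ℝ))) := by
      rintro x ⟨hp, hq⟩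
      refine ⟨?_, Prod.ext hp hq⟩
      have hk := x.mul_eq
      rw [hp, zero_mul, kap] at hk
      obtain ⟨r, hr⟩ := QuotientAddGroup.mk_surjective x.y
      have hn : ‖x.y‖ = 1 / 16 := by
        rcases min_choice (16 * ‖x.y‖ - 1) 1 with h | h
        · rw [h] at hk
          linarith
        · rw [h] at hk
          norm_num at hk
      have hxr : x.y = ((r - round r : ℝ) : UnitAddCircle) := by
        rw [← hr]
        have : ((round r : ℝ) : UnitAddCircle) = 0 :=
          AddCircle.coe_eq_zero_iff (p := (1 : ℝ)).2 ⟨round r, by simp⟩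
        rw [AddCircle.coe_sub, this, sub_zero]
      rw [hxr, norm_coe_circle (abs_sub_round r)] at hn
      change x.y ∈ _
      rcases abs_eq (by norm_num : (0 : ℝ) ≤ 1 / 16) |>.1 hn with h | h
      · left
        rw [hxr, h]
      · right
        rw [hxr, h]
        rfl
    refine Finite.subset (Finite.preimage Subtype.val_injective.injOn ?_) this
    exact ((finite_singleton _).insert _).prod (finite_singleton _)
  refine hfin.subset fun s hs => ?_
  rcases eq_saddle_or_mem_cyl s with ⟨x, hp, hq, rfl⟩ | ⟨b, ⟨σ, y⟩, rfl⟩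
  · exact ⟨x, ⟨hp, hq⟩, rfl⟩
  -- Time 1/2 moves σ within the range where the cylinder is injective, so no point of a cylinder is
  -- fixed.
  · have := hs (1 / 2)
    rw [(isCylinder_cyl b).flow] at this
    have := ((isCylinder_cyl b).strip _ _ _ _ (by norm_num) this).1
    linarith

/-! ### The symmetry that reverses the flow -/

section Reversible

/-- The gluing maps are conjugate to their inverses by the reflection of the circle. -/
def Reversible (h : UnitAddCircle ≃ₜ UnitAddCircle) : Prop := ∀ y, h (-h (-y)) = y

/-- The symmetry of the model that reverses the flow. -/
def Model.flip (x : Model) : Model :=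
  ⟨(-x.y, x.q, x.p), by
    change x.q * x.p = kap (-x.y)
    rw [kap_neg, mul_comm, x.mul_eq]⟩

lemma Step.flip (hg : ∀ b, Reversible (g b)) {x x' : Model} (h : Step g x x') :
    Step g x'.flip x.flip := by
  refine ⟨(mul_comm _ _).trans h.1, ?_⟩
  have h2 : decide (0 < x'.flip.p) = decide (0 < x.p) := by
    simp only [decide_eq_decide]
    exact h.pos_iff
  rw [h2]
  change -x.y = g _ (-x'.y)
  have := hg (decide (0 < x.p)) (-x.y)
  rw [neg_neg, ← h.2] at this
  exact this.symm

/-- The symmetry of the surface that reverses the flow. -/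
def flip (hg : ∀ b, Reversible (g b)) : GluedSurface g → GluedSurface g :=
  Quot.lift (fun x => glue g x.flip) fun _ _ h => (h.flip hg).glue_eq.symm

variable (hg : ∀ b, Reversible (g b))

lemma continuous_flip : Continuous (flip hg) := by
  refine continuous_quot_lift _ (continuous_glue.comp ?_)
  unfold Model.flip
  fun_prop

lemma flip_glue (x : Model) : flip hg (glue g x) = glue g x.flip := rfl

lemma flip_flip (s : GluedSurface g) : flip hg (flip hg s) = s := by
  obtain ⟨x, rfl⟩ := glue_surjective s
  rw [flip_glue, flip_glue]
  exact congrArg (glue g) (Model.ext' (neg_neg _) rfl rfl)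

/-- The symmetry as a homeomorphism. -/
def flipHomeo : GluedSurface g ≃ₜ GluedSurface g where
  toFun := flip hg
  invFun := flip hg
  left_inv := flip_flip hg
  right_inv := flip_flip hg
  continuous_toFun := continuous_flip hg
  continuous_invFun := continuous_flip hg

lemma flip_flow (t : ℝ) (s : GluedSurface g) :
    (gluedFlow g).reverse t (flip hg s) = flip hg (gluedFlow g t s) := by
  obtain ⟨x, rfl⟩ := glue_surjective s
  rw [Flow.reverse_apply, flip_glue, gluedFlow_glue, gluedFlow_glue, flip_glue]
  refine congrArg (glue g) (Model.ext' rfl rfl ?_)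
  change Real.exp (- -t) * x.p = Real.exp t * x.p
  rw [neg_neg]

/-- The backward cylinders. -/
noncomputable def cylRev (b : Bool) (a : ℝ × UnitAddCircle) : GluedSurface g :=
  flip hg (cyl g b a)

lemma isCylinder_cylRev (b : Bool) :
    IsCylinder (gluedFlow g).reverse (g b) (cylRev hg b) where
  continuous := (continuous_flip hg).comp (isCylinder_cyl b).continuous
  isOpenMap := (flipHomeo hg).isOpenMap.comp (isCylinder_cyl b).isOpenMap
  flow t σ y := by rw [cylRev, flip_flow, (isCylinder_cyl b).flow]; rfl
  strip σ σ' y y' hσ h := (isCylinder_cyl b).strip _ _ _ _ hσ ((flipHomeo hg).injective h)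
  shift σ y hy := by rw [cylRev, (isCylinder_cyl b).shift _ _ hy]; rfl

/-- The central orbit leaves one sheet for the other. -/
lemma cylRev_false_zero (σ : ℝ) : cylRev hg false (σ, 0) = cyl g true (-σ, 0) := by
  refine congrArg (glue g) (Model.ext' (neg_zero) ?_ ?_)
  · change sgn false * kap 0 * Real.exp (-σ) = sgn true * Real.exp (-σ)
    simp [sgn, kap_zero]
  · change sgn false * Real.exp σ = sgn true * kap 0 * Real.exp (- -σ)
    simp [sgn, kap_zero]

/-- Invariant sets of the sheets do not meet the opposite sheet. -/
lemma cylRev_ne_cyl {b c : Bool} (hbc : b ≠ c) {L : Set UnitAddCircle} (hL : ∀ y, y ∈ L ↔ g b y ∈ L)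
    (hL8 : ∀ y ∈ L, 1 / 8 ≤ ‖y‖) {y : UnitAddCircle} (hy : y ∈ L) (σ : ℝ)
    (a : ℝ × UnitAddCircle) : cylRev hg b (σ, y) ≠ cyl g c a := by
  have hL' : ∀ y, -y ∈ L ↔ -(g b y) ∈ L := by
    intro y
    have := hg b (-y)
    rw [neg_neg] at this
    rw [hL (-(g b y)), this]
  -- The point lies over -L (the sign comes from the flip) and p, q both have the sign of the sheet
  -- b. Since kap = 1 over L, steps preserve this, so it descends to the surface, where it holds on
  -- the left side and fails on the sheet c.
  let P : Model → Prop := fun x => -x.y ∈ L ∧ 0 < sgn b * x.p ∧ 0 < sgn b * x.q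
  have hP : ∀ x z, Step g x z → (P x ↔ P z) := by
    intro x z h
    have sg : ∀ w : Model, -w.y ∈ L → (0 < sgn b * w.p ↔ 0 < sgn b * w.q) := by
      intro w hw
      have h1 : (sgn b * w.p) * (sgn b * w.q) = 1 := by
        rw [← kap_eq_one (hL8 _ hw), kap_neg, ← w.mul_eq]
        linear_combination (w.p * w.q) * sgn_mul_self b
      have h1' : 0 < (sgn b * w.p) * (sgn b * w.q) := by rw [h1]; exact one_pos
      exact ⟨fun h2 => pos_of_mul_pos_right h1' h2.le, fun h2 => pos_of_mul_pos_left h1' h2.le⟩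
    have hpq : 0 < sgn b * x.p ↔ 0 < sgn b * z.q := by
      have h1' : 0 < (sgn b * x.p) * (sgn b * z.q) := by
        have := h.1
        have : (sgn b * x.p) * (sgn b * z.q) = Real.exp 1 := by
          rw [← this]
          linear_combination (x.p * z.q) * sgn_mul_self b
        rw [this]
        exact Real.exp_pos 1
      exact ⟨fun h2 => pos_of_mul_pos_right h1' h2.le, fun h2 => pos_of_mul_pos_left h1' h2.le⟩
    have hb : 0 < sgn b * x.p → decide (0 < x.p) = b := by
      intro h2
      have := decide_sgn_mul b h2
      rwa [← mul_assoc, sgn_mul_self, one_mul] at this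
    constructor
    · rintro ⟨h1, h2, h3⟩
      have hz : -z.y ∈ L := by
        rw [h.2, hb h2]
        exact (hL' _).1 h1
      exact ⟨hz, (sg z hz).2 (hpq.1 h2), hpq.1 h2⟩
    · rintro ⟨h1, h2, h3⟩
      have hx : -x.y ∈ L := by
        rw [h.2, hb (hpq.2 h3)] at h1
        exact (hL' _).2 h1
      exact ⟨hx, hpq.2 h3, (sg x hx).1 (hpq.2 h3)⟩
  let Q : GluedSurface g → Prop := Quot.lift P fun x z h => propext (hP x z h)
  intro heq
  have h1 : Q (cylRev hg b (σ, y)) := by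
    refine ⟨?_, ?_, ?_⟩
    · change - -y ∈ L
      rwa [neg_neg]
    · change 0 < sgn b * (sgn b * kap y * Real.exp (-σ))
      rw [kap_eq_one (hL8 _ hy), mul_one, ← mul_assoc, sgn_mul_self, one_mul]
      exact Real.exp_pos _
    · change 0 < sgn b * (sgn b * Real.exp σ)
      rw [← mul_assoc, sgn_mul_self, one_mul]
      exact Real.exp_pos _
  rw [heq] at h1
  have h2 : 0 < sgn b * (sgn c * Real.exp a.1) := h1.2.1
  have h3 : sgn b * sgn c = -1 := by
    cases b <;> cases c <;> first | exact absurd rfl hbc | norm_num [sgn]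
  rw [← mul_assoc, h3] at h2
  linarith [Real.exp_pos a.1]

end Reversible

end Cylinders

end SurfaceFlow

namespace SurfaceFlow

/-! ### Suspensions: limit sets and flow boxes in a cylinder -/

section Ends

variable {S : Type*} [TopologicalSpace S] {v : Flow ℝ S}
  {h : UnitAddCircle ≃ₜ UnitAddCircle} {Λ : ℝ × UnitAddCircle → S}

/-- `L` is an invariant set away from the slit which is the limit set of the orbit of `c`, and this
orbit is away from the slit. -/
structure IsLimitOf (h : UnitAddCircle ≃ₜ UnitAddCircle) (L : Set UnitAddCircle)
    (c : UnitAddCircle) : Prop where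
  mem_iff : ∀ y, y ∈ L ↔ h y ∈ L
  away : ∀ y ∈ L, 1 / 8 ≤ ‖y‖
  isClosed : IsClosed L
  orbit_away : ∀ n, 0 < n → 1 / 8 ≤ ‖h^[n] c‖
  cluster : ∀ l, MapClusterPt l atTop (fun n => h^[n] c) ↔ l ∈ L

namespace IsCylinder

variable (hΛ : IsCylinder v h Λ)
include hΛ

lemma shift_iterate {y : UnitAddCircle} (hy : ∀ n, 0 < n → 1 / 8 ≤ ‖h^[n] y‖) (n : ℕ) (σ : ℝ) :
    Λ (σ, y) = Λ (σ - n, h^[n] y) := by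
  induction n with
  | zero => simp
  | succ n ih =>
    rw [ih, hΛ.shift, ← Function.iterate_succ_apply' h n y]
    · rw [sub_sub, Nat.cast_succ]
    · rw [← Function.iterate_succ_apply' h n y]
      exact hy _ n.succ_pos

/-- Applying `shift` as often as the integer part of σ - σ' allows leaves a difference less than 1,
where the cylinder is injective. -/
lemma eq_of_eq {y z : UnitAddCircle} (hy : ∀ n, 0 < n → 1 / 8 ≤ ‖h^[n] y‖) {σ σ' : ℝ}
    (hσ : σ' ≤ σ) (heq : Λ (σ, y) = Λ (σ', z)) : ∃ n : ℕ, σ = σ' + n ∧ h^[n] y = z := by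
  rw [hΛ.shift_iterate hy ⌊σ - σ'⌋₊] at heq
  have h1 := Nat.floor_le (sub_nonneg.2 hσ)
  have h2 := Nat.lt_floor_add_one (σ - σ')
  obtain ⟨h3, h4⟩ := hΛ.strip _ _ _ _ (by rw [abs_lt]; constructor <;> linarith) heq
  exact ⟨_, by linarith, h4⟩

lemma ne_of_aperiodic {y : UnitAddCircle} (hy : ∀ n, 0 < n → 1 / 8 ≤ ‖h^[n] y‖)
    (hper : ∀ n, 0 < n → h^[n] y ≠ y) {σ σ' : ℝ} (hσ : σ ≠ σ') : Λ (σ, y) ≠ Λ (σ', y) := by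
  have key : ∀ σ σ', σ' ≤ σ → Λ (σ, y) = Λ (σ', y) → σ = σ' := by
    intro σ σ' hle heq
    obtain ⟨n, h1, h2⟩ := hΛ.eq_of_eq hy hle heq
    rcases n.eq_zero_or_pos with rfl | hn
    · simpa using h1
    · exact absurd h2 (hper n hn)
  intro heq
  rcases le_total σ' σ with hle | hle
  · exact hσ (key _ _ hle heq)
  · exact hσ (key _ _ hle heq.symm).symm

/-- Over an invariant set away from the slit `shift` works in both directions, so σ can be moved
into any fundamental interval. -/
lemma exists_normalized {L : Set UnitAddCircle} (hL : ∀ y, y ∈ L ↔ h y ∈ L)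
    (hL8 : ∀ y ∈ L, 1 / 8 ≤ ‖y‖) (a σ : ℝ) {y : UnitAddCircle} (hy : y ∈ L) :
    ∃ σ' ∈ Ico a (a + 1), ∃ y' ∈ L, Λ (σ, y) = Λ (σ', y') := by
  have key : ∀ n : ℕ, ∀ σ, ∀ y ∈ L, (∃ y' ∈ L, Λ (σ, y) = Λ (σ - n, y')) ∧
      ∃ y' ∈ L, Λ (σ, y) = Λ (σ + n, y') := by
    intro n
    induction n with
    | zero => exact fun σ y hy => ⟨⟨y, hy, by simp⟩, y, hy, by simp⟩
    | succ n ih =>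
      intro σ y hy
      obtain ⟨⟨y1, h1, e1⟩, y2, h2, e2⟩ := ih σ y hy
      refine ⟨⟨h y1, (hL _).1 h1, ?_⟩, h.symm y2, (hL _).2 (by simpa using h2), ?_⟩
      · rw [e1, hΛ.shift _ _ (hL8 _ ((hL _).1 h1))]
        push_cast
        ring_nf
      · have := hΛ.shift (σ + n + 1) (h.symm y2) (by simpa using hL8 _ h2)
        rw [h.apply_symm_apply] at this
        rw [e2]
        push_cast
        rw [← add_assoc, this]
        ring_nf
  have hm : σ - ⌊σ - a⌋ ∈ Ico a (a + 1) := by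
    have h1 := Int.floor_le (σ - a)
    have h2 := Int.lt_floor_add_one (σ - a)
    constructor <;> linarith
  refine ⟨_, hm, ?_⟩
  obtain ⟨n, hn | hn⟩ := Int.eq_nat_or_neg ⌊σ - a⌋
  · rw [hn]
    exact (key n σ y hy).1
  · rw [hn]
    have := (key n σ y hy).2
    simpa using this

lemma mem_image_iff {L : Set UnitAddCircle} (hL : ∀ y, y ∈ L ↔ h y ∈ L)
    (hL8 : ∀ y ∈ L, 1 / 8 ≤ ‖y‖) {σ : ℝ} {y : UnitAddCircle} :
    Λ (σ, y) ∈ Λ '' (univ ×ˢ L) ↔ y ∈ L := by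
  refine ⟨?_, fun hy => ⟨_, ⟨trivial, hy⟩, rfl⟩⟩
  rintro ⟨⟨σ', y'⟩, ⟨-, hy'⟩, heq⟩
  obtain ⟨σ'', hσ, y'', hy'', h1⟩ := hΛ.exists_normalized hL hL8 (σ - 1 / 2) σ' hy'
  rw [h1] at heq
  have := (hΛ.strip _ _ _ _ (by rw [abs_lt]; constructor <;> linarith [hσ.1, hσ.2]) heq).2
  rwa [← this]

lemma image_eq {L : Set UnitAddCircle} (hL : ∀ y, y ∈ L ↔ h y ∈ L)
    (hL8 : ∀ y ∈ L, 1 / 8 ≤ ‖y‖) : Λ '' (univ ×ˢ L) = Λ '' (Icc 0 1 ×ˢ L) := by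
  refine Subset.antisymm ?_ (image_mono (prod_mono_left (subset_univ _)))
  rintro _ ⟨⟨σ, y⟩, ⟨-, hy⟩, rfl⟩
  obtain ⟨σ', hσ, y', hy', e⟩ := hΛ.exists_normalized hL hL8 0 σ hy
  exact ⟨(σ', y'), ⟨⟨hσ.1, by linarith [hσ.2]⟩, hy'⟩, e.symm⟩

lemma isCompact_image {L : Set UnitAddCircle} (hL : ∀ y, y ∈ L ↔ h y ∈ L)
    (hL8 : ∀ y ∈ L, 1 / 8 ≤ ‖y‖) (hc : IsClosed L) : IsCompact (Λ '' (univ ×ˢ L)) := by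
  rw [hΛ.image_eq hL hL8]
  exact (isCompact_Icc.prod hc.isCompact).image hΛ.continuous

lemma flow_mem_image {L : Set UnitAddCircle} {z : S} (hz : z ∈ Λ '' (univ ×ˢ L)) (t : ℝ) :
    v t z ∈ Λ '' (univ ×ˢ L) := by
  obtain ⟨⟨σ, y⟩, ⟨-, hy⟩, rfl⟩ := hz
  rw [hΛ.flow]
  exact ⟨(σ + t, y), ⟨trivial, hy⟩, rfl⟩

/-- Modulo `shift` the time coordinate stays in [0, 1], so a limit point of the orbit lies in the
image of [0, 1] times the closure of every tail of the iterates of c. A nested intersection of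
compact sets yields one pair (σ, l) for all tails, and l is a cluster point. Conversely, the n-th
iterate at height σ is the orbit at time n + σ - σ₀. -/
lemma omegaSet_eq [T2Space S] {L : Set UnitAddCircle} {c : UnitAddCircle} (hc : IsLimitOf h L c)
    (σ₀ : ℝ) : omegaSet v (Λ (σ₀, c)) = Λ '' (univ ×ˢ L) := by
  ext z
  rw [mem_omegaSet]
  simp only [hΛ.flow]
  constructor
  · intro hz
    set A : ℕ → Set UnitAddCircle := fun N => closure ((fun n => h^[n] c) '' Ici N) with hA
    have hAm : ∀ N, A (N + 1) ⊆ A N := fun N => closure_mono (image_mono (Ici_subset_Ici.2 (by simp)))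
    have hcomp : ∀ N, IsCompact (Icc (0 : ℝ) 1 ×ˢ A N) := fun N =>
      isCompact_Icc.prod isClosed_closure.isCompact
    have hmem : ∀ N, z ∈ Λ '' (Icc (0 : ℝ) 1 ×ˢ A N) := by
      intro N
      rw [← ((hcomp N).image hΛ.continuous).isClosed.closure_eq, mem_closure_iff_nhds]
      intro U hU
      obtain ⟨t, ht, htU⟩ := frequently_atTop.1 (mapClusterPt_iff_frequently.1 hz U hU) (N - σ₀)
      refine ⟨_, htU, ⟨_, h^[⌊σ₀ + t⌋₊] c⟩, ⟨⟨?_, ?_⟩, subset_closure ⟨⌊σ₀ + t⌋₊, ?_, rfl⟩⟩,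
        (hΛ.shift_iterate hc.orbit_away ⌊σ₀ + t⌋₊ _).symm⟩
      · have := Nat.floor_le (show 0 ≤ σ₀ + t by linarith [N.cast_nonneg (α := ℝ)])
        change 0 ≤ σ₀ + t - _
        linarith
      · have := Nat.lt_floor_add_one (σ₀ + t)
        change σ₀ + t - _ ≤ 1
        linarith
      · exact Nat.le_floor (by linarith)
    have hne := IsCompact.nonempty_iInter_of_sequence_nonempty_isCompact_isClosed
      (fun N => Λ ⁻¹' {z} ∩ (Icc (0 : ℝ) 1 ×ˢ A N))
      (fun N => inter_subset_inter_right _ (prod_mono_right (hAm N)))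
      (fun N => by
        obtain ⟨a, ha, e⟩ := hmem N
        exact ⟨a, e, ha⟩)
      ((hcomp 0).inter_left (isClosed_singleton.preimage hΛ.continuous))
      (fun N => (isClosed_singleton.preimage hΛ.continuous).inter (hcomp N).isClosed)
    obtain ⟨⟨σ, l⟩, hl⟩ := hne
    rw [mem_iInter] at hl
    refine ⟨(σ, l), ⟨trivial, (hc.cluster l).1 ?_⟩, (hl 0).1⟩
    rw [mapClusterPt_iff_frequently]
    intro U hU
    rw [frequently_atTop]
    intro N
    obtain ⟨_, h1, n, hn, rfl⟩ := mem_closure_iff_nhds.1 (hl N).2.2 U hU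
    exact ⟨n, hn, h1⟩
  · rintro ⟨⟨σ, l⟩, ⟨-, hl⟩, rfl⟩
    have h1 := (hc.cluster l).2 hl
    have hcont : Continuous fun y => Λ (σ, y) := hΛ.continuous.comp (by fun_prop)
    have h2 : MapClusterPt (Λ (σ, l)) atTop ((fun y => Λ (σ, y)) ∘ fun n => h^[n] c) :=
      h1.continuousAt_comp (f := fun y => Λ (σ, y)) hcont.continuousAt
    have h3 : ((fun y => Λ (σ, y)) ∘ fun n => h^[n] c) =
        (fun t => Λ (σ₀ + t, c)) ∘ fun n : ℕ => (n : ℝ) + (σ - σ₀) := by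
      funext n
      simp only [Function.comp]
      rw [hΛ.shift_iterate hc.orbit_away n (σ₀ + _)]
      ring_nf
    rw [h3] at h2
    exact MapClusterPt.of_comp
      (tendsto_atTop_add_const_right _ _ tendsto_natCast_atTop_atTop) h2

end IsCylinder

/-- A rectangle in a cylinder. -/
noncomputable def box (Λ : ℝ × UnitAddCircle → S) (σ a r₀ r₁ : ℝ) (z : unitInterval × unitInterval) :
    S := Λ (σ - a + 2 * a * z.1, ((r₀ + z.2 * (r₁ - r₀) : ℝ) : UnitAddCircle))

namespace IsCylinder

variable (hΛ : IsCylinder v h Λ)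
include hΛ

lemma isEmbedding_box [T2Space S] {σ a r₀ r₁ : ℝ} (ha : 0 < a) (ha' : a < 1 / 2) (hr : r₀ < r₁)
    (hr' : r₁ - r₀ < 1) : IsEmbedding (box Λ σ a r₀ r₁) := by
  have hc : Continuous (box Λ σ a r₀ r₁) :=
    hΛ.continuous.comp ((by fun_prop : Continuous _).prodMk
      (continuous_coe_circle.comp (by fun_prop)))
  refine (hc.isClosedEmbedding ?_).isEmbedding
  rintro ⟨s, t⟩ ⟨s', t'⟩ heq
  have b1 := s.2.1
  have b2 := s.2.2
  have b3 := s'.2.1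
  have b4 := s'.2.2
  have b5 := t.2.1
  have b6 := t.2.2
  have b7 := t'.2.1
  have b8 := t'.2.2
  obtain ⟨e1, e2⟩ := hΛ.strip _ _ _ _ (by rw [abs_lt]; constructor <;> simp only <;> nlinarith) heq
  have e3 := coe_circle_injOn (by rw [abs_lt]; constructor <;> simp only <;> nlinarith) e2
  simp only at e1 e3
  have e4 : (s : ℝ) = s' := by
    have : 2 * a * ((s : ℝ) - s') = 0 := by linarith
    rcases mul_eq_zero.1 this with h0 | h0 <;> linarith
  have e5 : (t : ℝ) = t' := by
    have : ((t : ℝ) - t') * (r₁ - r₀) = 0 := by linarith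
    rcases mul_eq_zero.1 this with h0 | h0 <;> linarith
  exact Prod.ext (Subtype.ext e4) (Subtype.ext e5)

lemma range_box_mem_nhds {σ a r r₀ r₁ : ℝ} (ha : 0 < a) (hr : r ∈ Ioo r₀ r₁) :
    range (box Λ σ a r₀ r₁) ∈ 𝓝 (Λ (σ, (r : UnitAddCircle))) := by
  have h1 : IsOpen (Λ '' (Ioo (σ - a) (σ + a) ×ˢ ((↑) '' Ioo r₀ r₁))) :=
    hΛ.isOpenMap _ (isOpen_Ioo.prod (isOpenMap_coe_circle _ isOpen_Ioo))
  refine mem_of_superset (h1.mem_nhds ⟨(σ, r), ⟨⟨by linarith, by linarith⟩, r, hr, rfl⟩, rfl⟩) ?_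
  rintro _ ⟨⟨σ', y⟩, ⟨⟨h2, h3⟩, r', ⟨h4, h5⟩, rfl⟩, rfl⟩
  simp only at h2 h3
  have hr0 : 0 < r₁ - r₀ := by linarith [hr.1, hr.2]
  refine ⟨(⟨(σ' - σ + a) / (2 * a), ?_, ?_⟩, ⟨(r' - r₀) / (r₁ - r₀), ?_, ?_⟩), ?_⟩
  · exact div_nonneg (by linarith) (by linarith)
  · rw [div_le_one (by linarith)]
    linarith
  · exact div_nonneg (by linarith) hr0.le
  · rw [div_le_one hr0]
    linarith
  · simp only [box]
    congr 3
    · field_simp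
      ring
    · field_simp
      ring

/-- A horizontal segment is an arc of a v-orbit that avoids Z, and such arcs remain orbit arcs after
the time change. -/
lemma isTrivialFlowBox_box [T2Space S] {u : Flow ℝ S} {Z : Set S} (hu : IsTimeChange v u Z)
    {σ a r₀ r₁ : ℝ} (ha : 0 < a) (ha' : a < 1 / 2) (hr : r₀ < r₁) (hr' : r₁ - r₀ < 1)
    (hZ : ∀ σ' ∈ Icc (σ - a) (σ + a), ∀ r' ∈ Icc r₀ r₁, Λ (σ', (r' : UnitAddCircle)) ∉ Z) :
    IsTrivialFlowBox u (box Λ σ a r₀ r₁) := by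
  refine ⟨hΛ.isEmbedding_box ha ha' hr hr', fun s s' t => ?_⟩
  have e : box Λ σ a r₀ r₁ (s', t) = v (2 * a * (s' - s)) (box Λ σ a r₀ r₁ (s, t)) := by
    simp only [box, hΛ.flow]
    ring_nf
  rw [e]
  refine hu.mem_orbit fun r hr0 => ?_
  simp only [box, hΛ.flow]
  have b1 := s.2.1
  have b2 := s.2.2
  have b3 := s'.2.1
  have b4 := s'.2.2
  have b5 := t.2.1
  have b6 := t.2.2
  refine hZ _ ?_ _ ⟨by nlinarith, by nlinarith⟩
  have hb : ∀ x : ℝ, x ∈ uIcc (s : ℝ) s' → x ∈ Icc (0 : ℝ) 1 := by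
    intro x hx
    exact uIcc_subset_Icc s.2 s'.2 hx
  rw [mem_uIcc] at hr0
  rcases hr0 with ⟨h1, h2⟩ | ⟨h1, h2⟩ <;> constructor <;> nlinarith

lemma exists_small_box {Z : Set S} (hZ : IsClosed Z) {σ r : ℝ}
    (hz : Λ (σ, (r : UnitAddCircle)) ∉ Z) : ∃ η, 0 < η ∧ η < 1 / 2 ∧
      ∀ σ' ∈ Icc (σ - η) (σ + η), ∀ r' ∈ Icc (r - η) (r + η), Λ (σ', (r' : UnitAddCircle)) ∉ Z := by
  have hc : Continuous fun a : ℝ × ℝ => Λ (a.1, (a.2 : UnitAddCircle)) :=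
    hΛ.continuous.comp (continuous_fst.prodMk (continuous_coe_circle.comp continuous_snd))
  have ho : IsOpen ((fun a : ℝ × ℝ => Λ (a.1, (a.2 : UnitAddCircle))) ⁻¹' Zᶜ) :=
    hZ.isOpen_compl.preimage hc
  obtain ⟨ε, hε, hball⟩ := Metric.isOpen_iff.1 ho (σ, r) hz
  refine ⟨min (ε / 2) (1 / 4), by positivity, by
    have := min_le_right (ε / 2) (1 / 4)
    linarith, fun σ' hσ' r' hr' =>
    show (σ', r') ∈ (fun a : ℝ × ℝ => Λ (a.1, (a.2 : UnitAddCircle))) ⁻¹' Zᶜ from hball ?_⟩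
  have h1 := min_le_left (ε / 2) (1 / 4)
  rw [Metric.mem_ball, Prod.dist_eq, max_lt_iff, Real.dist_eq, Real.dist_eq, abs_lt, abs_lt]
  simp only
  refine ⟨⟨?_, ?_⟩, ?_, ?_⟩ <;> linarith [hσ'.1, hσ'.2, hr'.1, hr'.2]

end IsCylinder

end Ends

end SurfaceFlow

namespace SurfaceFlow

/-! ### Recognizing the types of limit sets in a cylinder -/

section EndTypes

variable {S : Type*} [TopologicalSpace S] [T2Space S] {v u : Flow ℝ S} {Z : Set S}
  {h : UnitAddCircle ≃ₜ UnitAddCircle} {Λ : ℝ × UnitAddCircle → S}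

omit [T2Space S] in
lemma mem_nonclosedProperSet_of_isEmbedding {x : S} (hx : IsEmbedding fun t => u t x) :
    x ∈ nonclosedProperSet u := by
  refine ⟨?_, hx⟩
  have key : ∀ t, t ≠ 0 → u t x ≠ x := by
    intro t ht heq
    exact ht (hx.injective (heq.trans (u.map_zero_apply x).symm))
  rintro (H | ⟨T, hT, H, -⟩)
  · exact key 1 one_ne_zero (H 1)
  · exact key T hT.ne' H

omit [T2Space S] in
lemma omegaSet_subset_closure (x : S) : omegaSet u x ⊆ closure (u.orbit x) := by
  intro y hy
  rw [mem_omegaSet] at hy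
  rw [mem_closure_iff_nhds]
  intro U hU
  obtain ⟨t, ht⟩ := (mapClusterPt_iff_frequently.1 hy U hU).exists
  exact ⟨_, ht, t, rfl⟩

namespace IsCylinder

variable (hΛ : IsCylinder v h Λ)
include hΛ

/-- An interior point would stay put under small changes of σ, against injectivity. -/
lemma isNowhereDense_singleton (a : ℝ × UnitAddCircle) : IsNowhereDense {Λ a} := by
  rw [IsNowhereDense, closure_singleton, eq_empty_iff_forall_notMem]
  intro p hp
  obtain ⟨σ, y⟩ := a
  have hpa : p = Λ (σ, y) := mem_singleton_iff.1 (interior_subset hp)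
  subst hpa
  have hc : Continuous fun r : ℝ => Λ (σ + r, y) := hΛ.continuous.comp (by fun_prop)
  have h0 : (fun r : ℝ => Λ (σ + r, y)) ⁻¹' interior {Λ (σ, y)} ∈ 𝓝 0 :=
    (isOpen_interior.preimage hc).mem_nhds (by simpa using hp)
  obtain ⟨ε, hε, hball⟩ := Metric.mem_nhds_iff.1 h0
  have hm : min (ε / 2) (1 / 2) ∈ Metric.ball (0 : ℝ) ε := by
    rw [Metric.mem_ball, dist_zero_right, Real.norm_eq_abs, abs_of_pos (by positivity)]
    exact (min_le_left _ _).trans_lt (by linarith)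
  have e : Λ (σ + min (ε / 2) (1 / 2), y) = Λ (σ, y) :=
    mem_singleton_iff.1 (interior_subset (hball hm))
  have hp0 : 0 < min (ε / 2) (1 / 2) := by positivity
  have := (hΛ.strip _ _ _ _ (by
    rw [add_sub_cancel_left, abs_of_pos hp0]
    exact (min_le_right _ _).trans_lt (by norm_num)) e).1
  linarith

omit [T2Space S] in
lemma isPeriodicPoint {y : UnitAddCircle} (hy : h y = y) (hy8 : 1 / 8 ≤ ‖y‖) (σ : ℝ) :
    IsPeriodicPoint v (Λ (σ, y)) := by
  refine ⟨1, one_pos, ?_, fun t ht heq => ?_⟩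
  · rw [hΛ.flow, hΛ.shift _ _ (by rwa [hy]), hy, add_sub_cancel_right]
  · rw [hΛ.flow] at heq
    have := (hΛ.strip _ _ _ _ (by
      rw [add_sub_cancel_left, abs_of_pos ht.1]
      exact ht.2) heq).1
    linarith [ht.1]

omit [T2Space S] in
lemma image_singleton_eq_orbit (y : UnitAddCircle) : Λ '' (univ ×ˢ {y}) = v.orbit (Λ (0, y)) := by
  ext z
  constructor
  · rintro ⟨⟨σ, y'⟩, ⟨-, rfl⟩, rfl⟩
    exact ⟨σ, (hΛ.flow _ _ _).trans (by rw [zero_add])⟩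
  · rintro ⟨t, rfl⟩
    exact ⟨(t, y), ⟨trivial, rfl⟩, ((hΛ.flow _ _ _).trans (by rw [zero_add])).symm⟩

variable (hu : IsTimeChange v u Z)
include hu

omit [T2Space S] in
lemma not_isClosedPoint (hh : ∀ n, 0 < n → 1 / 8 ≤ ‖h^[n] 0‖) {σ : ℝ} (hx : Λ (σ, 0) ∉ Z) :
    ¬ IsClosedPoint u (Λ (σ, 0)) := by
  refine hu.not_isClosedPoint hx fun t ht => ?_
  rw [hΛ.flow]
  refine hΛ.ne_of_aperiodic hh (fun n hn h0 => ?_) (by simpa using ht)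
  have := hh n hn
  rw [h0, norm_zero] at this
  norm_num at this

lemma omegaSet_eq_singleton {b : ℝ} (hb : 0 < b) (hz : Λ (b, 0) ∈ Z)
    (hx : ∀ s ∈ Ico 0 b, Λ (s, 0) ∉ Z) : omegaSet u (Λ (0, 0)) = {Λ (b, 0)} := by
  have e : ∀ s, v s (Λ (0, 0)) = Λ (s, 0) := fun s => by rw [hΛ.flow, zero_add]
  rw [hu.omegaSet_eq_singleton hb (by rwa [e]) (fun s hs => by rw [e]; exact hx s hs), e]

lemma omegaSet_timeChange_eq {L : Set UnitAddCircle} {c : UnitAddCircle} (hc : IsLimitOf h L c)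
    (hx : ∀ s, 0 ≤ s → Λ (s, c) ∉ Z) : omegaSet u (Λ (0, c)) = Λ '' (univ ×ˢ L) := by
  rw [hu.omegaSet_eq, hΛ.omegaSet_eq hc]
  intro s hs
  rw [hΛ.flow, zero_add]
  exact hx s hs

lemma isLimitCycle {y : UnitAddCircle} (hy : IsLimitOf h {y} 0)
    (hZ : ∀ σ, Λ (σ, y) ∉ Z) (hx : ∀ s, 0 ≤ s → Λ (s, 0) ∉ Z) :
    IsLimitCycle u (Λ '' (univ ×ˢ {y})) := by
  have hZ' : ∀ s, v s (Λ (0, y)) ∉ Z := by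
    intro s
    rw [hΛ.flow]
    exact hZ _
  have hfix : h y = y := (hy.mem_iff y).1 rfl
  refine ⟨⟨Λ (0, y), hu.isPeriodicPoint hZ' (hΛ.isPeriodicPoint hfix (hy.away y rfl) 0), ?_⟩,
    Λ (0, 0), ?_, Or.inl (hΛ.omegaSet_timeChange_eq hu hy hx)⟩
  · rw [hu.orbit_eq hZ', hΛ.image_singleton_eq_orbit]
  · rw [hΛ.mem_image_iff hy.mem_iff hy.away]
    intro h0
    have := hy.away 0 h0
    rw [norm_zero] at this
    norm_num at this

lemma isTransverselyCantorQSet {L : Set UnitAddCircle} {c : UnitAddCircle} (hc : IsLimitOf h L c)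
    (hcL : c ∈ L) (hper : ∀ n, 0 < n → h^[n] c ≠ c) (hacc : Preperfect L) (hint : interior L = ∅)
    (hZc : IsClosed Z) (hZ : ∀ σ, ∀ y ∈ L, Λ (σ, y) ∉ Z) :
    IsTransverselyCantorQSet u (Λ '' (univ ×ˢ L)) := by
  have hω := hΛ.omegaSet_timeChange_eq hu hc fun s _ => hZ s c hcL
  have hout : ∀ a b : ℝ, a < b → ∃ r ∈ Ioo a b, (r : UnitAddCircle) ∉ L := by
    intro a b hab
    by_contra! hcon
    have h1 : (↑) '' Ioo a b ⊆ interior L := interior_maximal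
      (by rintro _ ⟨r, hr, rfl⟩; exact hcon r hr) (isOpenMap_coe_circle _ isOpen_Ioo)
    rw [hint, subset_empty_iff, image_eq_empty, Ioo_eq_empty_iff] at h1
    exact h1 hab
  refine ⟨⟨Λ (0, c), hu.not_isClosedPoint (hZ _ _ hcL) fun t ht => ?_, Or.inl ?_, ?_⟩, ?_⟩
  · rw [hΛ.flow]
    exact hΛ.ne_of_aperiodic hc.orbit_away hper (by simpa using ht)
  · rw [hω]
    exact ⟨_, ⟨trivial, hcL⟩, rfl⟩
  · refine (hω ▸ omegaSet_subset_closure _).antisymm (closure_minimal ?_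
      (hΛ.isCompact_image hc.mem_iff hc.away hc.isClosed).isClosed)
    refine (hu.orbit_subset _).trans ?_
    rintro _ ⟨t, rfl⟩
    exact hΛ.flow_mem_image ⟨_, ⟨trivial, hcL⟩, rfl⟩ t
  rintro _ ⟨⟨σ, y⟩, ⟨-, hy⟩, rfl⟩ -
  obtain ⟨r, rfl⟩ := QuotientAddGroup.mk_surjective y
  obtain ⟨η, hη, hη2, hη3⟩ := hΛ.exists_small_box hZc (hZ σ _ hy)
  -- Both ends of the vertical interval are chosen outside L, possible since L has empty interior.
  -- Then the trace of L avoids 0 and 1, where accumulation might come only from outside the box,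
  -- and so it remains perfect.
  obtain ⟨r₀, ⟨h1, h2⟩, h3⟩ := hout (r - η) r (by linarith)
  obtain ⟨r₁, ⟨h4, h5⟩, h6⟩ := hout r (r + η) (by linarith)
  have hlt : r₀ < r₁ := h2.trans h4
  have hcψ : Continuous fun t : ℝ => ((r₀ + t * (r₁ - r₀) : ℝ) : UnitAddCircle) :=
    continuous_coe_circle.comp (by fun_prop)
  have hoψ : IsOpenMap fun t : ℝ => ((r₀ + t * (r₁ - r₀) : ℝ) : UnitAddCircle) := by
    have h7 : IsOpenMap fun t : ℝ => r₀ + t * (r₁ - r₀) :=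
      ((Homeomorph.mulRight₀ _ (sub_pos.2 hlt).ne').trans (Homeomorph.addLeft r₀)).isOpenMap
    exact isOpenMap_coe_circle.comp h7
  have hclosed : IsClosed {t : unitInterval | ((r₀ + t * (r₁ - r₀) : ℝ) : UnitAddCircle) ∈ L} :=
    hc.isClosed.preimage (hcψ.comp continuous_subtype_val)
  refine ⟨box Λ σ η r₀ r₁, hΛ.isTrivialFlowBox_box hu hη hη2 hlt (by linarith)
    (fun σ' hσ' r' hr' => hη3 σ' hσ' r' ⟨by linarith [hr'.1], by linarith [hr'.2]⟩),
    hΛ.range_box_mem_nhds hη ⟨h2, h4⟩,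
    {t : unitInterval | ((r₀ + t * (r₁ - r₀) : ℝ) : UnitAddCircle) ∈ L},
    ⟨⟨⟨(r - r₀) / (r₁ - r₀), div_nonneg (by linarith) (by linarith),
      (div_le_one (by linarith)).2 (by linarith)⟩, ?_⟩, hclosed.isCompact, ⟨hclosed, ?_⟩, ?_⟩, ?_⟩
  · rw [mem_ofPred_eq, div_mul_cancel₀ _ (sub_pos.2 hlt).ne', add_sub_cancel]
    exact hy
  · intro t ht
    rw [accPt_iff_nhds]
    intro U hU
    obtain ⟨V, hV, hVU⟩ := mem_nhds_subtype unitInterval t U |>.1 hU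
    obtain ⟨W, hWV, hW, htW⟩ := mem_nhds_iff.1 hV
    have ht0 : (0 : ℝ) < t := by
      refine lt_of_le_of_ne t.2.1 fun h0 => h3 ?_
      rw [mem_ofPred_eq, ← h0, zero_mul, add_zero] at ht
      exact ht
    have ht1 : (t : ℝ) < 1 := by
      refine lt_of_le_of_ne t.2.2 fun h0 => h6 ?_
      rw [mem_ofPred_eq, h0, one_mul, add_sub_cancel] at ht
      exact ht
    obtain ⟨_, ⟨⟨s, ⟨hsW, hs0, hs1⟩, rfl⟩, hsL⟩, hst⟩ := accPt_iff_nhds.1 (hacc _ ht) _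
      ((hoψ _ (hW.inter isOpen_Ioo)).mem_nhds ⟨t, ⟨htW, ht0, ht1⟩, rfl⟩)
    refine ⟨⟨s, hs0.le, hs1.le⟩, ⟨hVU (hWV hsW), hsL⟩, ?_⟩
    rintro rfl
    exact hst rfl
  · intro T hT hTc
    have key : ∀ a ∈ T, ∀ b ∈ T, ¬ a < b := by
      intro a ha b hb hab
      have hI := hTc.Icc_subset ha hb
      have h7 := (hoψ _ (isOpen_Ioo (a := (a : ℝ)) (b := b))).subset_interior_iff (t := L)
      have h8 : (fun t : ℝ => ((r₀ + t * (r₁ - r₀) : ℝ) : UnitAddCircle)) '' Ioo (a : ℝ) b ⊆ L := by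
        rintro _ ⟨t, ⟨h9, h10⟩, rfl⟩
        exact hT (hI (show (⟨t, a.2.1.trans h9.le, h10.le.trans b.2.2⟩ : unitInterval) ∈ Icc a b from
          ⟨h9.le, h10.le⟩))
      rw [← h7, hint, subset_empty_iff, image_eq_empty, Ioo_eq_empty_iff] at h8
      exact h8 hab
    intro a ha b hb
    exact le_antisymm (not_lt.1 (key b hb a ha)) (not_lt.1 (key a ha b hb))
  · ext ⟨s, t⟩
    rw [mem_preimage, box, hΛ.mem_image_iff hc.mem_iff hc.away]
    simp

/-- The cross section of the cylinder. -/
lemma exists_isClosedTransversal (hZc : IsClosed Z) (hZ : ∀ y, Λ (0, y) ∉ Z) :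
    ∃ c : C(Circle, S), (∀ θ, c θ = Λ (0, (AddCircle.homeomorphCircle one_ne_zero).symm θ)) ∧
      IsClosedTransversal u c := by
  set e := (AddCircle.homeomorphCircle (T := 1) one_ne_zero).symm
  let c : C(Circle, S) := ⟨fun θ => Λ (0, e θ), hΛ.continuous.comp (by fun_prop)⟩
  have hc : ∀ θ, c θ = Λ (0, e θ) := fun _ => rfl
  have hr : range c = Λ '' ({0} ×ˢ univ) := by
    ext z
    constructor
    · rintro ⟨θ, rfl⟩
      exact ⟨(0, e θ), ⟨rfl, trivial⟩, rfl⟩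
    · rintro ⟨⟨s, y⟩, ⟨rfl, -⟩, rfl⟩
      exact ⟨e.symm y, by rw [hc, e.apply_symm_apply]⟩
  refine ⟨c, hc, fun θ θ' heq => ?_, fun θ => ?_⟩
  · exact e.injective (hΛ.strip _ _ _ _ (by norm_num) heq).2
  obtain ⟨r, hr'⟩ := QuotientAddGroup.mk_surjective (e θ)
  have hr0 := hZ (e θ)
  rw [← hr'] at hr0
  obtain ⟨η, hη, hη2, hη3⟩ := hΛ.exists_small_box hZc hr0
  refine ⟨box Λ 0 η (r - η) (r + η), hΛ.isTrivialFlowBox_box hu hη hη2 (by linarith) (by linarith)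
    hη3, ?_, ?_⟩
  · rw [hc, ← hr']
    exact hΛ.range_box_mem_nhds hη ⟨by linarith, by linarith⟩
  · ext ⟨s, t⟩
    rw [hr, mem_preimage, box]
    have b3 := s.2.1
    have b4 := s.2.2
    constructor
    · rintro ⟨⟨s', y⟩, ⟨rfl, -⟩, heq⟩
      have := (hΛ.strip _ _ _ _ (by rw [abs_lt]; constructor <;> simp only <;> nlinarith) heq).1
      refine ⟨Subtype.ext ?_, trivial⟩
      have h2 : η * (2 * s - 1) = 0 := by simp only at this; linarith
      rcases mul_eq_zero.1 h2 with h0 | h0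
      · exact absurd h0 hη.ne'
      · change (s : ℝ) = 1 / 2
        linarith
    · rintro ⟨hs, -⟩
      have hs' : (s : ℝ) = 1 / 2 := congrArg Subtype.val hs
      refine ⟨(0, ((r - η + t * (r + η - (r - η)) : ℝ) : UnitAddCircle)), ⟨rfl, trivial⟩, ?_⟩
      simp only [hs']
      ring_nf

/-! ### Suspended sets stopped along the cross section σ = 1/2 -/

section Slit

variable {L : Set UnitAddCircle} (hL : ∀ y, y ∈ L ↔ h y ∈ L) (hL8 : ∀ y ∈ L, 1 / 8 ≤ ‖y‖)
  (hZ : ∀ σ, ∀ y ∈ L, Λ (σ, y) ∈ Z ↔ Λ (σ, y) ∈ Λ '' ({1 / 2} ×ˢ L))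
include hL hL8 hZ

omit [T2Space S] hu hZ in
lemma mem_or_exists_slit {z : S} (hz : z ∈ Λ '' (univ ×ˢ L)) :
    z ∈ Λ '' ({1 / 2} ×ˢ L) ∨ ∃ σ ∈ Ioo (1 / 2 : ℝ) (3 / 2), ∃ y ∈ L, z = Λ (σ, y) := by
  obtain ⟨⟨σ, y⟩, ⟨-, hy⟩, rfl⟩ := hz
  obtain ⟨σ', ⟨h1, h2⟩, y', hy', e⟩ := hΛ.exists_normalized hL hL8 (1 / 2) σ hy
  rcases h1.eq_or_lt with h1 | h1
  · exact Or.inl ⟨(σ', y'), ⟨h1.symm, hy'⟩, e.symm⟩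
  · exact Or.inr ⟨σ', ⟨h1, by linarith⟩, y', hy', e⟩

omit [T2Space S] hu hL hL8 in
lemma notMem_slit {σ : ℝ} (hσ : σ ∈ Ioo (1 / 2 : ℝ) (3 / 2)) {y : UnitAddCircle} (hy : y ∈ L) :
    Λ (σ, y) ∉ Z := by
  rw [hZ σ y hy]
  rintro ⟨⟨σ', y'⟩, ⟨h1, -⟩, e⟩
  have h1' : σ' = 1 / 2 := h1
  have := (hΛ.strip _ _ _ _ (by rw [abs_lt, h1']; constructor <;> linarith [hσ.1, hσ.2]) e).1
  linarith [hσ.1]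

omit [T2Space S] hu in
lemma half_mem_slit {y : UnitAddCircle} (hy : y ∈ L) : Λ (1 / 2, y) ∈ Z ∧ Λ (3 / 2, y) ∈ Z := by
  refine ⟨(hZ _ _ hy).2 ⟨(1 / 2, y), ⟨rfl, hy⟩, rfl⟩, (hZ _ _ hy).2 ⟨(1 / 2, h y), ⟨rfl, (hL y).1 hy⟩, ?_⟩⟩
  rw [hΛ.shift _ _ (hL8 _ ((hL y).1 hy))]
  norm_num

omit [T2Space S] in
-- The orbit is stopped at both ends of (1/2, 3/2). Over this interval the cylinder is openly
-- embedded, and in it the orbit is a strictly monotone curve with order-connected range.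
lemma isEmbedding_slit {σ : ℝ} (hσ : σ ∈ Ioo (1 / 2 : ℝ) (3 / 2)) {y : UnitAddCircle} (hy : y ∈ L) :
    IsEmbedding fun t => u t (Λ (σ, y)) := by
  obtain ⟨τ, h1, h0, -, h3⟩ := hu (Λ (σ, y))
  obtain ⟨hm, hc, hr⟩ := h3 (hΛ.notMem_slit hZ hσ hy)
  have hmem : ∀ t, σ + τ t ∈ Ioo (1 / 2 : ℝ) (3 / 2) := by
    intro t
    have ht : τ t ∈ range τ := ⟨t, rfl⟩
    rw [hr] at ht
    by_contra hcon
    rw [mem_Ioo, not_and_or, not_lt, not_lt] at hcon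
    rcases hcon with hcon | hcon
    · have := ht (1 / 2 - σ) (by rw [mem_uIcc]; right; constructor <;> linarith [hσ.1])
      rw [hΛ.flow, add_sub_cancel] at this
      exact this (hΛ.half_mem_slit hL hL8 hZ hy).1
    · have := ht (3 / 2 - σ) (by rw [mem_uIcc]; left; constructor <;> linarith [hσ.2])
      rw [hΛ.flow, add_sub_cancel] at this
      exact this (hΛ.half_mem_slit hL hL8 hZ hy).2
  let W : Ioo (1 / 2 : ℝ) (3 / 2) × UnitAddCircle → S := fun a => Λ (a.1, a.2)
  have hW : IsOpenEmbedding W := by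
    refine IsOpenEmbedding.of_continuous_injective_isOpenMap (hΛ.continuous.comp (by fun_prop)) ?_
      (hΛ.isOpenMap.comp (isOpen_Ioo.isOpenEmbedding_subtypeVal.isOpenMap.prodMap IsOpenMap.id))
    rintro ⟨⟨a, h1, h2⟩, b⟩ ⟨⟨a', h1', h2'⟩, b'⟩ heq
    have := hΛ.strip _ _ _ _ (by rw [abs_lt]; constructor <;> simp only <;> linarith) heq
    exact Prod.ext (Subtype.ext this.1) this.2
  let i : ℝ → Ioo (1 / 2 : ℝ) (3 / 2) × UnitAddCircle := fun t => (⟨σ + τ t, hmem t⟩, y)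
  have hi : IsEmbedding i := by
    refine IsEmbedding.of_comp (g := fun a => (a.1 : ℝ)) (by fun_prop) (by fun_prop) ?_
    have hs : StrictMono fun t => σ + τ t := hm.const_add σ
    have : OrdConnected (range fun t => σ + τ t) := (isPreconnected_range (by fun_prop)).ordConnected
    exact hs.isEmbedding_of_ordConnected this
  have : (fun t => u t (Λ (σ, y))) = W ∘ i := by
    funext t
    rw [h1, hΛ.flow]
    rfl
  rw [this]
  exact hW.isEmbedding.comp hi

omit [T2Space S] in
lemma image_subset_singularSet_union :
    Λ '' (univ ×ˢ L) ⊆ singularSet u ∪ nonclosedProperSet u := by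
  intro z hz
  rcases hΛ.mem_or_exists_slit hL hL8 hz with ⟨⟨σ, y⟩, ⟨hσ, hy⟩, rfl⟩ | ⟨σ, hσ, y, hy, rfl⟩
  · refine Or.inl (hu.mem_singularSet ?_)
    have hσ' : σ = 1 / 2 := hσ
    rw [hσ']
    exact (hΛ.half_mem_slit hL hL8 hZ hy).1
  · exact Or.inr (mem_nonclosedProperSet_of_isEmbedding (hΛ.isEmbedding_slit hu hL hL8 hZ hσ hy))

/-- The orbits on the image of an invariant set run from the slit to the slit. -/
lemma omegaSet_slit {σ : ℝ} (hσ : σ ∈ Ioo (1 / 2 : ℝ) (3 / 2)) {y : UnitAddCircle} (hy : y ∈ L) :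
    omegaSet u (Λ (σ, y)) = {Λ (3 / 2, y)} ∧ alphaSet u (Λ (σ, y)) = {Λ (1 / 2, y)} := by
  have h1 := hu.omegaSet_eq_singleton (x := Λ (σ, y)) (b := 3 / 2 - σ) (by linarith [hσ.2]) (by
    rw [hΛ.flow, add_sub_cancel]
    exact (hΛ.half_mem_slit hL hL8 hZ hy).2) (fun s hs => by
    rw [hΛ.flow]
    exact hΛ.notMem_slit hZ ⟨by linarith [hσ.1, hs.1], by linarith [hs.2]⟩ hy)
  have h2 := hu.reverse.omegaSet_eq_singleton (x := Λ (σ, y)) (b := σ - 1 / 2) (by linarith [hσ.1])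
    (by
      rw [Flow.reverse_apply, hΛ.flow, neg_sub, add_sub_cancel]
      exact (hΛ.half_mem_slit hL hL8 hZ hy).1) (fun s hs => by
      rw [Flow.reverse_apply, hΛ.flow]
      exact hΛ.notMem_slit hZ ⟨by linarith [hs.2], by linarith [hs.1, hσ.2]⟩ hy)
  rw [hΛ.flow, add_sub_cancel] at h1
  rw [Flow.reverse_apply, hΛ.flow, neg_sub, add_sub_cancel, omegaSet_reverse] at h2
  exact ⟨h1, h2⟩

end Slit

end IsCylinder

end EndTypes

end SurfaceFlow

namespace SurfaceFlow

/-! ### The annulus along a limit quasi-circuit -/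

section Annulus

/-- Two open continuous maps with the same fibres have homeomorphic images. -/
lemma exists_isOpenEmbedding_comp {X Y S : Type*} [TopologicalSpace X] [TopologicalSpace Y]
    [TopologicalSpace S] {Q : X → Y} {G : X → S} (hQ : IsOpenQuotientMap Q) (hG : Continuous G)
    (hGo : IsOpenMap G) (hQG : ∀ a b, Q a = Q b ↔ G a = G b) :
    ∃ Φ : Y → S, IsOpenEmbedding Φ ∧ ∀ a, Φ (Q a) = G a := by
  have hΦ : ∀ a, G (Function.surjInv hQ.surjective (Q a)) = G a := fun a =>
    (hQG _ _).1 (Function.surjInv_eq hQ.surjective _)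
  refine ⟨fun y => G (Function.surjInv hQ.surjective y), ?_, hΦ⟩
  refine IsOpenEmbedding.of_continuous_injective_isOpenMap ?_ ?_ ?_
  · rw [hQ.isQuotientMap.continuous_iff]
    exact hG.congr fun a => (hΦ a).symm
  · intro y y' heq
    obtain ⟨a, rfl⟩ := hQ.surjective y
    obtain ⟨b, rfl⟩ := hQ.surjective y'
    simp only [hΦ] at heq
    exact (hQG a b).2 heq
  · intro U hU
    have : (fun y => G (Function.surjInv hQ.surjective y)) '' U = G '' (Q ⁻¹' U) := by
      ext s
      constructor
      · rintro ⟨y, hy, rfl⟩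
        obtain ⟨a, rfl⟩ := hQ.surjective y
        exact ⟨a, hy, (hΦ a).symm⟩
      · rintro ⟨a, ha, rfl⟩
        exact ⟨Q a, ha, hΦ a⟩
    rw [this]
    exact hGo _ (hU.preimage hQ.continuous)

/-- The positive half line and the unit interval are homeomorphic. -/
noncomputable def ioiHomeomorphIoo : Ioi (0 : ℝ) ≃ₜ Ioo (0 : ℝ) 1 where
  toFun t := ⟨1 / (1 + t), by have := t.2.out; positivity, by
    have := t.2.out
    rw [div_lt_one (by positivity)]
    linarith⟩
  invFun s := ⟨1 / s - 1, by
    have := s.2.1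
    rw [mem_Ioi, sub_pos, one_lt_div this]
    exact s.2.2⟩
  left_inv t := by
    have := t.2.out
    ext
    field_simp
    ring
  right_inv s := by
    have := s.2.1
    ext
    field_simp
    ring
  continuous_toFun := by
    refine Continuous.subtype_mk (continuous_const.div (by fun_prop) fun t => ?_) _
    have := t.2.out
    positivity
  continuous_invFun := by
    refine Continuous.subtype_mk ((continuous_const.div (by fun_prop) fun s => ?_).sub
      continuous_const) _
    exact s.2.1.ne'

/-- A monotone parametrization of an orbit that converges to `1 / 2`. -/
noncomputable def ray (θ : ℝ) : ℝ := 1 / 2 - Real.exp (-(Real.log 2 * θ)) / 2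

lemma continuous_ray : Continuous ray := by unfold ray; fun_prop

lemma isOpenMap_ray : IsOpenMap ray := by
  have h2 : Real.log 2 ≠ 0 := (Real.log_pos one_lt_two).ne'
  have h1 : IsOpenMap fun θ : ℝ => -(Real.log 2 * θ) :=
    ((Homeomorph.mulLeft₀ _ h2).trans (Homeomorph.neg ℝ)).isOpenMap
  have h3 : IsOpenMap fun x : ℝ => 1 / 2 - x / 2 := by
    have := (((Homeomorph.mulRight₀ (2⁻¹ : ℝ) (by norm_num)).trans (Homeomorph.neg ℝ)).trans
      (Homeomorph.addLeft (1 / 2 : ℝ))).isOpenMap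
    convert this using 1
    funext x
    simp
    ring
  exact h3.comp (Real.isOpenEmbedding_exp.isOpenMap.comp h1)

lemma ray_strictMono : StrictMono ray := by
  intro a b hab
  have h2 : 0 < Real.log 2 := Real.log_pos one_lt_two
  have := Real.exp_lt_exp.2 (neg_lt_neg (mul_lt_mul_of_pos_left hab h2))
  simp only [ray]
  linarith

lemma ray_zero : ray 0 = 0 := by simp [ray]

lemma ray_one : ray 1 = 1 / 4 := by
  rw [ray, mul_one, Real.exp_neg, Real.exp_log two_pos]
  norm_num

lemma ray_lt (θ : ℝ) : ray θ < 1 / 2 := by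
  have := Real.exp_pos (-(Real.log 2 * θ))
  simp only [ray]
  linarith

lemma ray_nonneg {θ : ℝ} (hθ : 0 ≤ θ) : 0 ≤ ray θ := ray_zero ▸ ray_strictMono.monotone hθ

lemma exists_ray_eq {r : ℝ} (hr : r < 1 / 2) : ∃ θ, ray θ = r := by
  have h2 : Real.log 2 ≠ 0 := (Real.log_pos one_lt_two).ne'
  refine ⟨-(Real.log (1 - 2 * r) / Real.log 2), ?_⟩
  rw [ray, mul_neg, neg_neg, mul_div_cancel₀ _ h2, Real.exp_log (by linarith)]
  ring

lemma norm_ray_add_one {θ : ℝ} (hθ : 0 ≤ θ) : 1 / 8 ≤ ‖(ray (θ + 1) : UnitAddCircle)‖ := by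
  have h1 : 1 / 4 ≤ ray (θ + 1) := ray_one ▸ ray_strictMono.monotone (by linarith)
  have h2 := ray_lt (θ + 1)
  rw [norm_coe_circle (by rw [abs_le]; constructor <;> linarith), abs_of_pos (by linarith)]
  linarith

lemma ray_injOn_circle {θ θ' : ℝ} (hθ : 0 ≤ θ) (hθ' : 0 ≤ θ')
    (heq : (ray θ : UnitAddCircle) = ray θ') : θ = θ' := by
  refine ray_strictMono.injective (coe_circle_injOn ?_ heq)
  rw [abs_lt]
  constructor <;> linarith [ray_nonneg hθ, ray_nonneg hθ', ray_lt θ, ray_lt θ']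

variable {S : Type*} [TopologicalSpace S] [T2Space S] {v u : Flow ℝ S} {Z : Set S}
  {h : UnitAddCircle ≃ₜ UnitAddCircle} {Λ : ℝ × UnitAddCircle → S}

namespace IsCylinder

variable (hΛ : IsCylinder v h Λ)
  (hray : ∀ θ, 0 ≤ θ → h (ray θ : UnitAddCircle) = (ray (θ + 1) : UnitAddCircle))
include hΛ hray

omit [TopologicalSpace S] [T2Space S] hΛ in
lemma iterate_ray {θ : ℝ} (hθ : 0 ≤ θ) (n : ℕ) :
    h^[n] (ray θ : UnitAddCircle) = (ray (θ + n) : UnitAddCircle) := by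
  induction n with
  | zero => simp
  | succ n ih =>
    rw [Function.iterate_succ_apply', ih, hray _ (by positivity), Nat.cast_succ, add_assoc]

omit [T2Space S] in
/-- The annulus swept out by a closed transversal. -/
lemma exists_annulus : ∃ Φ : ℝ × UnitAddCircle → S, IsOpenEmbedding Φ ∧
    ∀ t θ : ℝ, 0 < θ → Φ (t, (θ : UnitAddCircle)) = Λ (t - θ, (ray θ : UnitAddCircle)) := by
  -- The curve θ ↦ Λ(-θ, ray θ) closes up with period 1, because `shift` takes (-θ, ray θ) to (-θ -
  -- 1, ray(θ + 1)). Flowing it for time t gives Φ. It remains to compare the fibres of (t, θ) ↦ (t,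
  -- θ mod 1) with those of (t, θ) ↦ Λ(t - θ, ray θ).
  have hQ : IsOpenQuotientMap
      fun a : ℝ × Ioi (0 : ℝ) => (a.1, ((a.2 : ℝ) : UnitAddCircle)) := by
    refine ⟨?_, ?_, ?_⟩
    · rintro ⟨t, k⟩
      refine ⟨(t, ⟨AddCircle.equivIco 1 1 k, zero_lt_one.trans_le (AddCircle.equivIco 1 1 k).2.1⟩),
        ?_⟩
      exact Prod.ext rfl AddCircle.coe_equivIco
    · exact continuous_fst.prodMk (continuous_coe_circle.comp (by fun_prop))
    · exact IsOpenMap.id.prodMap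
        (isOpenMap_coe_circle.comp isOpen_Ioi.isOpenEmbedding_subtypeVal.isOpenMap)
  have hfwd : ∀ a : ℝ × Ioi (0 : ℝ), ∀ n : ℕ, ∀ b : ℝ × Ioi (0 : ℝ), a.1 = b.1 →
      (b.2 : ℝ) = a.2 + n →
      Λ (a.1 - a.2, (ray a.2 : UnitAddCircle)) = Λ (b.1 - b.2, (ray b.2 : UnitAddCircle)) := by
    intro a n b h1 h2
    have ha : (0 : ℝ) ≤ a.2 := a.2.2.out.le
    have hn : ∀ n, 0 < n → 1 / 8 ≤ ‖h^[n] (ray a.2 : UnitAddCircle)‖ := by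
      intro n hn
      obtain ⟨m, rfl⟩ := Nat.exists_eq_succ_of_ne_zero hn.ne'
      rw [iterate_ray hray ha, Nat.cast_succ, ← add_assoc]
      exact norm_ray_add_one (by positivity)
    rw [hΛ.shift_iterate hn n, iterate_ray hray ha, h2, h1]
    ring_nf
  have hbwd : ∀ a b : ℝ × Ioi (0 : ℝ), b.1 - b.2 ≤ a.1 - a.2 →
      Λ (a.1 - a.2, (ray a.2 : UnitAddCircle)) = Λ (b.1 - b.2, (ray b.2 : UnitAddCircle)) →
      a.1 = b.1 ∧ ∃ n : ℕ, (b.2 : ℝ) = a.2 + n := by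
    intro a b hle heq
    have ha : (0 : ℝ) ≤ a.2 := a.2.2.out.le
    have hn : ∀ n, 0 < n → 1 / 8 ≤ ‖h^[n] (ray a.2 : UnitAddCircle)‖ := by
      intro n hn
      obtain ⟨m, rfl⟩ := Nat.exists_eq_succ_of_ne_zero hn.ne'
      rw [iterate_ray hray ha, Nat.cast_succ, ← add_assoc]
      exact norm_ray_add_one (by positivity)
    obtain ⟨n, h1, h2⟩ := hΛ.eq_of_eq hn hle heq
    rw [iterate_ray hray ha] at h2
    have h3 := ray_injOn_circle (by positivity) b.2.2.out.le h2
    exact ⟨by linarith, n, h3.symm⟩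
  refine (fun H => ?_ : (∃ Φ : ℝ × UnitAddCircle → S, IsOpenEmbedding Φ ∧
      ∀ a : ℝ × Ioi (0 : ℝ), Φ (a.1, ((a.2 : ℝ) : UnitAddCircle)) =
        Λ (a.1 - a.2, (ray a.2 : UnitAddCircle))) → _) (exists_isOpenEmbedding_comp hQ ?_ ?_ ?_)
  · obtain ⟨Φ, h1, h2⟩ := H
    exact ⟨Φ, h1, fun t θ hθ => h2 (t, ⟨θ, hθ⟩)⟩
  · have h1 : Continuous fun a : ℝ × Ioi (0 : ℝ) => a.1 - (a.2 : ℝ) := by fun_prop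
    have h2 : Continuous fun a : ℝ × Ioi (0 : ℝ) => ((ray a.2 : ℝ) : UnitAddCircle) :=
      continuous_coe_circle.comp (continuous_ray.comp (by fun_prop))
    exact hΛ.continuous.comp (h1.prodMk h2)
  · have hs : IsOpenMap fun a : ℝ × Ioi (0 : ℝ) => (a.1 - a.2, (a.2 : ℝ)) := by
      let e : ℝ × ℝ ≃ₜ ℝ × ℝ :=
        { toFun := fun a => (a.1 - a.2, a.2)
          invFun := fun a => (a.1 + a.2, a.2)
          left_inv := fun a => by simp
          right_inv := fun a => by simp }
      exact e.isOpenMap.comp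
        (IsOpenMap.id.prodMap isOpen_Ioi.isOpenEmbedding_subtypeVal.isOpenMap)
    exact hΛ.isOpenMap.comp ((IsOpenMap.id.prodMap
      (isOpenMap_coe_circle.comp isOpenMap_ray)).comp hs)
  · intro a b
    constructor
    · intro heq
      obtain ⟨h3, h4⟩ := Prod.mk.inj heq
      have h5 : (((b.2 : ℝ) - a.2 : ℝ) : UnitAddCircle) = 0 := by
        rw [AddCircle.coe_sub, h4, sub_self]
      obtain ⟨m, hm⟩ := AddCircle.coe_eq_zero_iff (p := (1 : ℝ)).1 h5
      rw [zsmul_eq_mul, mul_one] at hm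
      obtain ⟨n, hn | hn⟩ := Int.eq_nat_or_neg m
      · refine hfwd a n b h3 ?_
        rw [hn, Int.cast_natCast] at hm
        linarith
      · refine (hfwd b n a h3.symm ?_).symm
        rw [hn, Int.cast_neg, Int.cast_natCast] at hm
        linarith
    · intro heq
      have hcoe : ∀ (x : ℝ) (n : ℕ), ((x + n : ℝ) : UnitAddCircle) = x := by
        intro x n
        have : ((n : ℝ) : UnitAddCircle) = 0 :=
          AddCircle.coe_eq_zero_iff (p := (1 : ℝ)).2 ⟨n, by simp⟩
        rw [AddCircle.coe_add, this, add_zero]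
      rcases le_total (b.1 - b.2 : ℝ) (a.1 - a.2) with hle | hle
      · obtain ⟨h3, n, h4⟩ := hbwd a b hle heq
        exact Prod.ext h3 (by simp only [h4, hcoe])
      · obtain ⟨h3, n, h4⟩ := hbwd b a hle heq.symm
        exact Prod.ext h3.symm (by simp only [h4, hcoe])

/-- The frontier of the part t > 0 is contained in the union of the initial transversal t = 0 and γ.
These are disjoint closed sets, so the connected set γ is a full component. -/
lemma isBoundaryComponent_annulus (hL : IsLimitOf h {((1 / 2 : ℝ) : UnitAddCircle)} 0)
    {Φ : ℝ × UnitAddCircle → S} (hΦ : IsOpenEmbedding Φ)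
    (hΦΛ : ∀ t θ : ℝ, 0 < θ → Φ (t, (θ : UnitAddCircle)) = Λ (t - θ, (ray θ : UnitAddCircle))) :
    IsBoundaryComponent (Λ '' (univ ×ˢ {((1 / 2 : ℝ) : UnitAddCircle)})) (Φ '' (Ioi 0 ×ˢ univ)) := by
  set γ := Λ '' (univ ×ˢ {((1 / 2 : ℝ) : UnitAddCircle)}) with hγ
  set A := Φ '' (Ioi 0 ×ˢ univ) with hA
  have hAo : IsOpen A := hΦ.isOpenMap _ (isOpen_Ioi.prod isOpen_univ)
  have hγc : IsCompact γ := hΛ.isCompact_image hL.mem_iff hL.away hL.isClosed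
  have hdisj : ∀ t k, Φ (t, k) ∉ γ := by
    intro t k
    rw [← AddCircle.coe_equivIco (p := (1 : ℝ)) (a := 1) (y := k),
      hΦΛ _ _ (zero_lt_one.trans_le (AddCircle.equivIco 1 1 k).2.1), hγ,
      hΛ.mem_image_iff hL.mem_iff hL.away]
    intro heq
    have h0 : (0 : ℝ) ≤ AddCircle.equivIco 1 1 k := zero_le_one.trans (AddCircle.equivIco 1 1 k).2.1
    have := coe_circle_injOn (by
      rw [abs_lt]
      constructor <;> linarith [ray_nonneg h0, ray_lt (AddCircle.equivIco 1 1 k)]) heq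
    linarith [ray_lt (AddCircle.equivIco 1 1 k)]
  have hω : γ ⊆ closure A := by
    rw [hγ, ← hΛ.omegaSet_eq hL 0]
    intro z hz
    rw [mem_omegaSet] at hz
    rw [mem_closure_iff_nhds]
    intro U hU
    obtain ⟨t, ht, htU⟩ := frequently_atTop.1 (mapClusterPt_iff_frequently.1 hz U hU) 1
    refine ⟨_, htU, (t, ((1 : ℝ) : UnitAddCircle)), ⟨zero_lt_one.trans_le ht, trivial⟩, ?_⟩
    rw [hΦΛ _ _ one_pos, hΛ.flow, zero_add, hΛ.shift t]
    · have := hray 0 le_rfl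
      rw [ray_zero, zero_add, AddCircle.coe_zero] at this
      rw [this]
    · exact hL.orbit_away 1 one_pos
  -- A compact piece whose image contains the closure: lifting k to θ in [t + 1, t + 2) puts σ = t -
  -- θ in [-2, -1], and t ≥ 0 reads θ ≥ -σ. The edge at height 1/2 maps into γ.
  set T : Set (ℝ × ℝ) := {a | a.1 ∈ Icc (-2) (-1) ∧ a.2 ∈ Icc (ray (-a.1)) (1 / 2)} with hT
  have hTc : IsCompact T := by
    refine IsCompact.of_isClosed_subset (isCompact_Icc.prod isCompact_Icc :
      IsCompact (Icc (-2 : ℝ) (-1) ×ˢ Icc (0 : ℝ) (1 / 2))) ?_ ?_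
    · have h1 : IsClosed {a : ℝ × ℝ | a.1 ∈ Icc (-2) (-1)} := isClosed_Icc.preimage continuous_fst
      have h2 : IsClosed {a : ℝ × ℝ | ray (-a.1) ≤ a.2} :=
        isClosed_le (continuous_ray.comp (by fun_prop)) continuous_snd
      have h3 : IsClosed {a : ℝ × ℝ | a.2 ≤ 1 / 2} := isClosed_le continuous_snd continuous_const
      exact h1.inter (h2.inter h3)
    · rintro ⟨a, b⟩ ⟨h1, h2, h3⟩
      exact ⟨h1, (ray_nonneg (by linarith [h1.2])).trans h2, h3⟩
  have hclos : closure A ⊆ (fun a : ℝ × ℝ => Λ (a.1, (a.2 : UnitAddCircle))) '' T := by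
    refine closure_minimal ?_ (hTc.image (hΛ.continuous.comp (continuous_fst.prodMk
      (continuous_coe_circle.comp continuous_snd)))).isClosed
    rintro _ ⟨⟨t, k⟩, ⟨ht, -⟩, rfl⟩
    have ht' : 0 < t := ht
    obtain ⟨h1, h2⟩ := (AddCircle.equivIco 1 (t + 1) k).2
    have hr := ray_strictMono.monotone
      (show -(t - (AddCircle.equivIco 1 (t + 1) k : ℝ)) ≤ AddCircle.equivIco 1 (t + 1) k by linarith)
    refine ⟨(t - (AddCircle.equivIco 1 (t + 1) k : ℝ), ray (AddCircle.equivIco 1 (t + 1) k)),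
      ⟨⟨by linarith, by linarith⟩, hr, (ray_lt _).le⟩, ?_⟩
    conv_rhs => rw [← AddCircle.coe_equivIco (p := (1 : ℝ)) (a := t + 1) (y := k),
      hΦΛ _ _ (by linarith)]
  have hfr : frontier A ⊆ Φ '' ({0} ×ˢ univ) ∪ γ := by
    rintro z ⟨hz, hzA⟩
    rw [hAo.interior_eq] at hzA
    obtain ⟨⟨σ, r⟩, ⟨⟨h1, h2⟩, h3, h4⟩, rfl⟩ := hclos hz
    simp only at h1 h2 h3 h4 hzA ⊢
    rcases h4.eq_or_lt with rfl | h4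
    · exact Or.inr ⟨(σ, _), ⟨trivial, rfl⟩, rfl⟩
    obtain ⟨θ, rfl⟩ := exists_ray_eq h4
    have hθ := ray_strictMono.le_iff_le.1 h3
    have e : Φ (θ + σ, (θ : UnitAddCircle)) = Λ (σ, (ray θ : UnitAddCircle)) := by
      rw [hΦΛ _ _ (by linarith), add_sub_cancel_left]
    rw [← e] at hzA ⊢
    left
    refine ⟨(θ + σ, θ), ⟨?_, trivial⟩, rfl⟩
    by_contra hne
    exact hzA ⟨(θ + σ, θ), ⟨lt_of_le_of_ne (by linarith : 0 ≤ θ + σ) (Ne.symm hne), trivial⟩, rfl⟩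
  have hconn : IsPreconnected γ := by
    have : γ = range fun σ => Λ (σ, ((1 / 2 : ℝ) : UnitAddCircle)) := by
      ext z
      constructor
      · rintro ⟨⟨σ, y⟩, ⟨-, rfl⟩, rfl⟩
        exact ⟨σ, rfl⟩
      · rintro ⟨σ, rfl⟩
        exact ⟨(σ, _), ⟨trivial, rfl⟩, rfl⟩
    rw [this]
    exact isPreconnected_range (hΛ.continuous.comp (by fun_prop))
  have hγA : γ ⊆ frontier A := by
    intro z hz
    refine ⟨hω hz, fun hzA => ?_⟩
    obtain ⟨⟨t, k⟩, -, rfl⟩ := interior_subset hzA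
    exact hdisj t k hz
  have hy : Λ (0, ((1 / 2 : ℝ) : UnitAddCircle)) ∈ γ := ⟨(0, _), ⟨trivial, rfl⟩, rfl⟩
  refine ⟨_, hγA hy, (hconn.subset_connectedComponentIn hy hγA).antisymm ?_⟩
  have hBc : IsClosed (Φ '' ({0} ×ˢ univ)) :=
    ((isCompact_singleton.prod isCompact_univ).image hΦ.continuous).isClosed
  have hempty : Φ '' ({0} ×ˢ univ) ∩ γ = ∅ := by
    rw [eq_empty_iff_forall_notMem]
    rintro _ ⟨⟨⟨t, k⟩, -, rfl⟩, h2⟩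
    exact hdisj t k h2
  rcases isPreconnected_iff_subset_of_disjoint_closed.1
    (isPreconnected_connectedComponentIn (F := frontier A)
      (x := Λ (0, ((1 / 2 : ℝ) : UnitAddCircle)))) _ _ hBc hγc.isClosed
    ((connectedComponentIn_subset _ _).trans hfr) (by rw [hempty, inter_empty]) with h1 | h1
  · exact absurd (show _ ∈ _ ∩ γ from ⟨h1 (mem_connectedComponentIn (hγA hy)), hy⟩)
      (hempty ▸ notMem_empty _)
  · exact h1

/-- Stopped at one point, the periodic orbit becomes a singular point with a homoclinic orbit, which
is not recurrent because both its limit sets are that singular point. The orbit of Λ(1, 0) is a flow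
line of the annulus, and the time change affects neither its staying there nor its limit set. -/
lemma isLimitQuasiCircuit (hL : IsLimitOf h {((1 / 2 : ℝ) : UnitAddCircle)} 0)
    (hu : IsTimeChange v u Z) (hx : ∀ s, 0 ≤ s → Λ (s, 0) ∉ Z)
    (hZ : ∀ σ, ∀ y ∈ ({((1 / 2 : ℝ) : UnitAddCircle)} : Set UnitAddCircle),
      Λ (σ, y) ∈ Z ↔ Λ (σ, y) ∈ Λ '' ({1 / 2} ×ˢ {((1 / 2 : ℝ) : UnitAddCircle)})) :
    IsLimitQuasiCircuit u (Λ '' (univ ×ˢ {((1 / 2 : ℝ) : UnitAddCircle)})) := by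
  have hγc := hΛ.isCompact_image hL.mem_iff hL.away hL.isClosed
  obtain ⟨Φ, hΦ, hΦΛ⟩ := hΛ.exists_annulus hray
  have hcomp := hΛ.isBoundaryComponent_annulus hray hL hΦ hΦΛ
  have hnr : ∀ σ ∈ Ioo (1 / 2 : ℝ) (3 / 2),
      ¬ IsRecurrentPoint u (Λ (σ, ((1 / 2 : ℝ) : UnitAddCircle))) := by
    intro σ hσ hrec
    obtain ⟨h1, h2⟩ := hΛ.omegaSet_slit hu hL.mem_iff hL.away hZ hσ rfl
    obtain ⟨h3, h4⟩ := hΛ.half_mem_slit hL.mem_iff hL.away hZ rfl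
    have h5 := hΛ.notMem_slit hZ hσ rfl
    rw [IsRecurrentPoint, h1, h2] at hrec
    rcases hrec with hrec | hrec
    · exact h5 (mem_singleton_iff.1 hrec ▸ h4)
    · exact h5 (mem_singleton_iff.1 hrec ▸ h3)
  have hfix : h 0 = ((ray 1 : ℝ) : UnitAddCircle) := by
    have := hray 0 le_rfl
    rwa [ray_zero, zero_add, AddCircle.coe_zero] at this
  have hflow : ∀ t : ℝ, Φ (t, ((1 : ℝ) : UnitAddCircle)) = Λ (t, 0) := by
    intro t
    rw [hΦΛ _ _ one_pos, hΛ.shift t, hfix]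
    exact hL.orbit_away 1 one_pos
  refine ⟨⟨hγc.isClosed, ⟨⟨_, ⟨(0, _), ⟨trivial, rfl⟩, rfl⟩⟩, ?_⟩, ?_,
    ⟨Λ (1, _), ⟨(1, _), ⟨trivial, rfl⟩, rfl⟩, hnr 1 ⟨by norm_num, by norm_num⟩⟩, ?_⟩,
    Φ '' (Ioi 0 ×ˢ univ), ⟨hΦ.isOpenMap _ (isOpen_Ioi.prod isOpen_univ), ?_⟩, hcomp,
    Λ (1, 0), ⟨(1, ((1 : ℝ) : UnitAddCircle)), ⟨mem_Ioi.2 one_pos, trivial⟩, hflow 1⟩, Or.inl ⟨?_, ?_⟩⟩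
  · obtain ⟨y, -, hy⟩ := hcomp
    rw [hy]
    exact isPreconnected_connectedComponentIn
  · intro t z hz
    obtain ⟨s, hs⟩ := hu.orbit_subset z ⟨t, rfl⟩
    have := hΛ.flow_mem_image hz s
    rwa [show v s z = u t z from hs] at this
  · intro z hz
    rcases hΛ.mem_or_exists_slit hL.mem_iff hL.away hz with
      ⟨⟨σ, y⟩, ⟨hσ, hy⟩, rfl⟩ | ⟨σ, hσ, y, hy, rfl⟩
    · left
      have hσ' : σ = 1 / 2 := hσ
      rw [hσ']
      exact hu.mem_singularSet (hΛ.half_mem_slit hL.mem_iff hL.away hZ hy).1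
    · right
      rw [mem_singleton_iff.1 hy]
      exact hnr σ hσ
  · have e1 : IsOpenEmbedding fun a : Ioi (0 : ℝ) × UnitAddCircle => Φ (a.1, a.2) :=
      hΦ.comp (isOpen_Ioi.isOpenEmbedding_subtypeVal.prodMap IsOpenEmbedding.id)
    have e2 : range (fun a : Ioi (0 : ℝ) × UnitAddCircle => Φ (a.1, a.2)) =
        Φ '' (Ioi 0 ×ˢ univ) := by
      ext z
      constructor
      · rintro ⟨⟨t, k⟩, rfl⟩
        exact ⟨(t, k), ⟨t.2, trivial⟩, rfl⟩
      · rintro ⟨⟨t, k⟩, ⟨ht, -⟩, rfl⟩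
        exact ⟨(⟨t, ht⟩, k), rfl⟩
    rw [← e2]
    exact ⟨e1.isEmbedding.toHomeomorph.symm.trans
      (ioiHomeomorphIoo.prodCongr (AddCircle.homeomorphCircle one_ne_zero))⟩
  · rintro _ ⟨t, ht, rfl⟩
    obtain ⟨τ, h1, h0, hm, -⟩ := hu.tendsto_atTop (x := Λ (1, 0)) fun s hs => by
      rw [hΛ.flow]
      exact hx _ (by positivity)
    have := hm ht
    rw [h0] at this
    refine ⟨(1 + τ t, ((1 : ℝ) : UnitAddCircle)), ⟨?_, trivial⟩, ?_⟩
    · change 0 < 1 + τ t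
      positivity
    · rw [hflow, h1, hΛ.flow]
  · rw [hu.omegaSet_eq, hΛ.omegaSet_eq hL]
    intro s hs
    rw [hΛ.flow]
    exact hx _ (by positivity)

end IsCylinder

end Annulus

end SurfaceFlow

namespace SurfaceFlow

/-! ### Essential transversals -/

section Essential

/-- The circle is not contractible. -/
lemma not_nullhomotopic_homeomorphCircle_symm :
    ¬ (ContinuousMap.mk (AddCircle.homeomorphCircle (T := 1) one_ne_zero).symm
      (Homeomorph.continuous _) : C(Circle, UnitAddCircle)).Nullhomotopic := by
  set e := (AddCircle.homeomorphCircle (T := 1) one_ne_zero) with he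
  rintro ⟨y, ⟨F⟩⟩
  obtain ⟨r, hr⟩ := QuotientAddGroup.mk_surjective y
  have hr' : (r : UnitAddCircle) = y := hr
  have cov := AddCircle.isCoveringMap_coe (1 : ℝ)
  have hH : ∀ a, F.symm (0, a) = ((ContinuousMap.const Circle r a : ℝ) : UnitAddCircle) := by
    intro a
    rw [F.symm.apply_zero]
    exact hr'.symm
  have h1 := cov.liftHomotopy_lifts F.symm.toContinuousMap (ContinuousMap.const Circle r) hH
  set G : ℝ → ℝ := fun t =>
    cov.liftHomotopy F.symm.toContinuousMap (ContinuousMap.const Circle r) hH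
      (1, e (t : UnitAddCircle)) with hG
  have hGc : Continuous G := by
    have : Continuous fun t : ℝ => e (t : UnitAddCircle) := e.continuous.comp continuous_coe_circle
    fun_prop
  have hGt : ∀ t : ℝ, ((G t : ℝ) : UnitAddCircle) = t := by
    intro t
    have := congrFun h1 (1, e (t : UnitAddCircle))
    refine this.trans ?_
    change F.symm (1, _) = _
    rw [F.symm.apply_one]
    exact e.symm_apply_apply _
  have hG1 : G 1 = G 0 := by
    have : ((1 : ℝ) : UnitAddCircle) = ((0 : ℝ) : UnitAddCircle) := by
      rw [AddCircle.coe_zero]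
      exact AddCircle.coe_period 1
    simp only [hG, this]
  -- G t - t is continuous and vanishes modulo 1, but 1-periodicity of G makes it drop from G 0 to G
  -- 0 - 1. The intermediate value G 0 - 1/2 is the contradiction.
  have hivt := intermediate_value_Icc' (zero_le_one (α := ℝ))
    (f := fun t => G t - t) (hGc.sub continuous_id).continuousOn
  obtain ⟨t, -, ht⟩ := hivt (show G 0 - 1 / 2 ∈ _ from ⟨by simp only [hG1]; linarith, by
    simp only [sub_zero]; linarith⟩)
  have h2 : ((1 / 2 : ℝ) : UnitAddCircle) = 0 := by
    have h3 : (1 / 2 : ℝ) = (G 0 - 0) - (G t - t) := by simp only at ht; linarith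
    rw [h3, AddCircle.coe_sub, AddCircle.coe_sub, AddCircle.coe_sub, hGt, hGt]
    simp
  have h4 : ((1 / 2 : ℝ) : UnitAddCircle) = ((0 : ℝ) : UnitAddCircle) := by
    rw [h2, AddCircle.coe_zero]
  have := coe_circle_injOn (by norm_num) h4
  norm_num at this

/-- There is no boundary to collapse, so ψ factors through the collapsed surface and a null homotopy
of c would contract the circle. -/
lemma HasPlaneCharts.isEssential {S : Type*} [TopologicalSpace S] (hS : HasPlaneCharts S)
    (ψ : C(S, UnitAddCircle)) (c : C(Circle, S))
    (hψ : ∀ θ, ψ (c θ) = (AddCircle.homeomorphCircle (T := 1) one_ne_zero).symm θ) :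
    letI := hS.chartedSpace; IsEssential c := by
  let _ := hS.chartedSpace
  intro hnull
  let ψ' : C(CollapsedSurface S, UnitAddCircle) :=
    ⟨Quotient.lift ψ fun x y hxy => congrArg ψ (hS.eq_of_collapse_eq hxy),
      Continuous.quotient_lift ψ.continuous _⟩
  have h1 := hnull.comp_right ψ'
  refine not_nullhomotopic_homeomorphCircle_symm ?_
  convert h1 using 1
  ext1 θ
  exact (hψ θ).symm

/-- A cut-off function. -/
noncomputable def cutoff (r : ℝ) : ℝ := max 0 (min 1 ((r - 1) / (Real.exp (1 / 2) - 1)))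

lemma continuous_cutoff : Continuous cutoff := by unfold cutoff; fun_prop

lemma one_lt_exp_half : 1 < Real.exp (1 / 2) := Real.one_lt_exp_iff.2 (by norm_num)

lemma cutoff_of_le {r : ℝ} (hr : r ≤ 1) : cutoff r = 0 := by
  refine max_eq_left ((min_le_right _ _).trans ?_)
  exact div_nonpos_of_nonpos_of_nonneg (by linarith) (by linarith [one_lt_exp_half])

lemma cutoff_exp_half : cutoff (Real.exp (1 / 2)) = 1 := by
  rw [cutoff, div_self (by linarith [one_lt_exp_half])]
  norm_num

/-- A homeomorphism of the circle is a translation by a continuous displacement. -/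
def HasDisplacement (h : UnitAddCircle ≃ₜ UnitAddCircle) : Prop :=
  ∃ d : UnitAddCircle → ℝ, Continuous d ∧ ∀ y, h y = y + (d y : UnitAddCircle)

variable {g : Bool → UnitAddCircle ≃ₜ UnitAddCircle}

/-- The transverse coordinate extends to a map from the glued surface to the circle. -/
lemma exists_transverse_coordinate (hd : ∀ b, HasDisplacement (g b)) :
    ∃ ψ : C(GluedSurface g, UnitAddCircle), ∀ b y, ψ (cyl g b (0, y)) = y := by
  choose d hdc hd using hd
  -- The displacement of the return map is switched on between |p| = 1 and |p| = e^{1/2}: the value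
  -- is y where the core is entered and g(y) where it is left, as the gluing demands.
  let Y : Model → UnitAddCircle := fun x =>
    x.y + ((cutoff x.p * d true x.y + cutoff (-x.p) * d false x.y : ℝ) : UnitAddCircle)
  have hYc : Continuous Y := by
    have h1 : Continuous fun x : Model => x.y := continuous_fst.comp continuous_subtype_val
    have h2 : Continuous fun x : Model => x.p :=
      (continuous_fst.comp continuous_snd).comp continuous_subtype_val
    refine h1.add (continuous_coe_circle.comp ?_)
    exact ((continuous_cutoff.comp h2).mul ((hdc true).comp h1)).add
      ((continuous_cutoff.comp h2.neg).mul ((hdc false).comp h1))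
  have hY1 : ∀ x : Model, |x.p| ≤ 1 → Y x = x.y := by
    intro x hx
    simp only [Y]
    rw [cutoff_of_le ((le_abs_self _).trans hx), cutoff_of_le ((neg_le_abs _).trans hx)]
    simp
  -- Distinct identified points of the core are exactly one step apart, from |p| = e^{1/2} to |q| =
  -- e^{1/2}, by comparing the growth of |p| |q| with its maximum e.
  have hstep : ∀ x ∈ core, ∀ z ∈ core, ∀ n, StepN g n x z → Y x = Y z := by
    intro x hx z hz n hxz
    rcases n with _ | n
    · rw [show x = z from hxz]
    have h1 := hxz.exp_le
    have hexp := Real.exp_pos (1 / 2)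
    have h2 : |x.p| * |z.q| ≤ Real.exp 1 := by
      rw [← exp_half_mul]
      exact mul_le_mul hx.1 hz.2 (abs_nonneg _) hexp.le
    have hn : n = 0 := by
      by_contra hn
      have : (1 : ℝ) < n + 1 := by
        have : (1 : ℝ) ≤ n := by exact_mod_cast Nat.one_le_iff_ne_zero.2 hn
        linarith
      linarith [Real.exp_lt_exp.2 this]
    subst hn
    obtain ⟨w, hw, hs⟩ := hxz
    have hxw : x = w := hw
    subst hxw
    have h3 : Real.exp (1 / 2) * Real.exp (1 / 2) ≤ |x.p| * |z.q| := by
      rw [exp_half_mul]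
      simpa using h1
    have hp : |x.p| = Real.exp (1 / 2) := by
      refine le_antisymm hx.1 (le_of_mul_le_mul_right (h3.trans ?_) hexp)
      exact mul_le_mul_of_nonneg_left hz.2 (abs_nonneg _)
    have hq : |z.q| = Real.exp (1 / 2) := by
      refine le_antisymm hz.2 (le_of_mul_le_mul_left (h3.trans ?_) hexp)
      exact mul_le_mul_of_nonneg_right hx.1 (abs_nonneg _)
    have hzp : |z.p| ≤ 1 := by
      have h4 : |z.p| * |z.q| ≤ 1 := by
        rw [← abs_mul, z.mul_eq]
        exact abs_kap_le _
      rw [hq] at h4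
      nlinarith [one_lt_exp_half, abs_nonneg z.p]
    rw [hY1 z hzp, hs.2, hd]
    simp only [Y]
    congr 2
    rcases abs_eq hexp.le |>.1 hp with h5 | h5
    · rw [h5, cutoff_exp_half, cutoff_of_le (by linarith), decide_eq_true hexp]
      simp
    · rw [h5, neg_neg, cutoff_exp_half, cutoff_of_le (by linarith),
        decide_eq_false (by linarith : ¬ 0 < -Real.exp (1 / 2))]
      simp
  let π : core → GluedSurface g := fun x => glue g x
  have hπ : IsQuotientMap π := by
    have : CompactSpace core := isCompact_iff_compactSpace.1 isCompact_core
    have hc : Continuous π := continuous_glue.comp continuous_subtype_val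
    refine hc.isClosedMap.isQuotientMap hc fun s => ?_
    obtain ⟨z, hz, h⟩ := exists_core s
    exact ⟨⟨z, hz⟩, h⟩
  let Yc : C(core, UnitAddCircle) := ⟨fun x => Y x, hYc.comp continuous_subtype_val⟩
  have hfib : ∀ x z : core, π x = π z → Yc x = Yc z := by
    intro x z h
    obtain ⟨n, h | h⟩ := glue_eq_iff.1 h
    · exact hstep x x.2 z z.2 n h
    · exact (hstep z z.2 x x.2 n h).symm
  let π' : C(core, GluedSurface g) := ⟨π, hπ.continuous⟩
  have hπ' : IsQuotientMap π' := hπ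
  refine ⟨hπ'.lift Yc hfib, fun b y => ?_⟩
  have hp : |(lam b (0, y)).p| = 1 := by
    change |sgn b * Real.exp 0| = 1
    cases b <;> simp [sgn]
  have hq : |(lam b (0, y)).q| ≤ 1 := by
    change |sgn b * kap y * Real.exp (-0)| ≤ 1
    have := abs_kap_le y
    cases b <;> simpa [sgn] using this
  have hmem : lam b (0, y) ∈ core :=
    ⟨hp.le.trans one_lt_exp_half.le, hq.trans one_lt_exp_half.le⟩
  have : hπ'.lift Yc hfib (π' ⟨lam b (0, y), hmem⟩) = Yc ⟨lam b (0, y), hmem⟩ :=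
    DFunLike.congr_fun (hπ'.lift_comp Yc hfib) _
  exact this.trans (hY1 _ hp.le)

end Essential

end SurfaceFlow

namespace SurfaceFlow

/-! ### Reversible circle homeomorphisms; the map with one fixed point -/

section CircleMaps

/-- Lifts of reversible circle homeomorphisms of degree one. -/
structure IsReversibleLift (φ : ℝ → ℝ) : Prop where
  continuous : Continuous φ
  add_one : ∀ x, φ (x + 1) = φ x + 1
  reverse : ∀ x, φ (-φ (-x)) = x

variable {φ : ℝ → ℝ} (hφ : IsReversibleLift φ)

include hφ in
lemma IsReversibleLift.periodic : Function.Periodic (fun x => (φ x : UnitAddCircle)) 1 := by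
  intro x
  change ((φ (x + 1) : ℝ) : UnitAddCircle) = φ x
  rw [hφ.add_one, AddCircle.coe_add, AddCircle.coe_period, add_zero]

/-- The induced map of the circle. -/
noncomputable def circleMap (y : UnitAddCircle) : UnitAddCircle := hφ.periodic.lift y

lemma circleMap_coe (x : ℝ) : circleMap hφ (x : UnitAddCircle) = (φ x : UnitAddCircle) := rfl

lemma continuous_circleMap : Continuous (circleMap hφ) :=
  continuous_quot_lift _ (continuous_coe_circle.comp hφ.continuous)

lemma circleMap_reverse (y : UnitAddCircle) : circleMap hφ (-circleMap hφ (-y)) = y := by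
  obtain ⟨x, rfl⟩ := QuotientAddGroup.mk_surjective y
  change circleMap hφ (-circleMap hφ (-(x : UnitAddCircle))) = x
  rw [← AddCircle.coe_neg, circleMap_coe, ← AddCircle.coe_neg, circleMap_coe, hφ.reverse]

/-- The induced homeomorphism of the circle. -/
noncomputable def circleHomeo : UnitAddCircle ≃ₜ UnitAddCircle where
  toFun := circleMap hφ
  invFun y := -circleMap hφ (-y)
  left_inv y := by
    have := circleMap_reverse hφ (-y)
    rw [neg_neg] at this
    exact (congrArg _ this).trans (neg_neg y)
  right_inv := circleMap_reverse hφ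
  continuous_toFun := continuous_circleMap hφ
  continuous_invFun := by
    have := continuous_circleMap hφ
    fun_prop

lemma circleHomeo_coe (x : ℝ) : circleHomeo hφ (x : UnitAddCircle) = (φ x : UnitAddCircle) := rfl

lemma reversible_circleHomeo : Reversible (circleHomeo hφ) := circleMap_reverse hφ

lemma hasDisplacement_circleHomeo : HasDisplacement (circleHomeo hφ) := by
  have hper : Function.Periodic (fun x => φ x - x) 1 := by
    intro x
    change φ (x + 1) - (x + 1) = φ x - x
    rw [hφ.add_one]
    ring
  refine ⟨hper.lift, continuous_quot_lift _ (hφ.continuous.sub continuous_id), fun y => ?_⟩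
  obtain ⟨x, rfl⟩ := QuotientAddGroup.mk_surjective y
  change (φ x : UnitAddCircle) = (x : UnitAddCircle) + ((φ x - x : ℝ) : UnitAddCircle)
  rw [← AddCircle.coe_add, add_sub_cancel]

/-- A lift of a circle homeomorphism with exactly one fixed point. -/
noncomputable def hypLift (x : ℝ) : ℝ :=
  x + min (Int.fract (x + 1 / 2)) ((1 - Int.fract (x + 1 / 2)) / 2)

lemma hypLift_add_int (x : ℝ) (n : ℤ) : hypLift (x + n) = hypLift x + n := by
  have : Int.fract (x + n + 1 / 2) = Int.fract (x + 1 / 2) := by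
    rw [show x + n + 1 / 2 = x + 1 / 2 + n by ring, Int.fract_add_intCast]
  simp only [hypLift, this]
  ring

lemma hypLift_of_mem {x : ℝ} (hx : x ∈ Icc (-(1 / 2) : ℝ) (1 / 2)) :
    hypLift x = min (2 * x + 1 / 2) (x / 2 + 1 / 4) := by
  rcases hx.2.eq_or_lt with rfl | h
  · have : Int.fract (1 / 2 + 1 / 2 : ℝ) = 0 := by norm_num
    rw [hypLift, this]
    norm_num
  · have : Int.fract (x + 1 / 2) = x + 1 / 2 := Int.fract_eq_self.2 ⟨by linarith [hx.1], by linarith⟩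
    rw [hypLift, this, ← min_add_add_left]
    congr 1 <;> ring

/-- On [-1/2, 1/2] the lift is the minimum of 2x + 1/2 and x/2 + 1/4, and x ↦ -x conjugates each of
these two maps to the inverse of the other. -/
lemma isReversibleLift_hypLift : IsReversibleLift hypLift where
  continuous := by
    refine continuous_id.add ?_
    have h1 : ContinuousOn (fun w : ℝ => min w ((1 - w) / 2)) (Icc 0 1) := by fun_prop
    exact (h1.comp_fract'' (by norm_num)).comp (by fun_prop)
  add_one x := by simpa using hypLift_add_int x 1
  reverse x := by
    have key : ∀ x ∈ Icc (-(1 / 2) : ℝ) (1 / 2), hypLift (-hypLift (-x)) = x := by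
      rintro x ⟨h1, h2⟩
      rw [hypLift_of_mem (x := -x) ⟨by linarith, by linarith⟩]
      rcases min_choice (2 * -x + 1 / 2) (-x / 2 + 1 / 4) with h | h
      · have h3 := min_eq_left_iff.1 h
        rw [h, hypLift_of_mem ⟨by linarith, by linarith⟩, min_eq_right (by linarith)]
        ring
      · have h3 := min_eq_right_iff.1 h
        rw [h, hypLift_of_mem ⟨by linarith, by linarith⟩, min_eq_left (by linarith)]
        ring
    have h1 := abs_le.1 (abs_sub_round x)
    have h2 := key (x - round x) h1
    have h3 : -(x - round x : ℝ) = -x + round x := by ring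
    rw [h3, hypLift_add_int, neg_add, ← Int.cast_neg, hypLift_add_int, Int.cast_neg] at h2
    linarith

/-- A circle homeomorphism with exactly one fixed point. -/
noncomputable def hyp : UnitAddCircle ≃ₜ UnitAddCircle := circleHomeo isReversibleLift_hypLift

/-- On [0, 1/2] the map halves the distance to 1/2, and along `ray` this distance is 2^{-θ} / 2. -/
lemma hyp_ray (θ : ℝ) (hθ : 0 ≤ θ) : hyp (ray θ : UnitAddCircle) = (ray (θ + 1) : UnitAddCircle) := by
  have h0 := ray_nonneg hθ
  have h1 := ray_lt θ
  rw [hyp, circleHomeo_coe, hypLift_of_mem ⟨by linarith, h1.le⟩, min_eq_right (by linarith)]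
  congr 1
  rw [ray, ray, mul_add, mul_one, neg_add, Real.exp_add, Real.exp_neg (Real.log 2),
    Real.exp_log two_pos]
  ring

lemma tendsto_ray : Tendsto ray atTop (𝓝 (1 / 2)) := by
  have h1 : Tendsto (fun θ : ℝ => Real.log 2 * θ) atTop atTop :=
    tendsto_id.const_mul_atTop (Real.log_pos one_lt_two)
  have h2 := (Real.tendsto_exp_neg_atTop_nhds_zero.comp h1).div_const 2 |>.const_sub (1 / 2)
  rw [zero_div, sub_zero] at h2
  exact h2

lemma isLimitOf_hyp : IsLimitOf hyp {((1 / 2 : ℝ) : UnitAddCircle)} 0 := by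
  have hfix : hyp ((1 / 2 : ℝ) : UnitAddCircle) = ((1 / 2 : ℝ) : UnitAddCircle) := by
    rw [hyp, circleHomeo_coe, hypLift_of_mem (by norm_num)]
    norm_num
  have hit : ∀ n : ℕ, hyp^[n] 0 = (ray n : UnitAddCircle) := by
    intro n
    have := IsCylinder.iterate_ray hyp_ray le_rfl n
    rwa [ray_zero, zero_add, AddCircle.coe_zero] at this
  have hlim : Tendsto (fun n => hyp^[n] 0) atTop (𝓝 ((1 / 2 : ℝ) : UnitAddCircle)) := by
    simp only [hit]
    exact (continuous_coe_circle.tendsto _).comp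
      (tendsto_ray.comp tendsto_natCast_atTop_atTop)
  refine ⟨fun y => ?_, ?_, isClosed_singleton, fun n hn => ?_, fun l => ?_⟩
  · rw [mem_singleton_iff, mem_singleton_iff]
    nth_rw 2 [← hfix]
    exact hyp.injective.eq_iff.symm
  · rintro _ rfl
    rw [norm_coe_circle (by norm_num)]
    norm_num
  · obtain ⟨m, rfl⟩ := Nat.exists_eq_succ_of_ne_zero hn.ne'
    rw [hit, Nat.cast_succ]
    exact norm_ray_add_one (by positivity)
  · rw [mem_singleton_iff]
    constructor
    · intro H
      exact eq_of_nhds_neBot (NeBot.mono H (inf_le_inf_left _ hlim))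
    · rintro rfl
      exact hlim.mapClusterPt

end CircleMaps

end SurfaceFlow

namespace SurfaceFlow

/-! ### The semi-conjugacy behind the Denjoy map -/

section Denjoy

/-- The lengths of the gaps. -/
noncomputable def gapLen (n : ℤ) : ℝ := (1 / 2) ^ n.natAbs / 3

lemma gapLen_pos (n : ℤ) : 0 < gapLen n := by unfold gapLen; positivity

lemma gapLen_neg (n : ℤ) : gapLen (-n) = gapLen n := by rw [gapLen, Int.natAbs_neg, gapLen]

/-- Total length 1 is what makes `psi` commute with integer translations. -/
lemma hasSum_gapLen : HasSum gapLen 1 := by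
  have h1 : HasSum (fun n : ℕ => gapLen n) (2 / 3) := by
    have := hasSum_geometric_two.div_const 3
    simpa [gapLen] using this
  have h2 : HasSum (fun n : ℕ => gapLen (-(n + 1 : ℤ))) (1 / 3) := by
    have h3 := (hasSum_geometric_two.mul_right (1 / 2)).div_const 3
    have h4 : ∀ n : ℕ, gapLen (-(n + 1 : ℤ)) = (1 / 2) ^ n * (1 / 2) / 3 := by
      intro n
      rw [gapLen, Int.natAbs_neg, show ((n : ℤ) + 1).natAbs = n + 1 by omega, pow_succ]
    simp only [h4]
    have h5 : (1 / 3 : ℝ) = 2 * (1 / 2) / 3 := by norm_num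
    rw [h5]
    exact h3
  have := h1.of_nat_of_neg_add_one h2
  convert this using 1
  norm_num

/-- An irrational angle. -/
noncomputable def ang : ℝ := √2

lemma ang_eq_zero {n m : ℤ} (h : n * ang = m) : n = 0 := by
  by_contra hn
  have := irrational_sqrt_two.intCast_mul hn
  exact this ⟨m, by rw [Rat.cast_intCast]; exact h.symm⟩

lemma exists_mem_Ioo {a b : ℝ} (hab : a < b) (N : ℕ) :
    ∃ n : ℕ, N ≤ n ∧ ∃ m : ℤ, n * ang + m ∈ Ioo a b := by
  have h1 : DenseRange (· • (ang : UnitAddCircle) : ℤ → UnitAddCircle) := by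
    rw [AddCircle.denseRange_zsmul_coe_iff, div_one]
    exact irrational_sqrt_two
  have h2 : MapClusterPt (((a + b) / 2 : ℝ) : UnitAddCircle) atTop
      (fun n : ℕ => n • (ang : UnitAddCircle)) := by
    rw [mapClusterPt_atTop_nsmul_iff_mem_topologicalClosure_zmultiples]
    have : closure ((AddSubgroup.zmultiples (ang : UnitAddCircle) : Set UnitAddCircle)) = univ := by
      rw [AddSubgroup.coe_zmultiples]
      exact h1.closure_range
    change _ ∈ closure _
    rw [this]
    trivial
  obtain ⟨n, hn, r, hr, h3⟩ := frequently_atTop.1 (mapClusterPt_iff_frequently.1 h2 _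
    ((isOpenMap_coe_circle _ isOpen_Ioo).mem_nhds
      ⟨(a + b) / 2, ⟨by linarith, by linarith⟩, rfl⟩ : (↑) '' Ioo a b ∈ _)) N
  have h4 : ((r - n * ang : ℝ) : UnitAddCircle) = 0 := by
    rw [AddCircle.coe_sub, sub_eq_zero, h3, ← nsmul_eq_mul, AddCircle.coe_nsmul]
  obtain ⟨m, hm⟩ := AddCircle.coe_eq_zero_iff (p := (1 : ℝ)).1 h4
  rw [zsmul_eq_mul, mul_one] at hm
  refine ⟨n, hn, m, ?_⟩
  rw [hm, add_sub_cancel]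
  exact hr

/-- The terms of the series `psi`. -/
noncomputable def psiTerm (x : ℝ) (n : ℤ) : ℝ := gapLen n * (1 / 2 + n * ang + ⌊x - n * ang⌋)

/-- The upper semi-conjugacy from the rotation. -/
noncomputable def psi (x : ℝ) : ℝ := ∑' n, psiTerm x n

/-- The summand 1/2 + n * ang centres the step function: the bracket is x plus 1/2 minus a
fractional part. This gives summability and keeps `psi` within 1/2 of the identity. -/
lemma abs_psiTerm_sub_le (x : ℝ) (n : ℤ) : |psiTerm x n - gapLen n * x| ≤ gapLen n * (1 / 2) := by
  rw [psiTerm, ← mul_sub, abs_mul, abs_of_pos (gapLen_pos n)]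
  refine mul_le_mul_of_nonneg_left ?_ (gapLen_pos n).le
  have h1 := Int.floor_le (x - n * ang)
  have h2 := Int.lt_floor_add_one (x - n * ang)
  rw [abs_le]
  constructor <;> linarith

lemma abs_psiTerm_le (x : ℝ) (n : ℤ) : |psiTerm x n| ≤ gapLen n * (|x| + 1 / 2) := by
  have h1 := abs_psiTerm_sub_le x n
  have h2 : |gapLen n * x| = gapLen n * |x| := by rw [abs_mul, abs_of_pos (gapLen_pos n)]
  have h3 := abs_add_le (psiTerm x n - gapLen n * x) (gapLen n * x)
  rw [sub_add_cancel] at h3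
  linarith

lemma summable_psiTerm (x : ℝ) : Summable (psiTerm x) :=
  .of_norm_bounded (hasSum_gapLen.summable.mul_right (|x| + 1 / 2)) fun n => by
    rw [Real.norm_eq_abs]
    exact abs_psiTerm_le x n

lemma hasSum_psi (x : ℝ) : HasSum (psiTerm x) (psi x) := (summable_psiTerm x).hasSum

lemma abs_psi_sub_le (x : ℝ) : |psi x - x| ≤ 1 / 2 := by
  have h1 : HasSum (fun n => psiTerm x n - gapLen n * x) (psi x - x) := by
    simpa using (hasSum_psi x).sub (hasSum_gapLen.mul_right x)
  have h2 : HasSum (fun n => gapLen n * (1 / 2)) (1 / 2) := by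
    simpa only [one_mul] using hasSum_gapLen.mul_right (1 / 2)
  rw [abs_le]
  constructor
  · exact hasSum_le (fun n => (abs_le.1 (abs_psiTerm_sub_le x n)).1) h2.neg h1
  · exact hasSum_le (fun n => (abs_le.1 (abs_psiTerm_sub_le x n)).2) h1 h2

lemma psi_add_int (x : ℝ) (m : ℤ) : psi (x + m) = psi x + m := by
  have h1 : HasSum (fun n => psiTerm x n + gapLen n * m) (psi x + m) := by
    simpa using (hasSum_psi x).add (hasSum_gapLen.mul_right (m : ℝ))
  refine (hasSum_psi _).unique (h1.congr_fun ?_ )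
  intro n
  rw [psiTerm, psiTerm, show x + m - n * ang = x - n * ang + m by ring, Int.floor_add_intCast]
  push_cast
  ring

/-- Because the gap lengths are symmetric in n, reflection turns floors into ceilings. So -psi(-x)
is the left-hand counterpart of psi x, and the two bound the gap at x. -/
lemma hasSum_neg_psi_neg (x : ℝ) :
    HasSum (fun n => gapLen n * (-(1 / 2) + n * ang + ⌈x - n * ang⌉)) (-psi (-x)) := by
  have h1 := ((Equiv.neg ℤ).hasSum_iff.2 (hasSum_psi (-x))).neg
  refine h1.congr_fun fun n => ?_
  simp only [Function.comp, Equiv.neg_apply, psiTerm, gapLen_neg]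
  rw [show -x - ((-n : ℤ) : ℝ) * ang = -(x - n * ang) by push_cast; ring, Int.floor_neg]
  push_cast
  ring

/-- Jumps are dense, so one lies strictly between x and x'; it separates one term strictly, and all
others are weakly ordered. -/
lemma psi_lt {x x' : ℝ} (h : x < x') : psi x < -psi (-x') := by
  obtain ⟨n, -, m, hm1, hm2⟩ := exists_mem_Ioo h 0
  refine hasSum_lt (i := (n : ℤ)) (fun k => ?_) ?_ (hasSum_psi x) (hasSum_neg_psi_neg x')
  · refine mul_le_mul_of_nonneg_left ?_ (gapLen_pos k).le
    have : ⌊x - k * ang⌋ + 1 ≤ ⌈x' - k * ang⌉ := by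
      rw [Int.add_one_le_iff, Int.lt_ceil]
      exact (Int.floor_le _).trans_lt (by linarith)
    have : (⌊x - k * ang⌋ : ℝ) + 1 ≤ ⌈x' - k * ang⌉ := by exact_mod_cast this
    linarith
  · refine mul_lt_mul_of_pos_left ?_ (gapLen_pos _)
    have h3 : ⌊x - (n : ℤ) * ang⌋ < m := Int.floor_lt.2 (by push_cast; linarith)
    have h4 : m < ⌈x' - (n : ℤ) * ang⌉ := Int.lt_ceil.2 (by push_cast; linarith)
    have : ⌊x - (n : ℤ) * ang⌋ + 2 ≤ ⌈x' - (n : ℤ) * ang⌉ := by omega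
    have : (⌊x - (n : ℤ) * ang⌋ : ℝ) + 2 ≤ ⌈x' - (n : ℤ) * ang⌉ := by exact_mod_cast this
    linarith

/-- The orbit of zero under the rotation. -/
def IsJump (x : ℝ) : Prop := ∃ n m : ℤ, x = n * ang + m

/-- ⌈z⌉ ≤ ⌊z⌋ + 1, with equality unless z is an integer; so the n-th terms differ exactly when x - n
* ang is an integer. -/
lemma gap_nonneg_iff (x : ℝ) : -psi (-x) ≤ psi x ∧ (-psi (-x) = psi x ↔ ¬ IsJump x) := by
  have hle : ∀ n : ℤ, gapLen n * (-(1 / 2) + n * ang + ⌈x - n * ang⌉) ≤ psiTerm x n := by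
    intro n
    refine mul_le_mul_of_nonneg_left ?_ (gapLen_pos n).le
    have : (⌈x - n * ang⌉ : ℝ) ≤ ⌊x - n * ang⌋ + 1 := by exact_mod_cast Int.ceil_le_floor_add_one _
    linarith
  refine ⟨hasSum_le hle (hasSum_neg_psi_neg x) (hasSum_psi x), fun heq hj => ?_, fun hj => ?_⟩
  · obtain ⟨n, m, h⟩ := hj
    refine (hasSum_lt (i := n) hle ?_ (hasSum_neg_psi_neg x) (hasSum_psi x)).ne heq
    refine mul_lt_mul_of_pos_left ?_ (gapLen_pos _)
    rw [h, add_sub_cancel_left, Int.ceil_intCast, Int.floor_intCast]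
    linarith
  · refine (hasSum_neg_psi_neg x).unique ((hasSum_psi x).congr_fun fun n => ?_)
    have h1 : ⌈x - n * ang⌉ = ⌊x - n * ang⌋ + 1 := by
      rw [Int.ceil_eq_iff]
      refine ⟨?_, by
        push_cast
        exact (Int.lt_floor_add_one _).le⟩
      push_cast
      rw [add_sub_cancel_right]
      refine lt_of_le_of_ne (Int.floor_le _) fun h => hj ⟨n, ⌊x - n * ang⌋, ?_⟩
      rw [h]
      ring
    rw [psiTerm, h1]
    push_cast
    ring

/-- Only the term n = 0 jumps at 0, so the gap there has length `gapLen 0` = 1/3 and is centred at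
0. It reaches to ±1/6, beyond the zone ‖y‖ < 1/8 where the gluing is not a plain suspension. -/
lemma psi_zero : psi 0 = 1 / 6 := by
  have h1 : HasSum (fun n => psiTerm 0 n - gapLen n * (-(1 / 2) + n * ang + ⌈0 - n * ang⌉))
      (psi 0 - -psi (-0)) := (hasSum_psi 0).sub (hasSum_neg_psi_neg 0)
  have h2 := h1.unique (hasSum_single 0 fun n hn => ?_)
  · rw [neg_zero] at h2
    simp only [psiTerm, gapLen] at h2
    norm_num at h2
    linarith
  · have h1 : ⌈0 - n * ang⌉ = ⌊0 - n * ang⌋ + 1 := by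
      rw [Int.ceil_eq_iff]
      refine ⟨?_, by
        push_cast
        exact (Int.lt_floor_add_one _).le⟩
      push_cast
      rw [add_sub_cancel_right]
      refine lt_of_le_of_ne (Int.floor_le _) fun h => hn ?_
      refine ang_eq_zero (m := -⌊0 - n * ang⌋) ?_
      push_cast
      linarith
    rw [psiTerm, h1]
    push_cast
    ring

/-- Floors are right continuous; dominated convergence passes this to the series. -/
lemma tendsto_psi (x : ℝ) : Tendsto psi (𝓝[>] x) (𝓝 (psi x)) := by
  refine tendsto_tsum_of_dominated_convergence
    (hasSum_gapLen.summable.mul_right (|x| + 1 + 1 / 2)) (fun n => ?_) ?_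
  · have h1 : Tendsto (fun y => y - n * ang) (𝓝[>] x) (𝓝[≥] (x - n * ang)) := by
      refine tendsto_nhdsWithin_iff.2 ⟨?_, ?_⟩
      · exact ((continuous_id.sub continuous_const).tendsto x).mono_left nhdsWithin_le_nhds
      · filter_upwards [self_mem_nhdsWithin] with y hy
        exact sub_le_sub_right (le_of_lt (mem_Ioi.1 hy)) _
    have h2 := (tendsto_floor_right_pure_floor (x - n * ang)).comp h1
    have h3 : (fun y => psiTerm y n) =ᶠ[𝓝[>] x] fun _ => psiTerm x n := by
      filter_upwards [tendsto_pure.1 h2] with y hy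
      simp only [Function.comp] at hy
      rw [psiTerm, hy, psiTerm]
    exact tendsto_const_nhds.congr' h3.symm
  · filter_upwards [Ioo_mem_nhdsGT (show x < x + 1 by linarith)] with y hy n
    rw [Real.norm_eq_abs]
    refine (abs_psiTerm_le y n).trans (mul_le_mul_of_nonneg_left ?_ (gapLen_pos n).le)
    have : |y| ≤ |x| + 1 := by
      have h1 := abs_add_le x (y - x)
      rw [add_sub_cancel, abs_of_pos (sub_pos.2 hy.1)] at h1
      linarith [hy.2]
    linarith

end Denjoy

end SurfaceFlow

namespace SurfaceFlow

/-! ### The Denjoy homeomorphism and its minimal set -/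

section DenjoyMap

/-- The completed graph of `psi`. -/
noncomputable def blow (x s : ℝ) : ℝ := (1 - s) * -psi (-x) + s * psi x

lemma neg_blow (x s : ℝ) : -blow x s = blow (-x) (1 - s) := by
  simp only [blow, neg_neg]
  ring

lemma blow_add_int (x s : ℝ) (m : ℤ) : blow (x + m) s = blow x s + m := by
  have h := psi_add_int (-x) (-m)
  rw [show -x + ((-m : ℤ) : ℝ) = -(x + m) by push_cast; ring] at h
  simp only [blow, psi_add_int, h]
  push_cast
  ring

lemma blow_mem {x s : ℝ} (hs : s ∈ Icc (0 : ℝ) 1) : -psi (-x) ≤ blow x s ∧ blow x s ≤ psi x := by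
  have := (gap_nonneg_iff x).1
  simp only [blow]
  constructor <;> nlinarith [hs.1, hs.2]

lemma blow_lt {x x' s s' : ℝ} (hs : s ∈ Icc (0 : ℝ) 1) (hs' : s' ∈ Icc (0 : ℝ) 1) (h : x < x') :
    blow x s < blow x' s' :=
  (blow_mem hs).2.trans_lt ((psi_lt h).trans_le (blow_mem hs').1)

lemma eq_of_blow_eq {x x' s s' : ℝ} (hs : s ∈ Icc (0 : ℝ) 1) (hs' : s' ∈ Icc (0 : ℝ) 1)
    (h : blow x s = blow x' s') : x = x' := by
  rcases lt_trichotomy x x' with h1 | h1 | h1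
  · exact absurd h (blow_lt hs hs' h1).ne
  · exact h1
  · exact absurd h (blow_lt hs' hs h1).ne'

lemma blow_sub (x s s' : ℝ) : blow x s' - blow x s = (s' - s) * (psi x - -psi (-x)) := by
  simp only [blow]
  ring

lemma blow_lt_of_isJump {x s s' : ℝ} (hx : IsJump x) (h : s < s') : blow x s < blow x s' := by
  have h1 := gap_nonneg_iff x
  have h2 : -psi (-x) < psi x := lt_of_le_of_ne h1.1 fun h => h1.2.1 h hx
  have := mul_pos (sub_pos.2 h) (sub_pos.2 h2)
  rw [← blow_sub] at this
  linarith

lemma blow_eq_of_not_isJump {x : ℝ} (hx : ¬ IsJump x) (s s' : ℝ) : blow x s = blow x s' := by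
  have := blow_sub x s' s
  rw [(gap_nonneg_iff x).2.2 hx, sub_self, mul_zero] at this
  linarith

lemma isJump_add_ang {x : ℝ} : IsJump (x + ang) ↔ IsJump x := by
  constructor
  · rintro ⟨n, m, h⟩
    refine ⟨n - 1, m, ?_⟩
    push_cast
    linarith
  · rintro ⟨n, m, h⟩
    refine ⟨n + 1, m, ?_⟩
    push_cast
    linarith

lemma exists_psi_lt (x : ℝ) {r : ℝ} (hr : psi x < r) : ∃ y, x < y ∧ psi y < r := by
  have h1 := (tendsto_psi x).eventually (gt_mem_nhds hr)
  obtain ⟨y, h2, h3⟩ := (h1.and self_mem_nhdsWithin).exists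
  exact ⟨y, h3, h2⟩

/-- For x the supremum of the points with psi ≤ r, right continuity gives r ≤ psi x, and its mirror
image gives -psi(-x) ≤ r; so r lies in the closed gap at x. -/
lemma exists_blow_eq (r : ℝ) : ∃ x, ∃ s ∈ Icc (0 : ℝ) 1, blow x s = r := by
  set X : Set ℝ := {x | psi x ≤ r} with hX
  have hmono : ∀ x y, x ≤ y → psi x ≤ psi y := by
    intro x y h
    rcases h.eq_or_lt with rfl | h
    · exact le_rfl
    · exact (psi_lt h).le.trans (gap_nonneg_iff y).1
  have hne : X.Nonempty := ⟨r - 1, by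
    have := (abs_le.1 (abs_psi_sub_le (r - 1))).2
    change psi (r - 1) ≤ r
    linarith⟩
  have hbd : BddAbove X := ⟨r + 1, fun x hx => by
    have := (abs_le.1 (abs_psi_sub_le x)).1
    have hx' : psi x ≤ r := hx
    linarith⟩
  have h1 : r ≤ psi (sSup X) := by
    by_contra hcon
    obtain ⟨y, hy, hyr⟩ := exists_psi_lt _ (not_le.1 hcon)
    exact hy.not_ge (le_csSup hbd hyr.le)
  have h2 : -psi (-sSup X) ≤ r := by
    by_contra hcon
    rw [not_le, lt_neg] at hcon
    obtain ⟨y, hy, hyr⟩ := exists_psi_lt _ hcon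
    obtain ⟨x, hx, hyx⟩ := exists_lt_of_lt_csSup hne (show -y < sSup X by linarith)
    have h3 := psi_lt hyx
    have hx' : psi x ≤ r := hx
    have h4 : psi (-x) ≤ psi y := hmono _ _ (by linarith)
    have h5 := psi_lt (show -x < y by linarith)
    have h6 := hmono _ _ hyx.le
    have h7 := (gap_nonneg_iff (-y)).1
    rw [neg_neg] at h7
    linarith
  have hle := (gap_nonneg_iff (sSup X)).1
  rcases hle.eq_or_lt with h | h
  · refine ⟨sSup X, 0, by simp, ?_⟩
    simp only [blow]
    linarith
  · refine ⟨sSup X, (r - -psi (-sSup X)) / (psi (sSup X) - -psi (-sSup X)),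
      ⟨div_nonneg (by linarith) (by linarith), (div_le_one (by linarith)).2 (by linarith)⟩, ?_⟩
    have hne : psi (sSup X) - -psi (-sSup X) ≠ 0 := (sub_pos.2 h).ne'
    rw [blow]
    field_simp
    ring

/-- The lift of the Denjoy homeomorphism. -/
noncomputable def denjoyLift (r : ℝ) : ℝ :=
  blow ((exists_blow_eq r).choose + ang) (exists_blow_eq r).choose_spec.choose

/-- The value `blow x s` determines x, and also s if x is a jump. Otherwise s is irrelevant, both at
x and at x + ang, so the choice in the definition does no harm. -/
lemma denjoyLift_blow {s : ℝ} (hs : s ∈ Icc (0 : ℝ) 1) (x : ℝ) :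
    denjoyLift (blow x s) = blow (x + ang) s := by
  obtain ⟨x', s', h1, h2, h3⟩ : ∃ x' s', s' ∈ Icc (0 : ℝ) 1 ∧ blow x' s' = blow x s ∧
      denjoyLift (blow x s) = blow (x' + ang) s' :=
    let h := (exists_blow_eq (blow x s)).choose_spec.choose_spec
    ⟨_, _, h.1, h.2, rfl⟩
  have hx : x' = x := eq_of_blow_eq h1 hs h2
  rw [h3]
  rw [hx] at h2 ⊢
  by_cases hj : IsJump x
  · rcases lt_trichotomy s' s with h | h | h
    · exact absurd h2 (blow_lt_of_isJump hj h).ne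
    · rw [h]
    · exact absurd h2 (blow_lt_of_isJump hj h).ne'
  · exact blow_eq_of_not_isJump (mt isJump_add_ang.1 hj) _ _

lemma one_sub_mem {s : ℝ} (hs : s ∈ Icc (0 : ℝ) 1) : 1 - s ∈ Icc (0 : ℝ) 1 :=
  ⟨by linarith [hs.2], by linarith [hs.1]⟩

/-- In the coordinates (x, s), negation is (x, s) ↦ (-x, 1 - s), which conjugates translation of x
by ang to its inverse. -/
lemma denjoyLift_reverse (r : ℝ) : denjoyLift (-denjoyLift (-r)) = r := by
  obtain ⟨x, s, hs, rfl⟩ := exists_blow_eq r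
  rw [neg_blow, denjoyLift_blow (one_sub_mem hs), neg_blow, sub_sub_cancel, denjoyLift_blow hs]
  congr 1
  ring

lemma isReversibleLift_denjoyLift : IsReversibleLift denjoyLift where
  continuous := by
    refine Monotone.continuous_of_surjective ?_ fun r => ⟨_, denjoyLift_reverse r⟩
    intro r r' hrr
    obtain ⟨x, s, hs, rfl⟩ := exists_blow_eq r
    obtain ⟨x', s', hs', rfl⟩ := exists_blow_eq r'
    rw [denjoyLift_blow hs, denjoyLift_blow hs']
    rcases lt_trichotomy x x' with h | rfl | h
    · exact (blow_lt hs hs' (by linarith)).le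
    · by_cases hj : IsJump x
      · have hss : s ≤ s' := not_lt.1 fun h => hrr.not_gt (blow_lt_of_isJump hj h)
        rcases hss.eq_or_lt with rfl | h
        · exact le_rfl
        · exact (blow_lt_of_isJump (isJump_add_ang.2 hj) h).le
      · exact (blow_eq_of_not_isJump (mt isJump_add_ang.1 hj) _ _).le
    · exact absurd hrr (blow_lt hs' hs h).not_ge
  add_one r := by
    obtain ⟨x, s, hs, rfl⟩ := exists_blow_eq r
    have h1 := blow_add_int x s 1
    have h2 := blow_add_int (x + ang) s 1
    rw [Int.cast_one] at h1 h2
    rw [← h1, denjoyLift_blow hs, denjoyLift_blow hs, ← h2]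
    congr 1
    ring
  reverse := denjoyLift_reverse

/-- A Denjoy homeomorphism of the circle. -/
noncomputable def denjoy : UnitAddCircle ≃ₜ UnitAddCircle := circleHomeo isReversibleLift_denjoyLift

lemma denjoy_blow {s : ℝ} (hs : s ∈ Icc (0 : ℝ) 1) (x : ℝ) :
    denjoy (blow x s : UnitAddCircle) = (blow (x + ang) s : UnitAddCircle) := by
  rw [denjoy, circleHomeo_coe, denjoyLift_blow hs]

lemma denjoy_iterate_blow {s : ℝ} (hs : s ∈ Icc (0 : ℝ) 1) (n : ℕ) :
    denjoy^[n] (blow 0 s : UnitAddCircle) = (blow (n * ang) s : UnitAddCircle) := by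
  induction n with
  | zero => simp
  | succ n ih =>
    rw [Function.iterate_succ_apply', ih, denjoy_blow hs]
    push_cast
    ring_nf

lemma exists_of_coe_blow_eq {x x' s s' : ℝ} (hs : s ∈ Icc (0 : ℝ) 1) (hs' : s' ∈ Icc (0 : ℝ) 1)
    (h : (blow x s : UnitAddCircle) = (blow x' s' : UnitAddCircle)) :
    ∃ m : ℤ, x = x' + m ∧ blow x s = blow x s' := by
  have h0 : ((blow x s - blow x' s' : ℝ) : UnitAddCircle) = 0 := by
    rw [AddCircle.coe_sub, h, sub_self]
  obtain ⟨m, hm⟩ := AddCircle.coe_eq_zero_iff (p := (1 : ℝ)).1 h0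
  rw [zsmul_eq_mul, mul_one] at hm
  have h1 : blow x s = blow (x' + m) s' := by
    rw [blow_add_int]
    linarith
  have h2 := eq_of_blow_eq hs hs' h1
  refine ⟨m, h2, ?_⟩
  rw [h1, h2]

lemma coe_add_int (r : ℝ) (m : ℤ) : ((r + m : ℝ) : UnitAddCircle) = r := by
  have : ((m : ℝ) : UnitAddCircle) = 0 :=
    AddCircle.coe_eq_zero_iff (p := (1 : ℝ)).2 ⟨m, by simp⟩
  rw [AddCircle.coe_add, this, add_zero]

/-- The Denjoy minimal set. -/
def denjoySet : Set UnitAddCircle :=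
  {y | ∃ x s : ℝ, (s = 0 ∨ s = 1) ∧ y = (blow x s : UnitAddCircle)}

lemma mem_Icc_of_endpoint {s : ℝ} (hs : s = 0 ∨ s = 1) : s ∈ Icc (0 : ℝ) 1 := by
  rcases hs with rfl | rfl <;> simp

lemma mem_denjoySet_iff (y : UnitAddCircle) : y ∈ denjoySet ↔ denjoy y ∈ denjoySet := by
  constructor
  · rintro ⟨x, s, hs, rfl⟩
    exact ⟨x + ang, s, hs, denjoy_blow (mem_Icc_of_endpoint hs) x⟩
  · rintro ⟨x, s, hs, h⟩
    refine ⟨x - ang, s, hs, denjoy.injective ?_⟩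
    rw [h, denjoy_blow (mem_Icc_of_endpoint hs), sub_add_cancel]

/-- By monotonicity in x everything outside the gap at 0 lies beyond its endpoints ±1/6. -/
lemma one_sixth_le_abs_blow {x s : ℝ} (hs : s ∈ Icc (0 : ℝ) 1) (h : x ≠ 0 ∨ s = 0 ∨ s = 1) :
    1 / 6 ≤ |blow x s| := by
  have h1 : blow 0 1 = 1 / 6 := by simp [blow, psi_zero]
  have h0 : blow 0 0 = -(1 / 6) := by simp [blow, psi_zero]
  rcases lt_trichotomy x 0 with hx | rfl | hx
  · have := blow_lt hs (mem_Icc_of_endpoint (Or.inl rfl)) hx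
    rw [abs_of_neg] <;> linarith
  · rcases h with h | rfl | rfl
    · exact absurd rfl h
    · rw [h0]
      norm_num
    · rw [h1]
      norm_num
  · have := blow_lt (mem_Icc_of_endpoint (Or.inr rfl)) hs hx
    rw [abs_of_pos] <;> linarith

lemma one_eighth_le_norm_blow {x s : ℝ} (hs : s ∈ Icc (0 : ℝ) 1)
    (h : (∀ m : ℤ, x ≠ m) ∨ s = 0 ∨ s = 1) : 1 / 8 ≤ ‖(blow x s : UnitAddCircle)‖ := by
  have h1 : blow (x + (-round (blow x s) : ℤ)) s = blow x s - round (blow x s) := by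
    rw [blow_add_int]
    push_cast
    ring
  have h2 : (blow x s : UnitAddCircle) =
      (blow (x + (-round (blow x s) : ℤ)) s : UnitAddCircle) := by
    rw [blow_add_int, coe_add_int]
  rw [h2, norm_coe_circle (by rw [h1]; exact abs_sub_round _)]
  refine le_trans (by norm_num) (one_sixth_le_abs_blow hs (h.imp_left fun h h' => ?_))
  refine h (round (blow x s)) ?_
  push_cast at h'
  linarith

/-- Near an endpoint of a gap or a point outside the gaps, there is an interval of small gaps. -/
lemma exists_interval {x s : ℝ} (hs : s = 0 ∨ s = 1) {ε : ℝ} (hε : 0 < ε) :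
    ∃ a b, a < b ∧ ∀ z ∈ Ioo a b, ∀ t ∈ Icc (0 : ℝ) 1,
      |blow z t - blow x s| < ε ∧ blow z t ≠ blow x s := by
  have hI := mem_Icc_of_endpoint hs
  rcases hs with rfl | rfl
  · have h0 : blow x 0 = -psi (-x) := by simp [blow]
    obtain ⟨y, hy, hyr⟩ := exists_psi_lt (-x) (show psi (-x) < psi (-x) + ε by linarith)
    refine ⟨-y, x, by linarith, fun z hz t ht => ?_⟩
    have h1 := blow_lt ht hI hz.2
    have h2 := blow_lt (mem_Icc_of_endpoint (Or.inl rfl)) ht hz.1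
    have h3 : blow (-y) 0 = -psi y := by simp [blow]
    refine ⟨?_, h1.ne⟩
    rw [abs_lt]
    constructor <;> linarith
  · have h0 : blow x 1 = psi x := by simp [blow]
    obtain ⟨y, hy, hyr⟩ := exists_psi_lt x (show psi x < psi x + ε by linarith)
    refine ⟨x, y, hy, fun z hz t ht => ?_⟩
    have h1 := blow_lt hI ht hz.1
    have h2 := blow_lt ht (mem_Icc_of_endpoint (Or.inr rfl)) hz.2
    have h3 : blow y 1 = psi y := by simp [blow]
    refine ⟨?_, h1.ne'⟩
    rw [abs_lt]
    constructor <;> linarith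

lemma exists_interval_nhds {l : UnitAddCircle} (hl : l ∈ denjoySet) {U : Set UnitAddCircle}
    (hU : U ∈ 𝓝 l) : ∃ a b, a < b ∧ ∀ z ∈ Ioo a b, ∀ t ∈ Icc (0 : ℝ) 1,
      (blow z t : UnitAddCircle) ∈ U ∧ (blow z t : UnitAddCircle) ≠ l := by
  obtain ⟨x, s, hs, rfl⟩ := hl
  obtain ⟨ε, hε, hball⟩ := Metric.mem_nhds_iff.1 (continuous_coe_circle.tendsto _ hU)
  obtain ⟨a, b, hab, h⟩ := exists_interval (x := x) hs (ε := min ε 1) (by positivity)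
  refine ⟨a, b, hab, fun z hz t ht => ?_⟩
  obtain ⟨h1, h2⟩ := h z hz t ht
  refine ⟨hball ?_, fun heq => h2 (coe_circle_injOn (h1.trans_le (min_le_right _ _)) heq)⟩
  rw [Metric.mem_ball, Real.dist_eq]
  exact h1.trans_le (min_le_left _ _)

/-- The n-th iterate lies in the closed gap over n * ang. An open gap is visited at most once, by
irrationality. Near a point of `denjoySet` there are all the gaps over some interval of base points,
and the rotation visits that interval infinitely often. -/
lemma mapClusterPt_denjoy {s : ℝ} (hs : s ∈ Icc (0 : ℝ) 1) (l : UnitAddCircle) :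
    MapClusterPt l atTop (fun n => denjoy^[n] (blow 0 s : UnitAddCircle)) ↔ l ∈ denjoySet := by
  simp only [denjoy_iterate_blow hs]
  rw [mapClusterPt_iff_frequently]
  constructor
  · intro H
    by_contra hl
    obtain ⟨r, rfl⟩ := QuotientAddGroup.mk_surjective l
    obtain ⟨x, t, ht, rfl⟩ := exists_blow_eq r
    have hne : ∀ s : ℝ, (s = 0 ∨ s = 1) → blow x t ≠ blow x s := fun s hs h =>
      hl ⟨x, s, hs, congrArg _ h⟩
    have h0 : blow x 0 < blow x t := lt_of_le_of_ne
      ((by simp [blow] : blow x 0 = -psi (-x)).le.trans (blow_mem ht).1) (hne 0 (Or.inl rfl)).symm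
    have h1 : blow x t < blow x 1 := lt_of_le_of_ne
      ((blow_mem ht).2.trans (by simp [blow] : psi x = blow x 1).le) (hne 1 (Or.inr rfl))
    have hU := (isOpenMap_coe_circle _ (isOpen_Ioo (a := blow x 0) (b := blow x 1))).mem_nhds
      ⟨_, ⟨h0, h1⟩, rfl⟩
    have key : ∀ n : ℕ, (blow (n * ang) s : UnitAddCircle) ∈
        ((↑) '' Ioo (blow x 0) (blow x 1) : Set UnitAddCircle) → ∃ m : ℤ, n * ang = x + m := by
      rintro n ⟨r, ⟨h2, h3⟩, h4⟩
      obtain ⟨y, t', ht', rfl⟩ := exists_blow_eq r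
      have hyx : y = x := by
        rcases lt_trichotomy y x with h | h | h
        · exact absurd h2 (blow_lt ht' (mem_Icc_of_endpoint (Or.inl rfl)) h).not_gt
        · exact h
        · exact absurd h3 (blow_lt (mem_Icc_of_endpoint (Or.inr rfl)) ht' h).not_gt
      obtain ⟨m, hm, -⟩ := exists_of_coe_blow_eq hs ht' h4.symm
      exact ⟨m, hyx ▸ hm⟩
    obtain ⟨n, -, hn⟩ := frequently_atTop.1 (H _ hU) 0
    obtain ⟨n', hn', hnn⟩ := frequently_atTop.1 (H _ hU) (n + 1)
    obtain ⟨m, hm⟩ := key n hn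
    obtain ⟨m', hm'⟩ := key n' hnn
    have := ang_eq_zero (n := n' - n) (m := m' - m) (by push_cast; linarith)
    omega
  · intro hl U hU
    obtain ⟨a, b, hab, h⟩ := exists_interval_nhds hl hU
    rw [frequently_atTop]
    intro N
    obtain ⟨n, hn, m, hm⟩ := exists_mem_Ioo hab N
    refine ⟨n, hn, ?_⟩
    have := (h _ hm s hs).1
    rwa [blow_add_int, coe_add_int] at this

lemma isClosed_denjoySet : IsClosed denjoySet := by
  have h : denjoySet = {l | MapClusterPt l atTop
      (fun n => denjoy^[n] (blow 0 0 : UnitAddCircle))} := by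
    ext l
    exact (mapClusterPt_denjoy (mem_Icc_of_endpoint (Or.inl rfl)) l).symm
  rw [h]
  exact isClosed_setOfPred_clusterPt

lemma norm_of_mem_denjoySet {y : UnitAddCircle} (hy : y ∈ denjoySet) : 1 / 8 ≤ ‖y‖ := by
  obtain ⟨x, s, hs, rfl⟩ := hy
  exact one_eighth_le_norm_blow (mem_Icc_of_endpoint hs) (Or.inr hs)

lemma isLimitOf_denjoy {s : ℝ} (hs : s ∈ Icc (0 : ℝ) 1) :
    IsLimitOf denjoy denjoySet (blow 0 s : UnitAddCircle) where
  mem_iff := mem_denjoySet_iff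
  away _ := norm_of_mem_denjoySet
  isClosed := isClosed_denjoySet
  orbit_away n hn := by
    rw [denjoy_iterate_blow hs]
    refine one_eighth_le_norm_blow hs (Or.inl fun m hm => hn.ne' ?_)
    exact_mod_cast ang_eq_zero (n := n) (m := m) (by exact_mod_cast hm)
  cluster := mapClusterPt_denjoy hs

lemma blow_zero_half : (blow 0 (1 / 2) : UnitAddCircle) = 0 := by
  have : blow 0 (1 / 2) = 0 := by
    simp only [blow, neg_zero]
    ring
  rw [this, AddCircle.coe_zero]

lemma denjoy_iterate_ne {s : ℝ} (hs : s ∈ Icc (0 : ℝ) 1) {n : ℕ} (hn : 0 < n) :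
    denjoy^[n] (blow 0 s : UnitAddCircle) ≠ (blow 0 s : UnitAddCircle) := by
  rw [denjoy_iterate_blow hs]
  intro h
  obtain ⟨m, hm, -⟩ := exists_of_coe_blow_eq hs hs h
  refine hn.ne' ?_
  exact_mod_cast ang_eq_zero (n := n) (m := m) (by rw [zero_add] at hm; exact_mod_cast hm)

lemma preperfect_denjoySet : Preperfect denjoySet := by
  intro l hl
  rw [accPt_iff_nhds]
  intro U hU
  obtain ⟨a, b, hab, h⟩ := exists_interval_nhds hl hU
  obtain ⟨h1, h2⟩ := h ((a + b) / 2) ⟨by linarith, by linarith⟩ 0 (by simp)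
  exact ⟨_, ⟨h1, _, 0, Or.inl rfl, rfl⟩, h2⟩

/-- Every base interval contains a jump, and the midpoint of its gap is not in the set. -/
lemma interior_denjoySet : interior denjoySet = ∅ := by
  rw [eq_empty_iff_forall_notMem]
  intro l hl
  obtain ⟨a, b, hab, h⟩ := exists_interval_nhds (interior_subset hl) (isOpen_interior.mem_nhds hl)
  obtain ⟨n, -, m, hm⟩ := exists_mem_Ioo hab 0
  have hI : (1 / 2 : ℝ) ∈ Icc (0 : ℝ) 1 := by norm_num
  have hj : IsJump (n * ang + m) := ⟨n, m, by push_cast; ring⟩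
  obtain ⟨x, s, hs, heq⟩ := interior_subset (h _ hm _ hI).1
  obtain ⟨-, -, h3⟩ := exists_of_coe_blow_eq hI (mem_Icc_of_endpoint hs) heq
  rcases hs with rfl | rfl
  · exact (blow_lt_of_isJump hj (by norm_num : (0 : ℝ) < 1 / 2)).ne' h3
  · exact (blow_lt_of_isJump hj (by norm_num : (1 / 2 : ℝ) < 1)).ne h3

lemma infinite_denjoySet : denjoySet.Infinite := by
  have : InjOn (fun x : ℝ => (blow x 0 : UnitAddCircle)) (Ico 0 1) := by
    intro x hx y hy heq
    obtain ⟨m, hm, -⟩ := exists_of_coe_blow_eq (by simp) (by simp) heq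
    have h1 : |(m : ℝ)| < 1 := by
      rw [abs_lt]
      constructor <;> linarith [hx.1, hx.2, hy.1, hy.2]
    have h2 : |m| < 1 := by exact_mod_cast h1
    rw [Int.abs_lt_one_iff.1 h2, Int.cast_zero, add_zero] at hm
    exact hm
  refine ((Ico_infinite zero_lt_one).image this).mono ?_
  rintro _ ⟨x, -, rfl⟩
  exact ⟨x, 0, Or.inl rfl, rfl⟩

end DenjoyMap

end SurfaceFlow

namespace SurfaceFlow

/-! ### The ends of the orbit, type by type -/

section Ends

/-- The return map of an end of a given type. -/
noncomputable def GeneralType.endMap : GeneralType → UnitAddCircle ≃ₜ UnitAddCircle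
  | .transverselyCantorQSet => denjoy
  | .quasiQSet => denjoy
  | _ => hyp

/-- The minimal set of the return map of an end. -/
def GeneralType.endSet : GeneralType → Set UnitAddCircle
  | .transverselyCantorQSet => denjoySet
  | .quasiQSet => denjoySet
  | _ => {((1 / 2 : ℝ) : UnitAddCircle)}

/-- The points of an end where the flow is stopped. -/
def GeneralType.slit : GeneralType → Set (ℝ × UnitAddCircle)
  | .nowhereDenseSingular => {(1 / 8, 0)}
  | .limitQuasiCircuit => {1 / 2} ×ˢ {((1 / 2 : ℝ) : UnitAddCircle)}
  | .quasiQSet => {1 / 2} ×ˢ denjoySet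
  | _ => ∅

namespace GeneralType

lemma isLimitOf_endMap (a : GeneralType) : IsLimitOf a.endMap a.endSet 0 := by
  have h : IsLimitOf denjoy denjoySet 0 := by
    have := isLimitOf_denjoy (s := 1 / 2) (by norm_num)
    rwa [blow_zero_half] at this
  cases a
  · exact isLimitOf_hyp
  · exact isLimitOf_hyp
  · exact isLimitOf_hyp
  · exact isLimitOf_hyp
  · exact h
  · exact h

lemma reversible_endMap (a : GeneralType) : Reversible a.endMap := by
  cases a <;> exact reversible_circleHomeo _

lemma hasDisplacement_endMap (a : GeneralType) : HasDisplacement a.endMap := by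
  cases a <;> exact hasDisplacement_circleHomeo _

lemma isCompact_slit (a : GeneralType) : IsCompact a.slit := by
  cases a
  · exact isCompact_singleton
  · exact isCompact_empty
  · exact isCompact_singleton.prod isCompact_singleton
  · exact isCompact_empty
  · exact isCompact_empty
  · exact isCompact_singleton.prod isClosed_denjoySet.isCompact

lemma of_mem_slit {a : GeneralType} {e : ℝ × UnitAddCircle} (he : e ∈ a.slit) :
    e = (1 / 8, 0) ∨ e.1 = 1 / 2 ∧ e.2 ∈ a.endSet := by
  cases a
  · exact Or.inl he
  · exact he.elim
  · exact Or.inr he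
  · exact he.elim
  · exact he.elim
  · exact Or.inr he

end GeneralType

variable {S : Type*} [TopologicalSpace S] [T2Space S] [ChartedSpace (EuclideanHalfSpace 2) S]
  {v u : Flow ℝ S} {Z Zo : Set S} {a : GeneralType} {Λ : ℝ × UnitAddCircle → S}

omit [T2Space S] [ChartedSpace (EuclideanHalfSpace 2) S] in
-- The slits sit at times 1/8 and 1/2, and the stopping set of the other end can meet this cylinder
-- only at Λ(-1/8, 0); injectivity separates all of these from σ = 0.
lemma IsCylinder.zero_notMem (hΛ : IsCylinder v a.endMap Λ) (hZ : Z = Λ '' a.slit ∪ Zo)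
    (hZo : ∀ z, Λ z ∈ Zo → Λ z = Λ (-(1 / 8), 0)) (y : UnitAddCircle) : Λ (0, y) ∉ Z := by
  rw [hZ]
  rintro (⟨⟨σ, y'⟩, he, heq⟩ | h)
  · have h1 : |σ| < 1 ∧ 0 < σ := by
      rcases GeneralType.of_mem_slit he with h | h
      · rw [(Prod.mk.inj h).1]
        norm_num [abs_lt]
      · rw [show σ = 1 / 2 from h.1]
        norm_num [abs_lt]
    have := (hΛ.strip _ _ _ _ (by simpa using h1.1) heq).1
    linarith [h1.2]
  · have := (hΛ.strip _ _ _ _ (by norm_num) (hZo _ h)).1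
    norm_num at this

/-- An end of type `a` has an ω-limit set of type `a`. -/
theorem IsCylinder.holds_omegaSet (hΛ : IsCylinder v a.endMap Λ) (hu : IsTimeChange v u Z)
    (hZc : IsClosed Z) (hZ : Z = Λ '' a.slit ∪ Zo) (hZo : ∀ z, Λ z ∈ Zo → Λ z = Λ (-(1 / 8), 0))
    (hess : ∀ c : C(Circle, S), (∀ θ, c θ =
      Λ (0, (AddCircle.homeomorphCircle (T := 1) one_ne_zero).symm θ)) → IsEssential c)
    (ha : a ≠ .locallyDenseQSet) :
    a.Holds u (omegaSet u (Λ (0, 0))) ∧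
      (a = .nowhereDenseSingular → ∃ p ∈ singularSet u, omegaSet u (Λ (0, 0)) = {p}) := by
  have hL := a.isLimitOf_endMap
  have h0 : (0 : UnitAddCircle) ∉ a.endSet := by
    intro h0
    have := hL.away 0 h0
    rw [norm_zero] at this
    norm_num at this
  have hper : ∀ n, 0 < n → a.endMap^[n] 0 ≠ 0 := by
    intro n hn h
    have := hL.orbit_away n hn
    rw [h, norm_zero] at this
    norm_num at this
  have hcross := hΛ.zero_notMem hZ hZo
  have o1 : ∀ σ, ∀ y ∈ a.endSet, Λ (σ, y) ∉ Zo := by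
    intro σ y hy h
    have h1 : Λ (σ, y) ∈ Λ '' (univ ×ˢ a.endSet) := ⟨_, ⟨trivial, hy⟩, rfl⟩
    rw [hZo _ h, hΛ.mem_image_iff hL.mem_iff hL.away] at h1
    exact h0 h1
  -- The point stopped by the other end lies in the past of Λ(0, 0), and the central orbit is
  -- injective in time.
  have o2 : ∀ s, 0 ≤ s → Λ (s, 0) ∉ Zo := fun s hs h =>
    hΛ.ne_of_aperiodic hL.orbit_away hper (by linarith : s ≠ -(1 / 8)) (hZo _ h)
  have hempty : a.slit = ∅ → (∀ σ, ∀ y ∈ a.endSet, Λ (σ, y) ∉ Z) ∧ ∀ s, 0 ≤ s → Λ (s, 0) ∉ Z := by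
    intro h
    rw [hZ, h, image_empty, empty_union]
    exact ⟨o1, o2⟩
  have hslit : a.slit = {1 / 2} ×ˢ a.endSet → (∀ σ, ∀ y ∈ a.endSet, Λ (σ, y) ∈ Z ↔
      Λ (σ, y) ∈ Λ '' ({1 / 2} ×ˢ a.endSet)) ∧ ∀ s, 0 ≤ s → Λ (s, 0) ∉ Z := by
    intro h
    rw [hZ, h]
    refine ⟨fun σ y hy => or_iff_left (o1 σ y hy), fun s hs => ?_⟩
    rintro (⟨e, he, heq⟩ | h)
    · have h1 : Λ (s, 0) ∈ Λ '' (univ ×ˢ a.endSet) := ⟨e, ⟨trivial, he.2⟩, heq⟩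
      rw [hΛ.mem_image_iff hL.mem_iff hL.away] at h1
      exact h0 h1
    · exact o2 s hs h
  cases a with
  | nowhereDenseSingular =>
    have hmem : Λ (1 / 8, 0) ∈ Z := by
      rw [hZ]
      exact Or.inl ⟨_, rfl, rfl⟩
    have hω : omegaSet u (Λ (0, 0)) = {Λ (1 / 8, 0)} := by
      refine hΛ.omegaSet_eq_singleton hu (by norm_num) hmem fun s hs => ?_
      rw [hZ]
      rintro (⟨e, he, heq⟩ | h)
      · rw [show e = (1 / 8, 0) from he] at heq
        have := (hΛ.strip _ _ _ _ (by
          rw [abs_lt]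
          constructor <;> linarith [hs.1, hs.2]) heq).1
        linarith [hs.2]
      · exact o2 s hs.1 h
    have hsing := hu.mem_singularSet hmem
    refine ⟨?_, fun _ => ⟨_, hsing, hω⟩⟩
    rw [hω]
    exact ⟨singleton_subset_iff.2 hsing, hΛ.isNowhereDense_singleton _⟩
  | limitCycle =>
    obtain ⟨h1, h2⟩ := hempty rfl
    refine ⟨?_, fun h => nomatch h⟩
    rw [hΛ.omegaSet_timeChange_eq hu hL h2]
    exact hΛ.isLimitCycle hu hL (fun σ => h1 σ _ rfl) h2
  | limitQuasiCircuit =>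
    obtain ⟨h1, h2⟩ := hslit rfl
    refine ⟨?_, fun h => nomatch h⟩
    rw [hΛ.omegaSet_timeChange_eq hu hL h2]
    exact hΛ.isLimitQuasiCircuit hyp_ray hL hu h2 h1
  | locallyDenseQSet => exact absurd rfl ha
  | transverselyCantorQSet =>
    obtain ⟨h1, h2⟩ := hempty rfl
    refine ⟨?_, fun h => nomatch h⟩
    rw [hΛ.omegaSet_timeChange_eq hu hL h2]
    -- The recurrent orbit is that of an endpoint of the gap at 0, which lies in the minimal set;
    -- the orbit of the midpoint 0 only accumulates there.
    exact hΛ.isTransverselyCantorQSet hu (isLimitOf_denjoy (by simp)) ⟨0, 0, Or.inl rfl, rfl⟩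
      (fun n hn => denjoy_iterate_ne (by simp) hn) preperfect_denjoySet interior_denjoySet hZc h1
  | quasiQSet =>
    obtain ⟨h1, h2⟩ := hslit rfl
    refine ⟨?_, fun h => nomatch h⟩
    obtain ⟨c, hc, hct⟩ := hΛ.exists_isClosedTransversal hu hZc hcross
    refine ⟨⟨⟨_, Or.inl rfl⟩, c, hct, hess c hc, ?_⟩, ?_⟩
    · rw [hΛ.omegaSet_timeChange_eq hu hL h2]
      have hinj : InjOn (fun y => Λ (0, y)) denjoySet := fun y _ y' _ h =>
        (hΛ.strip _ _ _ _ (by norm_num) h).2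
      refine (infinite_denjoySet.image hinj).mono ?_
      rintro _ ⟨y, hy, rfl⟩
      refine ⟨⟨(0, y), ⟨trivial, hy⟩, rfl⟩, AddCircle.homeomorphCircle one_ne_zero y, ?_⟩
      rw [hc, Homeomorph.symm_apply_apply]
    · rw [hΛ.omegaSet_timeChange_eq hu hL h2]
      exact hΛ.image_subset_singularSet_union hu hL.mem_iff hL.away h1

end Ends

/-! ### Realization of the pairs without locally dense Q-sets -/

section Glued

/-- The flow with an α-limit set of type `a` and an ω-limit set of type `b`. -/
theorem exists_flow_of_ne_locallyDense {a b : GeneralType} (ha : a ≠ .locallyDenseQSet)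
    (hb : b ≠ .locallyDenseQSet) :
    ∃ (S : Type) (_ : TopologicalSpace S) (_ : ChartedSpace (EuclideanHalfSpace 2) S)
      (_ : T2Space S) (_ : CompactSpace S) (u : Flow ℝ S) (x : S),
      ¬ IsClosedPoint u x ∧ a.Holds u (alphaSet u x) ∧ b.Holds u (omegaSet u x) ∧
      (a = .nowhereDenseSingular → ∃ p ∈ singularSet u, alphaSet u x = {p}) ∧
      (b = .nowhereDenseSingular → ∃ p ∈ singularSet u, omegaSet u x = {p}) ∧
      (a.slit.Finite → b.slit.Finite → (singularSet u).Finite) := by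
  -- The positive sheet governs the future of the central orbit and the negative sheet its past.
  let g : Bool → UnitAddCircle ≃ₜ UnitAddCircle := fun i => (cond i b a).endMap
  have hg : ∀ i, Reversible (g i) := fun i => GeneralType.reversible_endMap _
  have hchart := hasPlaneCharts_gluedSurface (g := g)
  let _ := hchart.chartedSpace
  have hmet : TopologicalSpace.MetrizableSpace (GluedSurface g) :=
    TopologicalSpace.metrizableSpace_of_t3_secondCountable _
  have hΛ : IsCylinder (gluedFlow g) b.endMap (cyl g true) := isCylinder_cyl true
  have hM : IsCylinder (gluedFlow g).reverse a.endMap (cylRev hg false) := isCylinder_cylRev hg false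
  set Z : Set (GluedSurface g) := cyl g true '' b.slit ∪ cylRev hg false '' a.slit with hZ
  have hZc : IsClosed Z := ((b.isCompact_slit.image hΛ.continuous).isClosed).union
    (a.isCompact_slit.image hM.continuous).isClosed
  obtain ⟨u, hu⟩ := exists_isTimeChange (gluedFlow g) hZc
  obtain ⟨ψ, hψ⟩ := exists_transverse_coordinate (g := g)
    fun i => GeneralType.hasDisplacement_endMap _
  have hx : cylRev hg false (0, 0) = cyl g true (0, 0) := by rw [cylRev_false_zero, neg_zero]
  -- The two stopping sets can interact only on the central orbit, shared by both cylinders with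
  -- opposite time: what is stopped over an invariant set of one sheet never meets the other sheet.
  have hZo : ∀ z, cyl g true z ∈ cylRev hg false '' a.slit →
      cyl g true z = cyl g true (-(1 / 8), 0) := by
    rintro z ⟨⟨σ, y⟩, he, heq⟩
    rcases GeneralType.of_mem_slit he with h | ⟨-, h⟩
    · rw [← heq, h, cylRev_false_zero]
    · exact absurd heq (cylRev_ne_cyl hg (by decide) a.isLimitOf_endMap.mem_iff
        a.isLimitOf_endMap.away h σ z)
  have hZo' : ∀ z, cylRev hg false z ∈ cyl g true '' b.slit →
      cylRev hg false z = cylRev hg false (-(1 / 8), 0) := by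
    rintro z ⟨⟨σ, y⟩, he, heq⟩
    rcases GeneralType.of_mem_slit he with h | ⟨-, h⟩
    · rw [← heq, h, cylRev_false_zero, neg_neg]
    · refine absurd ?_ (cylRev_ne_cyl hg (b := true) (c := false) (by decide)
        b.isLimitOf_endMap.mem_iff b.isLimitOf_endMap.away h σ z)
      rw [cylRev, heq, cylRev, flip_flip]
  have hω := hΛ.holds_omegaSet hu hZc hZ hZo
    (fun c hc => hchart.isEssential ψ c fun θ => by rw [hc, hψ]) hb
  have hα := hM.holds_omegaSet hu.reverse hZc (hZ.trans (union_comm _ _)) hZo'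
    (fun c hc => hchart.isEssential (ψ.comp ⟨flip hg, continuous_flip hg⟩) c fun θ => by
      rw [hc]
      exact (congrArg ψ (flip_flip hg _)).trans (hψ _ _)) ha
  rw [generalType_holds_reverse, omegaSet_reverse, singularSet_reverse, hx] at hα
  refine ⟨GluedSurface g, inferInstance, hchart.chartedSpace, inferInstance, inferInstance, u,
    cyl g true (0, 0), hΛ.not_isClosedPoint hu b.isLimitOf_endMap.orbit_away
      (hΛ.zero_notMem hZ hZo 0), hα.1, hω.1, hα.2, hω.2, fun h1 h2 => ?_⟩
  exact (((h2.image _).union (h1.image _)).union finite_singularSet_gluedFlow).subset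
    hu.singularSet_subset

end Glued

end SurfaceFlow

namespace SurfaceFlow

/-! ### Locally dense Q-sets on the torus -/

section Torus

/-- The torus. -/
abbrev Torus : Type := UnitAddCircle × UnitAddCircle

lemma hasPlaneCharts_torus : HasPlaneCharts Torus := by
  rintro ⟨x, y⟩
  obtain ⟨a, rfl⟩ := QuotientAddGroup.mk_surjective x
  obtain ⟨b, rfl⟩ := QuotientAddGroup.mk_surjective y
  refine ⟨Ioo (a - 1 / 4) (a + 1 / 4) ×ˢ Ioo (b - 1 / 4) (b + 1 / 4), Prod.map (↑) (↑),
    isOpen_Ioo.prod isOpen_Ioo, (continuous_coe_circle.prodMap continuous_coe_circle).continuousOn,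
    ?_, fun V _ hV => (isOpenMap_coe_circle.prodMap isOpenMap_coe_circle) _ hV, (a, b),
    ⟨⟨by linarith, by linarith⟩, ⟨by linarith, by linarith⟩⟩, rfl⟩
  rintro ⟨a1, a2⟩ ⟨⟨h1, h2⟩, h3, h4⟩ ⟨b1, b2⟩ ⟨⟨h5, h6⟩, h7, h8⟩ hab
  simp only at h1 h2 h3 h4 h5 h6 h7 h8
  obtain ⟨e1, e2⟩ := Prod.mk.inj hab
  exact Prod.ext (coe_circle_injOn (by rw [abs_lt]; constructor <;> linarith) e1)
    (coe_circle_injOn (by rw [abs_lt]; constructor <;> linarith) e2)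

/-- An irrational flow on the torus. -/
noncomputable def torusFlow : Flow ℝ Torus where
  toFun t z := z + ((t : UnitAddCircle), ((t * ang : ℝ) : UnitAddCircle))
  cont' := by
    refine continuous_snd.add ((continuous_coe_circle.comp continuous_fst).prodMk
      (continuous_coe_circle.comp (continuous_fst.mul continuous_const)))
  map_add' s t z := by
    rw [add_mul, AddCircle.coe_add, AddCircle.coe_add, ← Prod.mk_add_mk]
    abel
  map_zero' z := by simp

lemma torusFlow_apply (t : ℝ) (z : Torus) :
    torusFlow t z = z + ((t : UnitAddCircle), ((t * ang : ℝ) : UnitAddCircle)) := rfl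

lemma torusFlow_ne {t : ℝ} (ht : t ≠ 0) (z : Torus) : torusFlow t z ≠ z := by
  rw [torusFlow_apply, Ne, add_eq_left]
  intro h
  obtain ⟨h1, h2⟩ := Prod.mk.inj h
  obtain ⟨n, hn⟩ := AddCircle.coe_eq_zero_iff (p := (1 : ℝ)).1 h1
  obtain ⟨m, hm⟩ := AddCircle.coe_eq_zero_iff (p := (1 : ℝ)).1 h2
  rw [zsmul_eq_mul, mul_one] at hn hm
  rw [← hn] at hm ht
  exact ht (by rw [ang_eq_zero hm.symm, Int.cast_zero])

/-- At the times n + ε s the orbit lies on the circle with first coordinate p and moves there by an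
irrational rotation, whose forward orbits are dense. The sign ε covers both directions of time. -/
lemma omegaSet_of_direction {w : Flow ℝ Torus} {ε : ℝ} (hε : ε = 1 ∨ ε = -1)
    (hw : ∀ t z, w t z = torusFlow (ε * t) z) (z : Torus) : omegaSet w z = univ := by
  rw [eq_univ_iff_forall]
  rintro ⟨p, q⟩
  obtain ⟨x, y⟩ := z
  obtain ⟨s, hs⟩ := QuotientAddGroup.mk_surjective (p - x)
  have hs' : (s : UnitAddCircle) = p - x := hs
  have hεε : ε * ε = 1 := by rcases hε with rfl | rfl <;> norm_num
  rw [mem_omegaSet]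
  simp only [hw]
  have h1 : DenseRange (· • ((ε * ang : ℝ) : UnitAddCircle) : ℤ → UnitAddCircle) := by
    rw [AddCircle.denseRange_zsmul_coe_iff, div_one]
    rcases hε with rfl | rfl
    · rw [one_mul]
      exact irrational_sqrt_two
    · rw [neg_one_mul]
      exact irrational_sqrt_two.neg
  have h2 : MapClusterPt (q - y - ((s * ang : ℝ) : UnitAddCircle)) atTop
      (fun n : ℕ => n • ((ε * ang : ℝ) : UnitAddCircle)) := by
    rw [mapClusterPt_atTop_nsmul_iff_mem_topologicalClosure_zmultiples]
    have : closure ((AddSubgroup.zmultiples ((ε * ang : ℝ) : UnitAddCircle) :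
        Set UnitAddCircle)) = univ := by
      rw [AddSubgroup.coe_zmultiples]
      exact h1.closure_range
    change _ ∈ closure _
    rw [this]
    trivial
  have hc : Continuous fun k : UnitAddCircle => (p, y + ((s * ang : ℝ) : UnitAddCircle) + k) := by
    fun_prop
  have h3 := h2.continuousAt_comp hc.continuousAt
  have h4 : (p, y + ((s * ang : ℝ) : UnitAddCircle) + (q - y - ((s * ang : ℝ) : UnitAddCircle))) =
      (p, q) := by
    congr 1
    abel
  rw [h4] at h3
  refine MapClusterPt.of_comp (φ := fun n : ℕ => (n : ℝ) + ε * s)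
    (tendsto_atTop_add_const_right _ _ tendsto_natCast_atTop_atTop) ?_
  convert h3 using 1
  funext n
  simp only [Function.comp, torusFlow_apply]
  have e1 : ε * (n + ε * s) = s + ε * n := by linear_combination s * hεε
  have e2 : ((ε * n : ℝ) : UnitAddCircle) = 0 := by
    rcases hε with rfl | rfl
    · exact AddCircle.coe_eq_zero_iff (p := (1 : ℝ)).2 ⟨n, by simp⟩
    · exact AddCircle.coe_eq_zero_iff (p := (1 : ℝ)).2 ⟨-n, by simp⟩
  have e3 : n • ((ε * ang : ℝ) : UnitAddCircle) = ((ε * n * ang : ℝ) : UnitAddCircle) := by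
    rw [← AddCircle.coe_nsmul, nsmul_eq_mul]
    ring_nf
  rw [e1, e3, add_mul, AddCircle.coe_add, AddCircle.coe_add, e2, hs', Prod.mk_add_mk]
  congr 1
  · abel
  · abel

lemma omegaSet_torusFlow (z : Torus) : omegaSet torusFlow z = univ :=
  omegaSet_of_direction (Or.inl rfl) (fun t z => by rw [one_mul]) z

lemma alphaSet_torusFlow (z : Torus) : alphaSet torusFlow z = univ := by
  rw [← omegaSet_reverse]
  exact omegaSet_of_direction (Or.inr rfl)
    (fun t z => by rw [neg_one_mul, Flow.reverse_apply]) z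

lemma isLocallyDenseQSet_univ {u : Flow ℝ Torus} {x : Torus} (hx : ¬ IsClosedPoint u x)
    (hω : omegaSet u x = univ) : IsLocallyDenseQSet u univ := by
  refine ⟨⟨x, hx, Or.inl (hω ▸ mem_univ x), ?_⟩, by simp⟩
  exact (eq_univ_of_univ_subset (hω ▸ omegaSet_subset_closure x)).symm

lemma not_isClosedPoint_torusFlow (x : Torus) : ¬ IsClosedPoint torusFlow x := by
  rintro (h | ⟨T, hT, h, -⟩)
  · exact torusFlow_ne one_ne_zero x (h 1)
  · exact torusFlow_ne hT.ne' x h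

/-- If {0} had an interior point, a dense forward orbit starting on the orbit of 0 would return to
0, against aperiodicity. -/
lemma isNowhereDense_singleton_torus : IsNowhereDense ({0} : Set Torus) := by
  rw [IsNowhereDense, closure_singleton, eq_empty_iff_forall_notMem]
  intro p hp
  have h1 : p ∈ omegaSet torusFlow (torusFlow 1 0) := omegaSet_torusFlow _ ▸ mem_univ p
  rw [mem_omegaSet] at h1
  obtain ⟨t, ht, h2⟩ := frequently_atTop.1
    (mapClusterPt_iff_frequently.1 h1 _ (isOpen_interior.mem_nhds hp)) 0
  have h3 : torusFlow t (torusFlow 1 0) = 0 := mem_singleton_iff.1 (interior_subset h2)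
  rw [← Flow.map_add] at h3
  exact torusFlow_ne (by positivity) 0 h3

/-- A flow on the torus with one singular point and a separatrix dense in positive time. -/
theorem exists_flow_torus : ∃ (u : Flow ℝ Torus) (x : Torus), (singularSet u).Finite ∧
    ¬ IsClosedPoint u x ∧ 0 ∈ singularSet u ∧ alphaSet u x = {0} ∧ omegaSet u x = univ := by
  have hmet : TopologicalSpace.MetrizableSpace Torus := inferInstance
  obtain ⟨u, hu⟩ := exists_isTimeChange torusFlow (isClosed_singleton (x := (0 : Torus)))
  have hne : ∀ t : ℝ, t ≠ 0 → torusFlow t 0 ∉ ({0} : Set Torus) := fun t ht => torusFlow_ne ht 0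
  -- The flow is stopped at 0 and the orbit starts one unit of time after 0: backwards it converges
  -- to 0, forwards it never meets 0 again and stays dense.
  have hα := hu.reverse.omegaSet_eq_singleton (x := torusFlow 1 0) (b := 1) one_pos
    (by rw [Flow.reverse_apply, ← Flow.map_add]; simp) (fun s hs => by
      rw [Flow.reverse_apply, ← Flow.map_add]
      exact hne _ (by linarith [hs.2]))
  rw [Flow.reverse_apply, ← Flow.map_add, neg_add_cancel, Flow.map_zero_apply,
    omegaSet_reverse] at hα
  refine ⟨u, torusFlow 1 0, ?_, hu.not_isClosedPoint (hne 1 one_ne_zero)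
    (fun t ht => torusFlow_ne ht _), hu.mem_singularSet rfl, hα, ?_⟩
  · refine (finite_singleton (0 : Torus)).subset (hu.singularSet_subset.trans ?_)
    exact union_subset le_rfl fun z hz => absurd (hz 1) (torusFlow_ne one_ne_zero z)
  · rw [hu.omegaSet_eq, omegaSet_torusFlow]
    intro s hs
    rw [← Flow.map_add]
    exact hne _ (by positivity)

end Torus

/-- The corresponding type for arbitrarily many singular points. -/
def FiniteSingType.toGeneral : FiniteSingType → GeneralType
  | .singularPoint => .nowhereDenseSingular
  | .limitCircuit => .limitCycle
  | .locallyDenseQSet => .locallyDenseQSet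
  | .transverselyCantorQSet => .transverselyCantorQSet

/-- Limit circuits are realized by limit cycles. For singular points the extra clause is needed,
because a nowhere dense set of singular points need not be a single point. -/
lemma FiniteSingType.holds_of_toGeneral {S : Type*} [TopologicalSpace S]
    [ChartedSpace (EuclideanHalfSpace 2) S] {v : Flow ℝ S} {A : Set S} {a : FiniteSingType}
    (h : a.toGeneral.Holds v A)
    (hs : a.toGeneral = .nowhereDenseSingular → ∃ p ∈ singularSet v, A = {p}) : a.Holds v A := by
  cases a with
  | singularPoint => exact hs rfl
  | limitCircuit => exact Or.inl h
  | locallyDenseQSet => exact h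
  | transverselyCantorQSet => exact h

/-- Only the quasi-Q-set is stopped along an infinite set, and it does not occur here; hence
finitely many singular points. -/
lemma FiniteSingType.finite_slit (a : FiniteSingType) : a.toGeneral.slit.Finite := by
  cases a
  · exact finite_singleton _
  · exact finite_empty
  · exact finite_empty
  · exact finite_empty

/-! ### Assembly of the cases -/

section Main

/-- Every pair of types that is not forbidden is realized. -/
theorem exists_flow {a b : GeneralType} (hab : ¬ a.Forbidden b) :
    ∃ (S : Type) (_ : TopologicalSpace S) (_ : ChartedSpace (EuclideanHalfSpace 2) S)
      (_ : T2Space S) (_ : CompactSpace S) (u : Flow ℝ S) (x : S),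
      ¬ IsClosedPoint u x ∧ a.Holds u (alphaSet u x) ∧ b.Holds u (omegaSet u x) ∧
      (a = .nowhereDenseSingular → ∃ p ∈ singularSet u, alphaSet u x = {p}) ∧
      (b = .nowhereDenseSingular → ∃ p ∈ singularSet u, omegaSet u x = {p}) ∧
      (a.slit.Finite → b.slit.Finite → (singularSet u).Finite) := by
  have hchart := hasPlaneCharts_torus
  obtain ⟨u, y, h1, h2, h3, h4, h5⟩ := exists_flow_torus
  have hN : IsNowhereDenseSingular u {0} :=
    ⟨singleton_subset_iff.2 h3, isNowhereDense_singleton_torus⟩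
  have hD := isLocallyDenseQSet_univ h2 h5
  by_cases ha : a = .locallyDenseQSet
  · subst ha
    cases b with
    | nowhereDenseSingular =>
      refine ⟨Torus, inferInstance, hchart.chartedSpace, inferInstance, inferInstance, u.reverse, y,
        by rwa [isClosedPoint_reverse], ?_, ?_, nofun, fun _ => ⟨0, ?_, ?_⟩, fun _ _ => ?_⟩
      · rw [generalType_holds_reverse, alphaSet_reverse, h5]
        exact hD
      · rw [generalType_holds_reverse, omegaSet_reverse, h4]
        exact hN
      · rwa [singularSet_reverse]
      · rw [omegaSet_reverse, h4]
      · rwa [singularSet_reverse]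
    | locallyDenseQSet =>
      have h := isLocallyDenseQSet_univ (not_isClosedPoint_torusFlow 0) (omegaSet_torusFlow 0)
      refine ⟨Torus, inferInstance, hchart.chartedSpace, inferInstance, inferInstance, torusFlow, 0,
        not_isClosedPoint_torusFlow 0, ?_, ?_, nofun, nofun, fun _ _ => ?_⟩
      · rw [alphaSet_torusFlow]
        exact h
      · rw [omegaSet_torusFlow]
        exact h
      · exact finite_empty.subset fun z hz => absurd (hz 1) (torusFlow_ne one_ne_zero z)
    | _ => exact absurd trivial hab
  by_cases hb : b = .locallyDenseQSet
  · subst hb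
    cases a with
    | nowhereDenseSingular =>
      refine ⟨Torus, inferInstance, hchart.chartedSpace, inferInstance, inferInstance, u, y, h2,
        ?_, ?_, fun _ => ⟨0, h3, h4⟩, nofun, fun _ _ => h1⟩
      · rw [h4]
        exact hN
      · rw [h5]
        exact hD
    | locallyDenseQSet => exact absurd rfl ha
    | _ => exact absurd trivial hab
  exact exists_flow_of_ne_locallyDense ha hb

lemma FiniteSingType.not_forbidden_toGeneral {a b : FiniteSingType} (h : ¬ a.Forbidden b) :
    ¬ a.toGeneral.Forbidden b.toGeneral := by
  cases a <;> cases b <;> exact h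

end Main

end SurfaceFlow

theorem mainTheorem8 :
    (∀ a b : SurfaceFlow.FiniteSingType, ¬ SurfaceFlow.FiniteSingType.Forbidden a b →
      ∃ (S : Type) (_ : TopologicalSpace S) (_ : ChartedSpace (EuclideanHalfSpace 2) S)
        (_ : T2Space S) (_ : CompactSpace S) (v : Flow ℝ S) (x : S),
        (SurfaceFlow.singularSet v).Finite ∧ ¬ SurfaceFlow.IsClosedPoint v x ∧
          SurfaceFlow.FiniteSingType.Holds v (SurfaceFlow.alphaSet v x) a ∧
          SurfaceFlow.FiniteSingType.Holds v (SurfaceFlow.omegaSet v x) b) ∧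
    (∀ a b : SurfaceFlow.GeneralType, ¬ SurfaceFlow.GeneralType.Forbidden a b →
      ∃ (S : Type) (_ : TopologicalSpace S) (_ : ChartedSpace (EuclideanHalfSpace 2) S)
        (_ : T2Space S) (_ : CompactSpace S) (v : Flow ℝ S) (x : S),
        ¬ SurfaceFlow.IsClosedPoint v x ∧
          SurfaceFlow.GeneralType.Holds v (SurfaceFlow.alphaSet v x) a ∧
          SurfaceFlow.GeneralType.Holds v (SurfaceFlow.omegaSet v x) b) := by
  constructor
  · intro a b hab
    obtain ⟨S, tS, cS, _, _, u, x, h1, h2, h3, h4, h5, h6⟩ :=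
      SurfaceFlow.exists_flow (SurfaceFlow.FiniteSingType.not_forbidden_toGeneral hab)
    exact ⟨S, tS, cS, ‹_›, ‹_›, u, x, h6 a.finite_slit b.finite_slit, h1,
      SurfaceFlow.FiniteSingType.holds_of_toGeneral h2 h4,
      SurfaceFlow.FiniteSingType.holds_of_toGeneral h3 h5⟩
  · intro a b hab
    obtain ⟨S, tS, cS, _, _, u, x, h1, h2, h3, -⟩ := SurfaceFlow.exists_flow hab
    exact ⟨S, tS, cS, ‹_›, ‹_›, u, x, h1, h2, h3⟩
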